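/- Call a metric space $X$ \emph{GCBA} if it is separable and locally compact, there is $\kappa\in\mathbb{R}$ such that every point of $X$ has a neighbourhood which (with the restricted metric) is a $\mathrm{CAT}(\kappa)$ space, and every local geodesic $\gamma:[a,b]\to X$, $a<b$, extends to a local geodesic on $[a-\varepsilon,b+\varepsilon]$ for some $\varepsilon>0$. Here $\mathrm{CAT}(\kappa)$ spaces are complete, geodesics are isometric embeddings of intervals, and local geodesics are locally isometric embeddings of intervals. For $x\in X$ the space of directions $\Sigma_x$ is the completion of the set of directions of (nonconstant) geodesics starting at $x$, with the angle metric, and the tangent space $T_xX$ is the Euclidean cone over $\Sigma_x$ (a single point if $\Sigma_x=\emptyset$). For $k\in\mathbb{N}$ let $X_{k,0}$ be the set of all $x\in X$ such that $T_xX$ is isometric to a direct product $\mathbb{R}^k\times Y$ for some metric space $Y$, where $\mathbb{R}^k$ is Euclidean and the product carries the metric $\sqrt{d_{\mathbb{R}^k}^2+d_Y^2}$. \textbf{Theorem.} Let $X$ be a GCBA space and let $k\ge 1$ be an integer. Then $X\setminus X_{k,0}$ is a countable union of subsets, each of which is biLipschitz equivalent to a compact subset of $\mathbb{R}^{k-1}$.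 In particular, $X\setminus X_{k,0}$ is countably $(k-1)$-rectifiable, that is, a countable union of Lipschitz images of bounded subsets of $\mathbb{R}^{k-1}$. -/

import Mathlib

open Set Filter Topology

universe u

namespace GCBA

noncomputable section

/-! ### Spaces with an upper curvature bound -/

/-- `γ` restricted to `[0, dist p q]` is a geodesic (an isometric embedding) from `p` to `q`. -/
def IsGeodesicBetween {X : Type*} [MetricSpace X] (γ : ℝ → X) (p q : X) : Prop :=
  γ 0 = p ∧ γ (dist p q) = q ∧
    ∀ s ∈ Icc 0 (dist p q), ∀ t ∈ Icc 0 (dist p q), dist (γ s) (γ t) = |s - t|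

/-- Triangle comparison for the points `p, q, r, x, y` of `X` (with `x` on the side `pq` and `y` on
the side `pr` of a triangle with vertices `p, q, r`) against a model `M` with distance function
`δ`: there are a comparison triangle `p', q', r'` and comparison points `x', y'` on its sides with
`d(x, y) ≤ δ(x', y')`. -/
def NotThicker {X : Type*} [MetricSpace X] {M : Type*} (δ : M → M → ℝ) (p q r x y : X) : Prop :=
  ∃ p' q' r' x' y' : M,
    δ p' q' = dist p q ∧ δ q' r' = dist q r ∧ δ p' r' = dist p r ∧
    δ p' x' = dist p x ∧ δ x' q' = dist x q ∧
    δ p' y' = dist p y ∧ δ y' r' = dist y r ∧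
    dist x y ≤ δ x' y'

/-- The distance function of the round 2-sphere of constant curvature `κ > 0`. -/
def sphereDist (κ : ℝ) (v w : Metric.sphere (0 : EuclideanSpace ℝ (Fin 3)) 1) : ℝ :=
  InnerProductGeometry.angle (v : EuclideanSpace ℝ (Fin 3)) (w : EuclideanSpace ℝ (Fin 3)) / √κ

/-- The distance function of the hyperbolic plane of constant curvature `κ < 0`. -/
def hyperbolicDist (κ : ℝ) (v w : UpperHalfPlane) : ℝ :=
  dist v w / √(-κ)

/-- Triangle comparison with the complete simply connected surface of constant curvature `κ`. -/
def ModelComparison {X : Type*} [MetricSpace X] (κ : ℝ) (p q r x y : X) : Prop :=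
  (0 < κ → NotThicker (sphereDist κ) p q r x y) ∧
  (κ = 0 → NotThicker (fun v w : EuclideanSpace ℝ (Fin 2) => dist v w) p q r x y) ∧
  (κ < 0 → NotThicker (hyperbolicDist κ) p q r x y)

/-- `CAT(κ)` spaces. The diameter of the model surface is `π / √κ` if `κ > 0` and `∞` otherwise.
In the comparison condition, since points at distance less than this diameter are joined by
geodesics, the equation `d(p, x) + d(x, q) = d(p, q)` says exactly that `x` lies on a geodesic
from `p` to `q`; the roles of the vertices are arbitrary, and for two points on
the same side of a triangle there is nothing to compare. -/
structure IsCAT (κ : ℝ) (X : Type*) [MetricSpace X] : Prop where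
  complete : CompleteSpace X
  geodesic : ∀ p q : X, (0 < κ → dist p q < Real.pi / √κ) → ∃ γ : ℝ → X, IsGeodesicBetween γ p q
  comparison : ∀ p q r x y : X,
    (0 < κ → dist p q + dist q r + dist r p < 2 * (Real.pi / √κ)) →
    dist p x + dist x q = dist p q → dist p y + dist y r = dist p r →
    ModelComparison κ p q r x y

/-- Every point has a `CAT(κ)` neighbourhood (with the restricted metric). -/
def CurvatureLE (κ : ℝ) (X : Type*) [MetricSpace X] : Prop :=
  ∀ x : X, ∃ U ∈ 𝓝 x, IsCAT κ U

/-! ### Local geodesic completeness and GCBA spaces -/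

/-- `γ` restricted to `[a, b]` is a local geodesic. -/
def IsLocalGeodesicOn {X : Type*} [MetricSpace X] (γ : ℝ → X) (a b : ℝ) : Prop :=
  ∀ t ∈ Icc a b, ∃ ε > 0, ∀ s ∈ Icc a b ∩ Ioo (t - ε) (t + ε),
    ∀ s' ∈ Icc a b ∩ Ioo (t - ε) (t + ε), dist (γ s) (γ s') = |s - s'|

/-- Every local geodesic on `[a, b]`, `a < b`, extends as a local geodesic to some
`[a - ε, b + ε]`. -/
def LocallyGeodesicallyComplete (X : Type*) [MetricSpace X] : Prop :=
  ∀ (γ : ℝ → X) (a b : ℝ), a < b → IsLocalGeodesicOn γ a b →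
    ∃ ε > 0, ∃ γ' : ℝ → X, EqOn γ' γ (Icc a b) ∧ IsLocalGeodesicOn γ' (a - ε) (b + ε)

/-- GCBA spaces: separable, locally compact, locally geodesically complete metric spaces with
curvature bounded above. -/
structure IsGCBA (X : Type*) [MetricSpace X] : Prop where
  separable : TopologicalSpace.SeparableSpace X
  locallyCompact : LocallyCompactSpace X
  curvature : ∃ κ : ℝ, CurvatureLE κ X
  complete : LocallyGeodesicallyComplete X

/-! ### Angles and the space of directions -/

/-- A (nonconstant) geodesic starting at `x`; only its values on `[0, length]` matter. -/
structure GeodesicFrom {X : Type u} [MetricSpace X] (x : X) where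
  toFun : ℝ → X
  length : ℝ
  length_pos : 0 < length
  start : toFun 0 = x
  isometric : ∀ s ∈ Icc 0 length, ∀ t ∈ Icc 0 length, dist (toFun s) (toFun t) = |s - t|

/-- The angle between the sides of lengths `s` and `t` in a Euclidean triangle whose third side has
length `d`. -/
def comparisonAngle (s t d : ℝ) : ℝ := Real.arccos ((s ^ 2 + t ^ 2 - d ^ 2) / (2 * s * t))

/-- The (Alexandrov, upper) angle between two geodesics starting at the same point; in a space with
an upper curvature bound the upper limit is a limit. -/
def angle {X : Type u} [MetricSpace X] {x : X} (γ η : GeodesicFrom x) : ℝ :=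
  limsup (fun p : ℝ × ℝ => comparisonAngle p.1 p.2 (dist (γ.toFun p.1) (η.toFun p.2)))
    (𝓝[>] (0 : ℝ) ×ˢ 𝓝[>] (0 : ℝ))

/-- The third side of a Euclidean triangle with two sides of lengths `s, t` enclosing the angle
`θ`. -/
def lawOfCosines (s t θ : ℝ) : ℝ := √(s ^ 2 + t ^ 2 - 2 * s * t * Real.cos θ)

lemma law_arg_nonneg {s t : ℝ} (hs : 0 ≤ s) (ht : 0 ≤ t) (θ : ℝ) :
    0 ≤ s ^ 2 + t ^ 2 - 2 * s * t * Real.cos θ := by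
  nlinarith [Real.cos_le_one θ, mul_nonneg hs ht, sq_nonneg (s - t)]

lemma comparisonAngle_mem (s t d : ℝ) : comparisonAngle s t d ∈ Icc 0 Real.pi :=
  ⟨Real.arccos_nonneg _, Real.arccos_le_pi _⟩

lemma comparisonAngle_comm (s t d : ℝ) : comparisonAngle s t d = comparisonAngle t s d := by
  unfold comparisonAngle; congr 1; ring

lemma lt_law_of_comparisonAngle_lt {s t d θ : ℝ} (hs : 0 < s) (ht : 0 < t)
    (hθ : θ ≤ Real.pi) (h1 : |s - t| ≤ d) (h : comparisonAngle s t d < θ) :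
    d < lawOfCosines s t θ := by
  have hst : 0 < 2 * s * t := by positivity
  have hsq : (s - t) ^ 2 ≤ d ^ 2 := by
    rw [← sq_abs (s - t)]; exact pow_le_pow_left₀ (abs_nonneg _) h1 2
  have hle : (s ^ 2 + t ^ 2 - d ^ 2) / (2 * s * t) ≤ 1 := by
    rw [div_le_one hst]; nlinarith
  have h0 := (comparisonAngle_mem s t d).1
  have hc : Real.cos θ < Real.cos (comparisonAngle s t d) :=
    Real.cos_lt_cos_of_nonneg_of_le_pi h0 hθ h
  unfold lawOfCosines
  apply Real.lt_sqrt_of_sq_lt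
  by_cases hm : -1 ≤ (s ^ 2 + t ^ 2 - d ^ 2) / (2 * s * t)
  · rw [comparisonAngle, Real.cos_arccos hm hle, lt_div_iff₀ hst] at hc
    linarith
  · exfalso
    have : comparisonAngle s t d = Real.pi := Real.arccos_of_le_neg_one (not_le.1 hm).le
    linarith

lemma law_lt_of_lt_comparisonAngle {s t d θ : ℝ} (hs : 0 < s) (ht : 0 < t) (hd : 0 ≤ d)
    (hθ : 0 ≤ θ) (h1 : d ≤ s + t) (h : θ < comparisonAngle s t d) :
    lawOfCosines s t θ < d := by
  have hst : 0 < 2 * s * t := by positivity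
  have hge : -1 ≤ (s ^ 2 + t ^ 2 - d ^ 2) / (2 * s * t) := by
    rw [le_div_iff₀ hst]; nlinarith
  have hpi := (comparisonAngle_mem s t d).2
  have hc : Real.cos (comparisonAngle s t d) < Real.cos θ :=
    Real.cos_lt_cos_of_nonneg_of_le_pi hθ hpi h
  have hm : (s ^ 2 + t ^ 2 - d ^ 2) / (2 * s * t) ≤ 1 := by
    by_contra hm
    have : comparisonAngle s t d = 0 := Real.arccos_of_one_le (not_le.1 hm).le
    linarith
  rw [comparisonAngle, Real.cos_arccos hge hm, div_lt_iff₀ hst] at hc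
  have hsq : s ^ 2 + t ^ 2 - 2 * s * t * Real.cos θ < d ^ 2 := by linarith
  unfold lawOfCosines
  calc _ < √(d ^ 2) := Real.sqrt_lt_sqrt (law_arg_nonneg hs.le ht.le θ) hsq
    _ = d := Real.sqrt_sq hd

lemma exists_split {s w α β : ℝ} (hs : 0 < s) (hw : 0 < w) (hα : 0 < α) (hβ : 0 < β)
    (h : α + β < Real.pi) :
    ∃ t, 0 < t ∧ t ≤ max s w ∧
      lawOfCosines s t α + lawOfCosines t w β = lawOfCosines s w (α + β) := by
  have sα : 0 < Real.sin α := Real.sin_pos_of_pos_of_lt_pi hα (by linarith)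
  have sβ : 0 < Real.sin β := Real.sin_pos_of_pos_of_lt_pi hβ (by linarith)
  have sαβ : 0 < Real.sin (α + β) := Real.sin_pos_of_pos_of_lt_pi (by linarith) h
  set D := s * Real.sin α + w * Real.sin β with hD
  have hDpos : 0 < D := by positivity
  set t := s * w * Real.sin (α + β) / D with ht
  set a := w * Real.sin β / D with ha
  set b := s * Real.sin α / D with hb
  have hapos : 0 < a := by positivity
  have hbpos : 0 < b := by positivity
  have htpos : 0 < t := by positivity
  have hab : a + b = 1 := by
    rw [ha, hb, ← add_div, hD]; rw [div_eq_one_iff_eq (by positivity)]; ring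
  have e1 : t * Real.cos α = a * s + b * w * Real.cos (α + β) := by
    have := Real.sin_sq_add_cos_sq α
    rw [ht, ha, hb]; field_simp
    rw [Real.sin_add, Real.cos_add]
    linear_combination (Real.sin β) * this
  have e2 : t * Real.sin α = b * w * Real.sin (α + β) := by
    rw [ht, hb]; field_simp
  have e3 := Real.sin_sq_add_cos_sq α
  have e4 := Real.sin_sq_add_cos_sq (α + β)
  have hcβ : Real.cos β =
      Real.cos (α + β) * Real.cos α + Real.sin (α + β) * Real.sin α := by
    rw [← Real.cos_sub]; congr 1; ring
  have htt : t ^ 2 = (a * s + b * w * Real.cos (α + β)) ^ 2 + (b * w * Real.sin (α + β)) ^ 2 := by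
    rw [← e1, ← e2]; linear_combination (-t ^ 2) * e3
  have ha' : a = 1 - b := by linarith
  have l1 : lawOfCosines s t α = b * lawOfCosines s w (α + β) := by
    unfold lawOfCosines
    have key : ∀ z, b * √z = √(b ^ 2 * z) := fun z => by
      rw [Real.sqrt_mul (sq_nonneg b), Real.sqrt_sq hbpos.le]
    rw [key]
    congr 1
    have : 2 * s * t * Real.cos α = 2 * s * (a * s + b * w * Real.cos (α + β)) := by
      rw [← e1]; ring
    rw [this, htt, ha']
    linear_combination (b ^ 2 * w ^ 2) * e4
  have l2 : lawOfCosines t w β = a * lawOfCosines s w (α + β) := by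
    unfold lawOfCosines
    have key : ∀ z, a * √z = √(a ^ 2 * z) := fun z => by
      rw [Real.sqrt_mul (sq_nonneg a), Real.sqrt_sq hapos.le]
    rw [key]
    congr 1
    have : 2 * t * w * Real.cos β = 2 * w * ((a * s + b * w * Real.cos (α + β)) *
        Real.cos (α + β) + (b * w * Real.sin (α + β)) * Real.sin (α + β)) := by
      rw [← e1, ← e2, hcβ]; ring
    have hb' : b = 1 - a := by linarith
    rw [this, htt, hb']
    linear_combination (w ^ 2 * (1 - a) ^ 2 - 2 * w ^ 2 * (1 - a)) * e4
  refine ⟨t, htpos, ?_, ?_⟩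
  · have h1 : t ^ 2 ≤ (a * s + b * w) ^ 2 := by
      have hc := Real.cos_le_one (α + β)
      have hpos : 0 ≤ 2 * (a * s) * (b * w) := by positivity
      have : t ^ 2 = (a * s) ^ 2 + (b * w) ^ 2 + 2 * (a * s) * (b * w) * Real.cos (α + β) := by
        rw [htt]; linear_combination (b ^ 2 * w ^ 2) * e4
      rw [this]; nlinarith [mul_le_mul_of_nonneg_left hc hpos]
    have h2 : t ≤ a * s + b * w := le_of_sq_le_sq h1 (by positivity)
    calc t ≤ a * s + b * w := h2
      _ ≤ a * max s w + b * max s w := by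
        gcongr
        · exact le_max_left _ _
        · exact le_max_right _ _
      _ = max s w := by rw [← add_mul, hab, one_mul]
  · rw [l1, l2, ← add_mul, add_comm b a, hab, one_mul]

section Angle

variable {X : Type u} [MetricSpace X] {x : X}

lemma GeodesicFrom.dist_start (γ : GeodesicFrom x) {s : ℝ} (hs : s ∈ Icc 0 γ.length) :
    dist (γ.toFun s) x = s := by
  have := γ.isometric s hs 0 ⟨le_rfl, γ.length_pos.le⟩
  rwa [γ.start, sub_zero, abs_of_nonneg hs.1] at this

lemma dist_geodesics (γ η : GeodesicFrom x) {s t : ℝ} (hs : s ∈ Icc 0 γ.length)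
    (ht : t ∈ Icc 0 η.length) :
    |s - t| ≤ dist (γ.toFun s) (η.toFun t) ∧ dist (γ.toFun s) (η.toFun t) ≤ s + t := by
  have h1 := γ.dist_start hs
  have h2 := η.dist_start ht
  constructor
  · have := abs_dist_sub_le (γ.toFun s) (η.toFun t) x
    rwa [h1, h2] at this
  · calc _ ≤ dist (γ.toFun s) x + dist x (η.toFun t) := dist_triangle _ _ _
      _ = s + t := by rw [h1, dist_comm, h2]

lemma eventually_small {l : ℝ} (hl : 0 < l) {m : ℝ} (hm : 0 < m) :
    ∀ᶠ p : ℝ × ℝ in 𝓝[>] (0 : ℝ) ×ˢ 𝓝[>] (0 : ℝ), p.1 ∈ Ioo 0 l ∧ p.2 ∈ Ioo 0 m :=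
  Eventually.prod_mk (pa := fun s => s ∈ Ioo 0 l) (pb := fun s => s ∈ Ioo 0 m)
    (Ioo_mem_nhdsGT hl) (Ioo_mem_nhdsGT hm)

lemma bdd_above_angle (f : ℝ × ℝ → ℝ) (L : Filter (ℝ × ℝ)) :
    L.IsBoundedUnder (· ≤ ·) (fun p : ℝ × ℝ => comparisonAngle p.1 p.2 (f p)) :=
  isBoundedUnder_of ⟨Real.pi, fun _ => (comparisonAngle_mem _ _ _).2⟩

lemma bdd_below_angle (f : ℝ × ℝ → ℝ) (L : Filter (ℝ × ℝ)) :
    L.IsBoundedUnder (· ≥ ·) (fun p : ℝ × ℝ => comparisonAngle p.1 p.2 (f p)) :=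
  isBoundedUnder_of ⟨0, fun _ => (comparisonAngle_mem _ _ _).1⟩

lemma angle_nonneg (γ η : GeodesicFrom x) : 0 ≤ angle γ η :=
  le_limsup_of_frequently_le
    (Frequently.of_forall fun _ => (comparisonAngle_mem _ _ _).1) (bdd_above_angle _ _)

lemma angle_le_pi (γ η : GeodesicFrom x) : angle γ η ≤ Real.pi :=
  limsup_le_of_le (bdd_below_angle _ _).isCoboundedUnder_flip
    (Eventually.of_forall fun _ => (comparisonAngle_mem _ _ _).2)

lemma angle_self (γ : GeodesicFrom x) : angle γ γ = 0 := by
  unfold angle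
  rw [limsup_congr (v := fun _ => (0 : ℝ)) ?_, limsup_const]
  filter_upwards [eventually_small γ.length_pos γ.length_pos] with p hp
  obtain ⟨⟨h1, h2⟩, h3, h4⟩ := hp
  rw [γ.isometric _ ⟨h1.le, h2.le⟩ _ ⟨h3.le, h4.le⟩, comparisonAngle, sq_abs]
  have : (p.1 ^ 2 + p.2 ^ 2 - (p.1 - p.2) ^ 2) / (2 * p.1 * p.2) = 1 := by
    rw [div_eq_one_iff_eq (by positivity)]; ring
  rw [this, Real.arccos_one]

lemma angle_comm (γ η : GeodesicFrom x) : angle γ η = angle η γ := by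
  unfold angle
  conv_rhs => rw [prod_comm, limsup, map_map]
  rw [limsup]
  congr 2
  funext p
  simp only [Function.comp, Prod.fst_swap, Prod.snd_swap]
  rw [comparisonAngle_comm, dist_comm]

lemma eventually_lt_of_angle_lt {γ η : GeodesicFrom x} {c : ℝ} (h : angle γ η < c) :
    ∃ ε > 0, ∀ s ∈ Ioo 0 ε, ∀ t ∈ Ioo 0 ε,
      comparisonAngle s t (dist (γ.toFun s) (η.toFun t)) < c := by
  have := eventually_lt_of_limsup_lt h (bdd_above_angle _ _)
  obtain ⟨pa, ha, pb, hb, hab⟩ := eventually_prod_iff.1 this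
  obtain ⟨a, ha0, ha'⟩ := mem_nhdsGT_iff_exists_Ioo_subset.1 ha
  obtain ⟨b, hb0, hb'⟩ := mem_nhdsGT_iff_exists_Ioo_subset.1 hb
  exact ⟨min a b, lt_min ha0 hb0, fun s hs t ht =>
    hab (ha' ⟨hs.1, hs.2.trans_le (min_le_left _ _)⟩)
      (hb' ⟨ht.1, ht.2.trans_le (min_le_right _ _)⟩)⟩

lemma angle_triangle (γ η ζ : GeodesicFrom x) : angle γ ζ ≤ angle γ η + angle η ζ := by
  by_contra! hlt
  set A := angle γ η
  set B := angle η ζ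
  set C := angle γ ζ
  set e := (C - A - B) / 3 with he
  have hA : 0 ≤ A := angle_nonneg _ _
  have hB : 0 ≤ B := angle_nonneg _ _
  have hC : C ≤ Real.pi := angle_le_pi _ _
  have he0 : 0 < e := by rw [he]; linarith
  have hsum : (A + e) + (B + e) < C := by linarith
  obtain ⟨ε₁, hε₁, h₁⟩ := eventually_lt_of_angle_lt (show angle γ η < A + e by linarith)
  obtain ⟨ε₂, hε₂, h₂⟩ := eventually_lt_of_angle_lt (show angle η ζ < B + e by linarith)
  have hfr := frequently_lt_of_lt_limsup (bdd_below_angle _ _).isCoboundedUnder_flip hsum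
  set ε := min (min ε₁ ε₂) (min γ.length (min η.length ζ.length)) with hεdef
  have hε : 0 < ε := lt_min (lt_min hε₁ hε₂)
    (lt_min γ.length_pos (lt_min η.length_pos ζ.length_pos))
  obtain ⟨⟨s, w⟩, hsw, ⟨hs0, hs1⟩, hw0, hw1⟩ :=
    (hfr.and_eventually (eventually_small hε hε)).exists
  simp only at hsw hs0 hs1 hw0 hw1
  obtain ⟨t, ht0, ht1, hsplit⟩ := exists_split hs0 hw0 (show 0 < A + e by linarith)
    (show 0 < B + e by linarith) (by linarith)
  have ht2 : t < ε := ht1.trans_lt (max_lt hs1 hw1)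
  have b1 : ε ≤ ε₁ := (min_le_left _ _).trans (min_le_left _ _)
  have b2 : ε ≤ ε₂ := (min_le_left _ _).trans (min_le_right _ _)
  have b3 : ε ≤ γ.length := (min_le_right _ _).trans (min_le_left _ _)
  have b4 : ε ≤ η.length := (min_le_right _ _).trans ((min_le_right _ _).trans (min_le_left _ _))
  have b5 : ε ≤ ζ.length := (min_le_right _ _).trans ((min_le_right _ _).trans (min_le_right _ _))
  have ms : s ∈ Icc 0 γ.length := ⟨hs0.le, by linarith⟩
  have mt : t ∈ Icc 0 η.length := ⟨ht0.le, by linarith⟩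
  have mw : w ∈ Icc 0 ζ.length := ⟨hw0.le, by linarith⟩
  have k1 := lt_law_of_comparisonAngle_lt hs0 ht0 (by linarith)
    (dist_geodesics γ η ms mt).1 (h₁ s ⟨hs0, by linarith⟩ t ⟨ht0, by linarith⟩)
  have k2 := lt_law_of_comparisonAngle_lt ht0 hw0 (by linarith)
    (dist_geodesics η ζ mt mw).1 (h₂ t ⟨ht0, by linarith⟩ w ⟨hw0, by linarith⟩)
  have k3 := law_lt_of_lt_comparisonAngle hs0 hw0 dist_nonneg (by linarith)
    (dist_geodesics γ ζ ms mw).2 hsw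
  have k4 := dist_triangle (γ.toFun s) (η.toFun t) (ζ.toFun w)
  linarith

end Angle

/-- The angle is a pseudometric on the set of geodesics starting at `x`. -/
instance {X : Type u} [MetricSpace X] (x : X) : PseudoMetricSpace (GeodesicFrom x) where
  dist := angle
  dist_self := angle_self
  dist_comm := angle_comm
  dist_triangle := angle_triangle

/-- The space of directions at `x`: the completion of the set of geodesic directions (that is, of
geodesics starting at `x`, geodesics enclosing a zero angle being identified) with the angle
metric. The completion is the Hausdorff one, so it performs the identification. -/
abbrev SpaceOfDirections {X : Type u} [MetricSpace X] (x : X) : Type u :=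
  UniformSpace.Completion (GeodesicFrom x)

/-! ### Euclidean cones and tangent spaces -/

/-- The underlying set `[0, ∞) × S / {0} × S` of the Euclidean cone over `S`: an apex and the points
`(t, v)` with `t > 0`, `v ∈ S`. The cone over the empty set is a point. -/
inductive EuclideanCone (S : Type u) : Type u
  | apex : EuclideanCone S
  | point (t : ℝ) (ht : 0 < t) (v : S) : EuclideanCone S

namespace EuclideanCone

variable {S : Type u} [MetricSpace S]

/-- The cone metric. -/
def coneDist : EuclideanCone S → EuclideanCone S → ℝ
  | apex, apex => 0
  | apex, point t _ _ => t
  | point t _ _, apex => t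
  | point s _ v, point t _ w => lawOfCosines s t (min (dist v w) Real.pi)

lemma law_comm (s t θ : ℝ) : lawOfCosines s t θ = lawOfCosines t s θ := by
  unfold lawOfCosines; congr 1; ring

lemma law_mono {s t θ θ' : ℝ} (hs : 0 ≤ s) (ht : 0 ≤ t) (h0 : 0 ≤ θ) (h : θ ≤ θ')
    (hpi : θ' ≤ Real.pi) : lawOfCosines s t θ ≤ lawOfCosines s t θ' := by
  unfold lawOfCosines
  apply Real.sqrt_le_sqrt
  have := Real.cos_le_cos_of_nonneg_of_le_pi h0 hpi h
  nlinarith [mul_nonneg hs ht]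

lemma law_eq_norm (s t a b : ℝ) :
    lawOfCosines s t (b - a) =
      ‖(⟨s * Real.cos a - t * Real.cos b, s * Real.sin a - t * Real.sin b⟩ : ℂ)‖ := by
  rw [Complex.norm_def, Complex.normSq_mk, lawOfCosines, Real.cos_sub]
  congr 1
  linear_combination (-s ^ 2) * Real.sin_sq_add_cos_sq a - t ^ 2 * Real.sin_sq_add_cos_sq b

lemma law_triangle_aux (s t w α β : ℝ) :
    lawOfCosines s w (α + β) ≤ lawOfCosines s t α + lawOfCosines t w β := by
  have h1 := law_eq_norm s t 0 α
  have h2 := law_eq_norm t w α (α + β)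
  have h3 := law_eq_norm s w 0 (α + β)
  rw [sub_zero] at h1 h3
  rw [add_sub_cancel_left] at h2
  rw [h1, h2, h3]
  refine le_trans (le_of_eq ?_) (norm_add_le _ _)
  congr 1
  apply Complex.ext
  · simp
  · simp; ring

lemma law_triangle {s t w α β γ : ℝ} (hs : 0 ≤ s) (ht : 0 ≤ t) (hw : 0 ≤ w)
    (hα : α ∈ Icc 0 Real.pi) (hβ : β ∈ Icc 0 Real.pi) (hγ : γ ∈ Icc 0 Real.pi)
    (h : γ ≤ α + β) :
    lawOfCosines s w γ ≤ lawOfCosines s t α + lawOfCosines t w β := by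
  have hb : 0 ≤ min β (Real.pi - α) := le_min hβ.1 (by linarith [hα.2])
  calc lawOfCosines s w γ ≤ lawOfCosines s w (α + min β (Real.pi - α)) := by
        apply law_mono hs hw hγ.1
        · rw [← min_add_add_left]; exact le_min h (by linarith [hγ.2])
        · linarith [min_le_right β (Real.pi - α)]
    _ ≤ lawOfCosines s t α + lawOfCosines t w (min β (Real.pi - α)) := law_triangle_aux _ _ _ _ _
    _ ≤ _ := by
        gcongr
        exact law_mono ht hw hb (min_le_left _ _) hβ.2

lemma abs_sub_le_law {s t : ℝ} (hs : 0 ≤ s) (ht : 0 ≤ t) (θ : ℝ) :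
    |s - t| ≤ lawOfCosines s t θ := by
  unfold lawOfCosines
  rw [← Real.sqrt_sq_eq_abs]
  apply Real.sqrt_le_sqrt
  nlinarith [Real.cos_le_one θ, mul_nonneg hs ht]

lemma law_le_add {s t : ℝ} (hs : 0 ≤ s) (ht : 0 ≤ t) (θ : ℝ) :
    lawOfCosines s t θ ≤ s + t := by
  unfold lawOfCosines
  rw [Real.sqrt_le_left (by positivity)]
  nlinarith [Real.neg_one_le_cos θ, mul_nonneg hs ht]

lemma min_mem (v w : S) : min (dist v w) Real.pi ∈ Icc 0 Real.pi :=
  ⟨le_min dist_nonneg Real.pi_pos.le, min_le_right _ _⟩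

lemma coneDist_self (p : EuclideanCone S) : coneDist p p = 0 := by
  cases p with
  | apex => rfl
  | point t ht v =>
    simp only [coneDist, lawOfCosines, dist_self, min_eq_left Real.pi_pos.le, Real.cos_zero]
    rw [show t ^ 2 + t ^ 2 - 2 * t * t * 1 = 0 by ring, Real.sqrt_zero]

lemma coneDist_comm (p q : EuclideanCone S) : coneDist p q = coneDist q p := by
  cases p <;> cases q <;> simp only [coneDist]
  rw [law_comm, dist_comm]

lemma coneDist_triangle (p q r : EuclideanCone S) :
    coneDist p r ≤ coneDist p q + coneDist q r := by
  cases p with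
  | apex =>
    cases q with
    | apex => cases r <;> simp [coneDist]
    | point t ht v =>
      cases r with
      | apex => simp only [coneDist]; linarith
      | point w hw u =>
        simp only [coneDist]
        have := (abs_le.1 (abs_sub_le_law ht.le hw.le (min (dist v u) Real.pi))).1
        linarith
  | point s hs z =>
    cases q with
    | apex =>
      cases r with
      | apex => simp [coneDist]
      | point w hw u => exact law_le_add hs.le hw.le _
    | point t ht v =>
      cases r with
      | apex =>
        simp only [coneDist]
        have := (abs_le.1 (abs_sub_le_law hs.le ht.le (min (dist z v) Real.pi))).2
        linarith
      | point w hw u =>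
        refine law_triangle hs.le ht.le hw.le (min_mem _ _) (min_mem _ _) (min_mem _ _) ?_
        have h1 := dist_triangle z v u
        have h2 : (0 : ℝ) ≤ dist z v := dist_nonneg
        have h3 : (0 : ℝ) ≤ dist v u := dist_nonneg
        have h4 := Real.pi_pos
        rcases le_total (dist z v) Real.pi with a | a <;>
        rcases le_total (dist v u) Real.pi with b | b <;>
        rcases le_total (dist z u) Real.pi with c | c <;>
        simp only [min_eq_left, min_eq_right, a, b, c] <;> linarith

lemma eq_of_coneDist_eq_zero {p q : EuclideanCone S} (h : coneDist p q = 0) : p = q := by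
  cases p with
  | apex =>
    cases q with
    | apex => rfl
    | point t ht v => simp only [coneDist] at h; exact absurd h ht.ne'
  | point s hs z =>
    cases q with
    | apex => simp only [coneDist] at h; exact absurd h hs.ne'
    | point t ht v =>
      simp only [coneDist] at h
      have hst : s = t := by
        have := abs_sub_le_law hs.le ht.le (min (dist z v) Real.pi)
        rw [h] at this
        exact sub_eq_zero.1 (abs_nonpos_iff.1 this)
      subst hst
      unfold lawOfCosines at h
      rw [Real.sqrt_eq_zero (law_arg_nonneg hs.le hs.le _)] at h
      have hc : Real.cos (min (dist z v) Real.pi) = Real.cos 0 := by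
        rw [Real.cos_zero]
        have : 2 * s ^ 2 * (1 - Real.cos (min (dist z v) Real.pi)) = 0 := by linarith
        rcases mul_eq_zero.1 this with h' | h'
        · exact absurd h' (by positivity)
        · linarith
      have h0 := Real.injOn_cos (min_mem z v) ⟨le_rfl, Real.pi_pos.le⟩ hc
      have hd : dist z v = 0 := by
        rcases min_choice (dist z v) Real.pi with h' | h'
        · rw [← h', h0]
        · exact absurd (h'.symm.trans h0) Real.pi_pos.ne'
      rw [dist_eq_zero.1 hd]

instance : MetricSpace (EuclideanCone S) where
  dist := coneDist
  dist_self := coneDist_self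
  dist_comm := coneDist_comm
  dist_triangle := coneDist_triangle
  eq_of_dist_eq_zero := eq_of_coneDist_eq_zero

end EuclideanCone

/-- The tangent space at `x`: the Euclidean cone over the space of directions. -/
abbrev TangentSpace {X : Type u} [MetricSpace X] (x : X) : Type u :=
  EuclideanCone (SpaceOfDirections x)

/-! ### Strained points and biLipschitz equivalence -/

/-- The metric space `T` is isometric to a direct product of `ℝ ^ k` and a metric space `Y`, with
the product metric `√(d₁² + d₂²)`. -/
def SplitsOff (k : ℕ) (T : Type u) [MetricSpace T] : Prop :=
  ∃ (Y : Type u) (_ : MetricSpace Y), Nonempty (T ≃ᵢ WithLp 2 (EuclideanSpace ℝ (Fin k) × Y))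

/-- The set of `(k, 0)`-strained points. -/
def strainedSet (k : ℕ) (X : Type u) [MetricSpace X] : Set X :=
  {x | SplitsOff k (TangentSpace x)}

/-- There is a bijection which is an `L`-biLipschitz map for some `L`. -/
def BiLipschitzEquivalent {X Y : Type*} [MetricSpace X] [MetricSpace Y] (A : Set X) (K : Set Y) :
    Prop :=
  ∃ (e : A ≃ K) (L : ℝ), 0 < L ∧
    ∀ a b : A, 1 / L * dist a b ≤ dist (e a) (e b) ∧ dist (e a) (e b) ≤ L * dist a b

/-- `S` is a countable union of Lipschitz images of bounded subsets of `ℝ ^ m`. -/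
def CountablyRectifiable (m : ℕ) {X : Type*} [MetricSpace X] (S : Set X) : Prop :=
  ∃ (B : ℕ → Set (EuclideanSpace ℝ (Fin m))) (f : (i : ℕ) → B i → X),
    (∀ i, Bornology.IsBounded (B i)) ∧ (∀ i, ∃ L, LipschitzWith L (f i)) ∧
    S = ⋃ i, range (f i)

end

end GCBA

/-!
# Points without a Euclidean factor in a GCBA space

At a point `x` outside the strained set the tangent space splits off `ℝ ^ l` but not `ℝ ^ (l + 1)`
for some `l < k`. There are two ideas: the points of this kind are separated from each other by `l`
distance functions, and being strained is an open condition.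

*Blow-up.* Around every point there is a small compact ball in which geodesics exist and can be
extended, and in which midpoints satisfy the `CAT(0)` inequality up to an error of higher order
(`NiceBall`, `IsGCBA.exists_niceBall`). Comparison gives a law of cosines in both directions along
geodesics starting at `x`, uniformly as the scale tends to `0`, so that the rescaled balls converge
to the tangent space (`NiceBall.eventually_blowUp`). Hence the space of directions is compact, and
the tangent space is a `CAT(0)` cone (`NiceBall.hasMidpoints`).

*Splitting.* In such a cone a factor `ℝ ^ k` is the same as an orthonormal frame of `k` vectors
having opposites, where opposite means that the parallelogram law holds (`FlatFrame.splitsOff`,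
`exists_flatFrame`): a pair of opposites generates translations of the cone. The frame condition,
up to an error `δ` and at a scale smaller than `δ`, is a condition on finitely many points of `X`
and on a ball; it defines `strainedNear k δ X`. It is stable under small perturbations of the point
(`strainedNear_subset_interior`), and the tangent space splits off `ℝ ^ k` if and only if the
condition holds for every `δ` (`NiceBall.mem_strainedSet_iff`).

*Separation.* Suppose that the tangent space at `x` splits off `ℝ ^ l`, and let `y` be near `x`, in
a direction almost orthogonal to the factor. Looking from `y`, the translates of `y` along the
factor form an orthonormal frame, to which `x` and the point opposite to `x` are added: thus `y`
belongs to `strainedNear (l + 1) δ X` (`NiceBall.eventually_strained_of_orthogonal`). A point `y`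
near `x` outside this set therefore has a component along the factor of size comparable to `dist x
y`. By the first variation formula (`NiceBall.eventually_dist_end_le`), that component is visible
in the distances to the ends of `l` geodesics starting at `x`, and the ends can be taken from a
countable dense set (`NiceBall.exists_strainer`).

Consequently the complement of the strained set is exhausted by countably many sets on which a map
into `ℝ ^ (k - 1)` given by distances to points of the dense set does not contract distances too
much. Such maps are Lipschitz. It remains to take closures, to cut with small compact balls, and to
remove the interior of `strainedNear k δ X` in order to stay in the complement of the strained set
(`compl_strainedSet_eq_iUnion`).
-/

namespace GCBA

noncomputable section

section

/-! ### Midpoint inequalities in the model surfaces -/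

/-- The hypothesis `h` is the law of cosines for the median of a spherical triangle with sides `A`,
`B`, `L`; the right hand side of the conclusion with `1` instead of `1 - 2 * r ^ 2` is the square of
the Euclidean median. -/
lemma cos_midpoint_estimate {A B L f r : ℝ} (hf0 : 0 ≤ f) (hfpi : f ≤ Real.pi)
    (hL0 : 0 ≤ L) (hAB : |A - B| ≤ L) (hLAB : L ≤ A + B) (hA : A ≤ r) (hB : B ≤ r) (hL : L ≤ r)
    (hr : r ≤ 1) (h : Real.cos A + Real.cos B = 2 * Real.cos (L / 2) * Real.cos f) :
    f ^ 2 ≤ ((A + B) / 2) ^ 2 - (1 - 2 * r ^ 2) * ((L / 2) ^ 2 - ((A - B) / 2) ^ 2) := by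
  set S := (A + B) / 2 with hS
  set l := L / 2 with hl
  set D := |A - B| / 2 with hD
  have hDsq : ((A - B) / 2) ^ 2 = D ^ 2 := by rw [hD, div_pow, div_pow, sq_abs]
  rw [hDsq]
  have hD0 : 0 ≤ D := by positivity
  have hDl : D ≤ l := by rw [hD, hl]; linarith
  have hl0 : 0 ≤ l := by rw [hl]; linarith
  have hlS : l ≤ S := by rw [hl, hS]; linarith
  have hSr : S ≤ r := by rw [hS]; linarith
  have hlr : l ≤ r / 2 := by rw [hl]; linarith
  have hr0 : 0 ≤ r := hL0.trans hL
  have hpi := Real.pi_gt_three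
  have hcc : Real.cos S * Real.cos D = Real.cos l * Real.cos f := by
    have h1 : Real.cos D = Real.cos ((A - B) / 2) := by
      rw [hD, ← Real.cos_abs ((A - B) / 2), abs_div, abs_two]
    have h2 := Real.cos_add_cos A B
    rw [h1]
    linarith
  have hlpos : 0 < Real.cos l := Real.cos_pos_of_mem_Ioo ⟨by linarith, by linarith⟩
  have hSpos : 0 < Real.cos S := Real.cos_pos_of_mem_Ioo ⟨by linarith, by linarith⟩
  have hl1 : Real.cos l ≤ 1 := Real.cos_le_one _
  have hDgel : Real.cos l ≤ Real.cos D := Real.cos_le_cos_of_nonneg_of_le_pi hD0 (by linarith) hDl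
  have hdiff : Real.cos S * (Real.cos D - Real.cos l) ≤ Real.cos f - Real.cos S := by
    have e : Real.cos l * (Real.cos f - Real.cos S) = Real.cos S * (Real.cos D - Real.cos l) := by
      linarith
    have h0 : 0 ≤ Real.cos S * (Real.cos D - Real.cos l) :=
      mul_nonneg hSpos.le (by linarith)
    have h1 : 0 ≤ Real.cos f - Real.cos S := by
      by_contra hneg
      nlinarith [mul_pos hlpos (sub_pos.2 (not_le.1 hneg))]
    nlinarith
  have hfS : f ≤ S := by
    by_contra hlt
    have := Real.cos_lt_cos_of_nonneg_of_le_pi (by linarith) hfpi (not_le.1 hlt)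
    nlinarith [mul_nonneg hSpos.le (sub_nonneg.2 hDgel)]
  -- the two differences of cosines are products of sines
  have hup : Real.cos f - Real.cos S ≤ (S ^ 2 - f ^ 2) / 2 := by
    have e := Real.cos_sub_cos f S
    have a1 : 0 ≤ (f + S) / 2 := by linarith
    have a2 : 0 ≤ (S - f) / 2 := by linarith
    have s1 := Real.sin_le a1
    have s2 := Real.sin_le a2
    have s3 : 0 ≤ Real.sin ((S - f) / 2) := Real.sin_nonneg_of_nonneg_of_le_pi a2 (by linarith)
    have e2 : Real.sin ((f - S) / 2) = - Real.sin ((S - f) / 2) := by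
      rw [← Real.sin_neg]; congr 1; ring
    rw [e, e2]
    have : Real.sin ((f + S) / 2) * Real.sin ((S - f) / 2) ≤ (f + S) / 2 * ((S - f) / 2) :=
      mul_le_mul s1 s2 s3 a1
    linarith
  have sinlow : ∀ x, 0 ≤ x → x ≤ r / 2 → x * (1 - r ^ 2 / 16) ≤ Real.sin x := by
    intro x hx hxr
    rcases hx.eq_or_lt with rfl | hx'
    · simp
    · have h1 := Real.sin_gt_sub_cube hx'
      have h2 : x ^ 2 ≤ (r / 2) ^ 2 := pow_le_pow_left₀ hx hxr 2
      have h3 : x ^ 3 / 6 = x * (x ^ 2 / 6) := by ring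
      nlinarith [mul_le_mul_of_nonneg_left h2 hx, mul_nonneg hx (sq_nonneg r)]
  have hr2 : r ^ 2 ≤ 1 := pow_le_one₀ hr0 hr
  have hll : 0 ≤ l ^ 2 - D ^ 2 := sub_nonneg.2 (pow_le_pow_left₀ hD0 hDl 2)
  have hlow : (l ^ 2 - D ^ 2) / 2 * (1 - r ^ 2 / 8) ≤ Real.cos D - Real.cos l := by
    have e := Real.cos_sub_cos D l
    have a1 : 0 ≤ (D + l) / 2 := by linarith
    have a2 : 0 ≤ (l - D) / 2 := by linarith
    have s1 := sinlow _ a1 (by linarith)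
    have s2 := sinlow _ a2 (by linarith)
    have e2 : Real.sin ((D - l) / 2) = - Real.sin ((l - D) / 2) := by
      rw [← Real.sin_neg]; congr 1; ring
    rw [e, e2]
    have c0 : 0 ≤ 1 - r ^ 2 / 16 := by linarith
    have := mul_le_mul s1 s2 (mul_nonneg a2 c0) ((mul_nonneg a1 c0).trans s1)
    have hw := mul_nonneg hll (sq_nonneg (r ^ 2))
    have e3 : (D + l) / 2 * (1 - r ^ 2 / 16) * ((l - D) / 2 * (1 - r ^ 2 / 16)) =
        (l ^ 2 - D ^ 2) / 4 * (1 - r ^ 2 / 8) + (l ^ 2 - D ^ 2) * (r ^ 2) ^ 2 / 1024 := by ring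
    rw [e3] at this
    linarith
  have hcS : 1 - r ^ 2 / 2 ≤ Real.cos S := by
    have := Real.one_sub_sq_div_two_le_cos (x := S)
    have : S ^ 2 ≤ r ^ 2 := pow_le_pow_left₀ (by linarith) hSr 2
    linarith
  have h5 : (1 - r ^ 2 / 2) * ((l ^ 2 - D ^ 2) / 2 * (1 - r ^ 2 / 8)) ≤
      Real.cos S * (Real.cos D - Real.cos l) :=
    mul_le_mul hcS hlow (mul_nonneg (by linarith) (by linarith)) hSpos.le
  have h6 : (1 - r ^ 2 / 2) * ((l ^ 2 - D ^ 2) / 2 * (1 - r ^ 2 / 8)) =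
      (l ^ 2 - D ^ 2) * (1 - r ^ 2 * (5 / 8)) / 2 + (l ^ 2 - D ^ 2) * (r ^ 2) ^ 2 / 32 := by ring
  have h7 := mul_nonneg hll (sq_nonneg (r ^ 2))
  have h8 := mul_nonneg hll (sq_nonneg r)
  rw [h6] at h5
  linarith

lemma sinh_le_mul {x : ℝ} (h0 : 0 ≤ x) (h1 : x ≤ 1) : Real.sinh x ≤ x * (1 + x ^ 2) := by
  have e1 := Real.exp_bound (x := x) (by rw [abs_of_nonneg h0]; exact h1) (n := 3) (by norm_num)
  have e2 := Real.exp_bound (x := -x) (by rw [abs_neg, abs_of_nonneg h0]; exact h1) (n := 3)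
    (by norm_num)
  rw [abs_neg] at e2
  rw [abs_of_nonneg h0] at e1 e2
  have e1 := (abs_le.1 e1).2
  have e2 := (abs_le.1 e2).1
  simp only [Finset.sum_range_succ, Finset.sum_range_zero, Nat.factorial] at e1 e2
  norm_num at e1 e2
  rw [Real.sinh_eq]
  nlinarith [pow_nonneg h0 3]

/-- The hyperbolic counterpart of `cos_midpoint_estimate`. -/
lemma cosh_midpoint_estimate {A B L f r : ℝ} (hf0 : 0 ≤ f)
    (hL0 : 0 ≤ L) (hAB : |A - B| ≤ L) (hLAB : L ≤ A + B) (hA : A ≤ r) (hB : B ≤ r) (hL : L ≤ r)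
    (hr : r ≤ 1) (h : Real.cosh A + Real.cosh B = 2 * Real.cosh (L / 2) * Real.cosh f) :
    f ^ 2 ≤ ((A + B) / 2) ^ 2 - (1 - 2 * r ^ 2) * ((L / 2) ^ 2 - ((A - B) / 2) ^ 2) := by
  have cosh_sub : ∀ a b : ℝ, Real.cosh a - Real.cosh b =
      2 * Real.sinh ((a + b) / 2) * Real.sinh ((a - b) / 2) := by
    intro a b
    have ha : a = (a + b) / 2 + (a - b) / 2 := by ring
    have hb : b = (a + b) / 2 - (a - b) / 2 := by ring
    have e1 := Real.cosh_add ((a + b) / 2) ((a - b) / 2)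
    have e2 := Real.cosh_sub ((a + b) / 2) ((a - b) / 2)
    rw [← ha] at e1
    rw [← hb] at e2
    linarith
  set S := (A + B) / 2 with hS
  set l := L / 2 with hl
  set D := |A - B| / 2 with hD
  have hDsq : ((A - B) / 2) ^ 2 = D ^ 2 := by rw [hD, div_pow, div_pow, sq_abs]
  have hD0 : 0 ≤ D := by positivity
  have hDl : D ≤ l := by rw [hD, hl]; linarith
  have hl0 : 0 ≤ l := by rw [hl]; linarith
  have hlS : l ≤ S := by rw [hl, hS]; linarith
  have hSr : S ≤ r := by rw [hS]; linarith
  have hr0 : 0 ≤ r := hL0.trans hL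
  have hcc : Real.cosh S * Real.cosh D = Real.cosh l * Real.cosh f := by
    have h1 : Real.cosh D = Real.cosh ((A - B) / 2) := by
      rw [hD, ← Real.cosh_abs ((A - B) / 2), abs_div, abs_two]
    have ha : A = S + (A - B) / 2 := by rw [hS]; ring
    have hb : B = S - (A - B) / 2 := by rw [hS]; ring
    have h2 : Real.cosh A + Real.cosh B = 2 * Real.cosh S * Real.cosh ((A - B) / 2) := by
      have e1 := Real.cosh_add S ((A - B) / 2)
      have e2 := Real.cosh_sub S ((A - B) / 2)
      rw [← ha] at e1; rw [← hb] at e2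
      linarith
    rw [h1]
    linarith
  rw [hDsq]
  have hDlc : Real.cosh D ≤ Real.cosh l := by
    rw [Real.cosh_le_cosh, abs_of_nonneg hD0, abs_of_nonneg hl0]; exact hDl
  have hlSc : Real.cosh l ≤ Real.cosh S := by
    rw [Real.cosh_le_cosh, abs_of_nonneg (hl0.trans hlS), abs_of_nonneg hl0]; exact hlS
  have hl1 := Real.one_le_cosh l
  have hS1 := Real.one_le_cosh S
  have hdiff : Real.cosh l - Real.cosh D ≤ Real.cosh S - Real.cosh f := by
    have e : Real.cosh l * (Real.cosh S - Real.cosh f) =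
        Real.cosh S * (Real.cosh l - Real.cosh D) := by linarith
    have h2 : Real.cosh l * (Real.cosh l - Real.cosh D) ≤
        Real.cosh S * (Real.cosh l - Real.cosh D) :=
      mul_le_mul_of_nonneg_right hlSc (by linarith)
    rw [← e] at h2
    exact le_of_mul_le_mul_left h2 (by linarith)
  have hfS : f ≤ S := by
    have : Real.cosh f ≤ Real.cosh S := by linarith
    rwa [Real.cosh_le_cosh, abs_of_nonneg (hl0.trans hlS), abs_of_nonneg hf0] at this
  have hr2 : r ^ 2 ≤ 1 := pow_le_one₀ hr0 hr
  have hup : Real.cosh S - Real.cosh f ≤ (S ^ 2 - f ^ 2) / 2 * (1 + r ^ 2) ^ 2 := by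
    have sl : ∀ x, 0 ≤ x → x ≤ r → Real.sinh x ≤ x * (1 + r ^ 2) := by
      intro x hx hxr
      have h1 := sinh_le_mul hx (hxr.trans hr)
      have h2 : x ^ 2 ≤ r ^ 2 := pow_le_pow_left₀ hx hxr 2
      nlinarith
    have a1 : 0 ≤ (S + f) / 2 := by linarith
    have a2 : 0 ≤ (S - f) / 2 := by linarith
    have s1 := sl _ a1 (by linarith)
    have s2 := sl _ a2 (by linarith)
    have s3 : 0 ≤ Real.sinh ((S - f) / 2) := Real.sinh_nonneg_iff.2 a2
    rw [cosh_sub]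
    have := mul_le_mul s1 s2 s3 (mul_nonneg a1 (by positivity))
    have e3 : (S + f) / 2 * (1 + r ^ 2) * ((S - f) / 2 * (1 + r ^ 2)) =
        (S ^ 2 - f ^ 2) / 4 * (1 + r ^ 2) ^ 2 := by ring
    rw [e3] at this
    linarith
  have hlow : (l ^ 2 - D ^ 2) / 2 ≤ Real.cosh l - Real.cosh D := by
    have a1 : 0 ≤ (l + D) / 2 := by linarith
    have a2 : 0 ≤ (l - D) / 2 := by linarith
    have s1 := Real.self_le_sinh_iff.2 a1
    have s2 := Real.self_le_sinh_iff.2 a2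
    rw [cosh_sub]
    have := mul_le_mul s1 s2 a2 (a1.trans s1)
    linarith [show (l + D) / 2 * ((l - D) / 2) = (l ^ 2 - D ^ 2) / 4 by ring]
  have hll : 0 ≤ l ^ 2 - D ^ 2 := sub_nonneg.2 (pow_le_pow_left₀ hD0 hDl 2)
  have hkey : l ^ 2 - D ^ 2 ≤ (S ^ 2 - f ^ 2) * (1 + r ^ 2) ^ 2 := by linarith
  have hSf : 0 ≤ S ^ 2 - f ^ 2 := sub_nonneg.2 (pow_le_pow_left₀ hf0 hfS 2)
  rcases le_total (1 - 2 * r ^ 2) 0 with hneg | hpos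
  · linarith [mul_nonneg hll (neg_nonneg.2 hneg)]
  · have h3 : (1 - 2 * r ^ 2) * (1 + r ^ 2) ^ 2 ≤ 1 := by
      have : (1 - 2 * r ^ 2) * (1 + r ^ 2) ^ 2 = 1 - 3 * (r ^ 2) ^ 2 - 2 * (r ^ 3) ^ 2 := by ring
      linarith [sq_nonneg (r ^ 3), sq_nonneg (r ^ 2)]
    have h4 := mul_le_mul_of_nonneg_left hkey hpos
    have h5 := mul_le_mul_of_nonneg_left h3 hSf
    linarith

/-! ### Midpoints in the model surfaces -/

lemma sphere_cos_midpoint {p c q m : EuclideanSpace ℝ (Fin 3)} (hp : ‖p‖ = 1) (hc : ‖c‖ = 1)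
    (hq : ‖q‖ = 1) (hm : ‖m‖ = 1) {h : ℝ} (hpc : InnerProductGeometry.angle p c = 2 * h)
    (hpm : InnerProductGeometry.angle p m = h) (hmc : InnerProductGeometry.angle m c = h) :
    Real.cos (InnerProductGeometry.angle q p) + Real.cos (InnerProductGeometry.angle q c) =
      2 * Real.cos h * Real.cos (InnerProductGeometry.angle q m) := by
  have cosa : ∀ a b : EuclideanSpace ℝ (Fin 3), ‖a‖ = 1 → ‖b‖ = 1 →
      Real.cos (InnerProductGeometry.angle a b) = inner ℝ a b := by
    intro a b ha hb
    rw [InnerProductGeometry.cos_angle, ha, hb]; simp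
  have i1 : inner ℝ p c = Real.cos (2 * h) := by rw [← cosa p c hp hc, hpc]
  have i2 : inner ℝ p m = Real.cos h := by rw [← cosa p m hp hm, hpm]
  have i3 : inner ℝ m c = Real.cos h := by rw [← cosa m c hm hc, hmc]
  have key : p + c - (2 * Real.cos h) • m = 0 := by
    rw [← norm_eq_zero, ← sq_eq_zero_iff, ← real_inner_self_eq_norm_sq]
    have i4 : inner ℝ c p = Real.cos (2 * h) := by rw [real_inner_comm, i1]
    have i5 : inner ℝ m p = Real.cos h := by rw [real_inner_comm, i2]
    have i6 : inner ℝ c m = Real.cos h := by rw [real_inner_comm, i3]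
    simp only [inner_sub_left, inner_sub_right, inner_add_left, inner_add_right,
      real_inner_smul_left, real_inner_smul_right, real_inner_self_eq_norm_sq, hp, hc, hm,
      i1, i2, i3, i4, i5, i6, norm_smul, Real.norm_eq_abs, mul_pow, sq_abs]
    rw [Real.cos_two_mul]; ring_nf
  have : p + c = (2 * Real.cos h) • m := sub_eq_zero.1 key
  rw [cosa q p hq hp, cosa q c hq hc, cosa q m hq hm, ← inner_add_right, this,
    real_inner_smul_right]

lemma halfPlane_cosh_midpoint {p c q m : UpperHalfPlane} {h : ℝ} (hpc : dist p c = 2 * h)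
    (hpm : dist p m = h) (hmc : dist m c = h) :
    Real.cosh (dist q p) + Real.cosh (dist q c) = 2 * Real.cosh h * Real.cosh (dist q m) := by
  -- `cosh (dist z w)` is the bilinear form `(a c' + c a' - 2 b b') / 2` evaluated at the vectors
  -- `(a, b, c) = (1 / y, x / y, (x ^ 2 + y ^ 2) / y)` of `z` and `w`.
  have hform : ∀ z w : UpperHalfPlane, Real.cosh (dist z w) =
      ((1 / z.im) * ((w.re ^ 2 + w.im ^ 2) / w.im) + ((z.re ^ 2 + z.im ^ 2) / z.im) * (1 / w.im)
        - 2 * (z.re / z.im) * (w.re / w.im)) / 2 := by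
    intro z w
    have hz := z.im_pos
    have hw := w.im_pos
    rw [UpperHalfPlane.cosh_dist, Complex.dist_eq, ← Complex.normSq_eq_norm_sq,
      Complex.normSq_apply]
    simp only [Complex.sub_re, Complex.sub_im, UpperHalfPlane.coe_re, UpperHalfPlane.coe_im]
    field_simp
    ring
  have hself : ∀ z : UpperHalfPlane, (1 / z.im) * ((z.re ^ 2 + z.im ^ 2) / z.im) =
      1 + (z.re / z.im) ^ 2 := by
    intro z
    have hz := z.im_pos
    field_simp
    ring
  have e1 := hform p c
  have e2 := hform p m
  have e3 := hform m c
  rw [hpc, Real.cosh_two_mul, Real.sinh_sq] at e1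
  rw [hpm] at e2
  rw [hmc] at e3
  rw [hform q p, hform q c, hform q m]
  have sp := hself p
  have sc := hself c
  have sm := hself m
  set K := Real.cosh h
  generalize 1 / p.im = a₁ at *
  generalize p.re / p.im = b₁ at *
  generalize (p.re ^ 2 + p.im ^ 2) / p.im = c₁ at *
  generalize 1 / c.im = a₂ at *
  generalize c.re / c.im = b₂ at *
  generalize (c.re ^ 2 + c.im ^ 2) / c.im = c₂ at *
  generalize 1 / m.im = a₃ at *
  generalize m.re / m.im = b₃ at *
  generalize (m.re ^ 2 + m.im ^ 2) / m.im = c₃ at *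
  -- the vector `p + c - 2 cosh h • m` is isotropic and orthogonal to the timelike vector `m`
  set a := a₁ + a₂ - 2 * K * a₃ with ha
  set b := b₁ + b₂ - 2 * K * b₃ with hb
  set d := c₁ + c₂ - 2 * K * c₃ with hd
  have hiso : a * d = b ^ 2 := by
    rw [ha, hb, hd]; linear_combination sp + sc + 4 * K ^ 2 * sm - 2 * e1 + 4 * K * e2 + 4 * K * e3
  have hort : a * c₃ + d * a₃ = 2 * b * b₃ := by
    rw [ha, hb, hd]; linear_combination -2 * e2 - 2 * e3 - 4 * K * sm
  have hsq : (a * c₃ - d * a₃) ^ 2 = - 4 * b ^ 2 := by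
    linear_combination (a * c₃ + d * a₃ + 2 * b * b₃) * hort - 4 * a * d * sm
      - (4 + 4 * b₃ ^ 2) * hiso
  have hb0 : b = 0 := by nlinarith [sq_nonneg (a * c₃ - d * a₃), sq_nonneg b]
  have hdiff : a * c₃ = d * a₃ := by
    have : (a * c₃ - d * a₃) ^ 2 = 0 := by rw [hsq, hb0]; ring
    linarith [pow_eq_zero_iff (two_ne_zero) |>.1 this]
  have h1 : a * c₃ = 0 := by rw [hb0] at hort; linarith
  have h2 : d * a₃ = 0 := by linarith
  have hc3 : c₃ ≠ 0 := by rintro h0; rw [h0] at sm; nlinarith [sq_nonneg b₃]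
  have ha3 : a₃ ≠ 0 := by rintro h0; rw [h0] at sm; nlinarith [sq_nonneg b₃]
  have ha0 : a = 0 := (mul_eq_zero.1 h1).resolve_right hc3
  have hd0 : d = 0 := (mul_eq_zero.1 h2).resolve_right ha3
  have ea : a₁ = 2 * K * a₃ - a₂ := by linarith
  have eb : b₁ = 2 * K * b₃ - b₂ := by linarith
  have ed : c₁ = 2 * K * c₃ - c₂ := by linarith
  rw [ea, eb, ed]; ring

/-! ### The midpoint inequality in spaces with an upper curvature bound -/

/-- An infinitesimally sharp form of the `CAT(0)` midpoint inequality, valid up to a relative error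
`C * r ^ 2` for triples of diameter at most `r ≤ R`. -/
def MidpointIneq {X : Type*} [MetricSpace X] (C R : ℝ) (p c q m : X) : Prop :=
  dist p m = dist p c / 2 → dist m c = dist p c / 2 →
  ∀ r ≤ R, dist q p ≤ r → dist q c ≤ r → dist p c ≤ r →
    dist q m ^ 2 ≤ ((dist q p + dist q c) / 2) ^ 2 -
      (1 - C * r ^ 2) * ((dist p c / 2) ^ 2 - ((dist q p - dist q c) / 2) ^ 2)

/-- Comparison is only used for a vertex and the midpoint of the opposite side. -/
theorem IsCAT.midpointIneq {κ : ℝ} {X : Type*} [MetricSpace X] (h : IsCAT κ X) :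
    ∃ C R : ℝ, 0 ≤ C ∧ 0 < R ∧ (0 < κ → 2 * R < Real.pi / √κ) ∧
      ∀ p c q m : X, MidpointIneq C R p c q m := by
  rcases lt_trichotomy 0 κ with hκ | hκ | hκ
  · have hk : 0 < √κ := Real.sqrt_pos.2 hκ
    set k := √κ with hkdef
    have hR : 2 * (1 / k) < Real.pi / k := by
      rw [← mul_div_assoc, div_lt_div_iff_of_pos_right hk]; linarith [Real.pi_gt_three]
    refine ⟨2 * k ^ 2, 1 / k, by positivity, by positivity, fun _ => hR, ?_⟩
    intro p c q m hpm hmc r hr hqp hqc hpc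
    have hr0 : 0 ≤ r := dist_nonneg.trans hpc
    have hkr : k * r ≤ 1 := by rw [le_div_iff₀ hk] at hr; linarith
    obtain ⟨p', c', q', m', y', h1, h2, h3, h4, h5, h6, h7, h8⟩ :=
      (h.comparison p c q m q (fun _ => by
        rw [dist_comm c q]; rw [dist_comm q p] at hqp; rw [dist_comm q p]
        have : r * 2 ≤ 2 * (1 / k) := by linarith
        have h0 : 0 < 1 / k := by positivity
        linarith) (by rw [hpm, hmc]; ring) (by rw [dist_self, add_zero])).1 hκ
    have hu : ∀ v w : Metric.sphere (0 : EuclideanSpace ℝ (Fin 3)) 1,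
        InnerProductGeometry.angle (v : EuclideanSpace ℝ (Fin 3)) w =
        k * sphereDist κ v w := by
      intro v w; unfold sphereDist; rw [← hkdef]; field_simp
    have nrm : ∀ v : Metric.sphere (0 : EuclideanSpace ℝ (Fin 3)) 1,
        ‖(v : EuclideanSpace ℝ (Fin 3))‖ = 1 :=
      fun v => by simp
    rw [dist_self] at h7
    have hy : (y' : EuclideanSpace ℝ (Fin 3)) = q' := by
      have := hu y' q'
      rw [h7, mul_zero, InnerProductGeometry.angle_eq_zero_iff] at this
      obtain ⟨_, a, ha, hq⟩ := this
      have := nrm q'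
      rw [hq, norm_smul, nrm y', mul_one, Real.norm_eq_abs, abs_of_pos ha] at this
      rw [hq, this, one_smul]
    have hy' : y' = q' := Subtype.ext hy
    subst hy'
    have e := sphere_cos_midpoint (nrm p') (nrm c') (nrm y') (nrm m')
      (h := k * (dist p c / 2)) (by rw [hu, h1]; ring) (by rw [hu, h4, hpm]) (by rw [hu, h5, hmc])
    have a1 : InnerProductGeometry.angle (y' : EuclideanSpace ℝ (Fin 3)) p' = k * dist q p := by
      rw [InnerProductGeometry.angle_comm, hu, h3, dist_comm]
    have a2 : InnerProductGeometry.angle (y' : EuclideanSpace ℝ (Fin 3)) c' = k * dist q c := by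
      rw [InnerProductGeometry.angle_comm, hu, h2, dist_comm]
    have a3 : InnerProductGeometry.angle (y' : EuclideanSpace ℝ (Fin 3)) m' =
      k * sphereDist κ m' y' := by rw [InnerProductGeometry.angle_comm, hu]
    have hpi := InnerProductGeometry.angle_le_pi (y' : EuclideanSpace ℝ (Fin 3)) m'
    have hn := InnerProductGeometry.angle_nonneg (y' : EuclideanSpace ℝ (Fin 3)) m'
    rw [a3] at hpi hn
    rw [a1, a2, a3, show k * (dist p c / 2) = (k * dist p c) / 2 by ring] at e
    have t1 := abs_dist_sub_le p c q
    rw [dist_comm p q, dist_comm c q] at t1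
    have t2 := dist_triangle_left p c q
    have est := cos_midpoint_estimate (r := k * r) hn hpi (by positivity)
      (by rw [← mul_sub, abs_mul, abs_of_pos hk]; gcongr) (by rw [← mul_add]; gcongr)
      (by gcongr) (by gcongr) (by gcongr) hkr e
    have hqm : dist q m ≤ sphereDist κ m' y' := by rw [dist_comm]; exact h8
    have hqm2 : dist q m ^ 2 ≤ sphereDist κ m' y' ^ 2 := pow_le_pow_left₀ dist_nonneg hqm 2
    refine hqm2.trans ?_
    have hk2 : 0 < k ^ 2 := by positivity
    refine le_of_mul_le_mul_left ?_ hk2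
    calc k ^ 2 * sphereDist κ m' y' ^ 2 = (k * sphereDist κ m' y') ^ 2 := by ring
      _ ≤ _ := est
      _ = _ := by ring
  · refine ⟨0, 1, le_rfl, one_pos, fun h0 => absurd h0 hκ.not_lt, ?_⟩
    intro p c q m hpm hmc r hr hqp hqc hpc
    obtain ⟨p', c', q', m', y', h1, h2, h3, h4, h5, h6, h7, h8⟩ :=
      (h.comparison p c q m q (fun h0 => absurd h0 hκ.not_lt) (by rw [hpm, hmc]; ring)
        (by rw [dist_self, add_zero])).2.1 hκ.symm
    simp only at h1 h2 h3 h4 h5 h6 h7 h8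
    rw [dist_self, dist_eq_zero] at h7
    subst h7
    have hpl := parallelogram_law_with_norm ℝ (p' - m') (c' - m')
    have hpl2 := parallelogram_law_with_norm ℝ (p' - y') (c' - y')
    have hmm : p' - m' + (c' - m') = 0 := by
      rw [← norm_eq_zero, ← mul_self_eq_zero]
      rw [sub_sub_sub_cancel_right, ← dist_eq_norm p' m', ← dist_eq_norm p' c',
        ← dist_eq_norm c' m', dist_comm c' m', h1, h4, h5, hpm, hmc] at hpl
      linarith
    have hs : p' - y' + (c' - y') = (2 : ℝ) • (m' - y') := by
      rw [two_smul, ← sub_eq_zero, ← hmm]; abel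
    rw [hs, sub_sub_sub_cancel_right, norm_smul, ← dist_eq_norm p' y', ← dist_eq_norm p' c',
      ← dist_eq_norm c' y', ← dist_eq_norm m' y', h1, h2, h3, Real.norm_eq_abs, abs_two] at hpl2
    have hqm2 : dist q m ^ 2 ≤ dist m' y' ^ 2 := by
      rw [dist_comm]; exact pow_le_pow_left₀ dist_nonneg h8 2
    rw [dist_comm q p, dist_comm q c]
    nlinarith
  · have hk : 0 < √(-κ) := Real.sqrt_pos.2 (by linarith)
    set k := √(-κ) with hkdef
    refine ⟨2 * k ^ 2, 1 / k, by positivity, by positivity, fun h0 => absurd h0 hκ.not_gt, ?_⟩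
    intro p c q m hpm hmc r hr hqp hqc hpc
    have hr0 : 0 ≤ r := dist_nonneg.trans hpc
    have hkr : k * r ≤ 1 := by rw [le_div_iff₀ hk] at hr; linarith
    obtain ⟨p', c', q', m', y', h1, h2, h3, h4, h5, h6, h7, h8⟩ :=
      (h.comparison p c q m q (fun h0 => absurd h0 hκ.not_gt) (by rw [hpm, hmc]; ring)
        (by rw [dist_self, add_zero])).2.2 hκ
    have hu : ∀ v w : UpperHalfPlane, dist v w = k * hyperbolicDist κ v w := by
      intro v w; unfold hyperbolicDist; rw [← hkdef]; field_simp
    rw [dist_self] at h7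
    have hy := hu y' q'
    rw [h7, mul_zero, dist_eq_zero] at hy
    subst hy
    have e := halfPlane_cosh_midpoint (q := y') (h := k * (dist p c / 2))
      (by rw [hu, h1]; ring) (by rw [hu, h4, hpm]) (by rw [hu, h5, hmc])
    have a1 : dist y' p' = k * dist q p := by rw [dist_comm, hu, h3, dist_comm]
    have a2 : dist y' c' = k * dist q c := by rw [dist_comm, hu, h2, dist_comm]
    have a3 : dist y' m' = k * hyperbolicDist κ m' y' := by rw [dist_comm, hu]
    have hn : 0 ≤ dist y' m' := dist_nonneg
    rw [a3] at hn
    rw [a1, a2, a3, show k * (dist p c / 2) = (k * dist p c) / 2 by ring] at e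
    have t1 := abs_dist_sub_le p c q
    rw [dist_comm p q, dist_comm c q] at t1
    have t2 := dist_triangle_left p c q
    have est := cosh_midpoint_estimate (r := k * r) hn (by positivity)
      (by rw [← mul_sub, abs_mul, abs_of_pos hk]; gcongr) (by rw [← mul_add]; gcongr)
      (by gcongr) (by gcongr) (by gcongr) hkr e
    have hqm : dist q m ≤ hyperbolicDist κ m' y' := by rw [dist_comm]; exact h8
    have hqm2 : dist q m ^ 2 ≤ hyperbolicDist κ m' y' ^ 2 := pow_le_pow_left₀ dist_nonneg hqm 2
    refine hqm2.trans ?_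
    have hk2 : 0 < k ^ 2 := by positivity
    refine le_of_mul_le_mul_left ?_ hk2
    calc k ^ 2 * hyperbolicDist κ m' y' ^ 2 = (k * hyperbolicDist κ m' y') ^ 2 := by ring
      _ ≤ _ := est
      _ = _ := by ring

end

section

open Metric

/-! ### Small balls -/

/-- A compact ball in which any two points are joined by a geodesic of `X` (which may leave the
ball) and in which the midpoint inequality holds with a uniform constant. -/
structure NiceBall {X : Type*} [MetricSpace X] (x : X) (R C : ℝ) : Prop where
  radius_pos : 0 < R
  const_nonneg : 0 ≤ C
  small : C * R ^ 2 ≤ 1 / 8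
  compact : IsCompact (closedBall x R)
  geodesic : ∀ p ∈ closedBall x R, ∀ q ∈ closedBall x R, ∃ γ : ℝ → X, IsGeodesicBetween γ p q
  midpoint : ∀ p ∈ closedBall x R, ∀ c ∈ closedBall x R, ∀ q ∈ closedBall x R,
    ∀ m ∈ closedBall x R, MidpointIneq C (2 * R) p c q m

variable {X : Type u} [MetricSpace X]

/-- The radius is so small that geodesics between points of the ball stay in a `CAT(κ)`
neighbourhood. -/
theorem IsGCBA.exists_niceBall (hX : IsGCBA X) (x : X) : ∃ R C : ℝ, NiceBall x R C := by
  obtain ⟨κ, hκ⟩ := hX.curvature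
  have := hX.locallyCompact
  obtain ⟨U, hU, hcat⟩ := hκ x
  obtain ⟨C, R₁, hC, hR₁, hκR, hmid⟩ := hcat.midpointIneq
  obtain ⟨R₀, hR₀, hball⟩ := Metric.nhds_basis_closedBall.mem_iff.1 hU
  obtain ⟨K, hK, hKx⟩ := exists_compact_mem_nhds x
  obtain ⟨R₂, hR₂, hball₂⟩ := Metric.nhds_basis_closedBall.mem_iff.1 hKx
  set R₃ := 1 / (8 * (C + 1)) with hR₃
  have hR₃pos : 0 < R₃ := by positivity
  set R := min (min R₀ R₁) (min R₂ (min R₃ 1)) / 2 with hR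
  have hmpos : 0 < min (min R₀ R₁) (min R₂ (min R₃ 1)) := by positivity
  have hRpos : 0 < R := by positivity
  have b0 : R ≤ R₀ := by
    have : min (min R₀ R₁) (min R₂ (min R₃ 1)) ≤ R₀ :=
      (min_le_left _ _).trans (min_le_left _ _)
    linarith
  have b1 : 2 * R ≤ R₁ := by
    have : min (min R₀ R₁) (min R₂ (min R₃ 1)) ≤ R₁ :=
      (min_le_left _ _).trans (min_le_right _ _)
    linarith
  have b2 : R ≤ R₂ := by
    have : min (min R₀ R₁) (min R₂ (min R₃ 1)) ≤ R₂ :=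
      (min_le_right _ _).trans (min_le_left _ _)
    linarith
  have b3 : R ≤ R₃ := by
    have : min (min R₀ R₁) (min R₂ (min R₃ 1)) ≤ R₃ :=
      (min_le_right _ _).trans ((min_le_right _ _).trans (min_le_left _ _))
    linarith
  have b4 : R ≤ 1 := by
    have : min (min R₀ R₁) (min R₂ (min R₃ 1)) ≤ 1 :=
      (min_le_right _ _).trans ((min_le_right _ _).trans (min_le_right _ _))
    linarith
  have hsub : closedBall x R ⊆ U := (closedBall_subset_closedBall b0).trans hball
  refine ⟨R, C, hRpos, hC, ?_, ?_, ?_, ?_⟩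
  · have h1 : R ^ 2 ≤ R₃ := by nlinarith
    calc C * R ^ 2 ≤ (C + 1) * R₃ := by
          apply mul_le_mul (by linarith) h1 (by positivity) (by linarith)
      _ = 1 / 8 := by rw [hR₃]; field_simp
  · exact hK.of_isClosed_subset isClosed_closedBall
      ((closedBall_subset_closedBall b2).trans hball₂)
  · intro p hp q hq
    have hpq : dist p q ≤ 2 * R := by
      have := dist_triangle_right p q x
      linarith [mem_closedBall.1 hp, mem_closedBall.1 hq]
    obtain ⟨γ, h0, h1, h2⟩ := hcat.geodesic ⟨p, hsub hp⟩ ⟨q, hsub hq⟩ (fun h => by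
      have := hκR h
      rw [Subtype.dist_eq]
      simp only
      linarith)
    refine ⟨fun t => γ t, by simp [h0], ?_, ?_⟩
    · rw [Subtype.dist_eq] at h1; simp [h1]
    · intro s hs t ht
      have := h2 s hs t ht
      rwa [Subtype.dist_eq] at this
  · intro p hp c hc q hq m hm h1 h2 r hr
    exact hmid ⟨p, hsub hp⟩ ⟨c, hsub hc⟩ ⟨q, hsub hq⟩ ⟨m, hsub hm⟩ h1 h2 r (hr.trans b1)

namespace NiceBall

variable {x : X} {R C : ℝ}

lemma dist_midpoint_le (hB : NiceBall x R C) {p c q m : X} (hp : p ∈ closedBall x R)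
    (hc : c ∈ closedBall x R) (hq : q ∈ closedBall x R) (hm : m ∈ closedBall x R)
    (h1 : dist p m = dist p c / 2) (h2 : dist m c = dist p c / 2) :
    dist q m ≤ (dist q p + dist q c) / 2 := by
  have bd : ∀ a ∈ closedBall x R, ∀ b ∈ closedBall x R, dist a b ≤ 2 * R := by
    intro a ha b hb
    have := dist_triangle_right a b x
    linarith [mem_closedBall.1 ha, mem_closedBall.1 hb]
  have := hB.midpoint p hp c hc q hq m hm h1 h2 (2 * R) le_rfl (bd _ hq _ hp) (bd _ hq _ hc)
    (bd _ hp _ hc)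
  have t1 := abs_dist_sub_le p c q
  rw [dist_comm p q, dist_comm c q] at t1
  have t2 : ((dist q p - dist q c) / 2) ^ 2 ≤ (dist p c / 2) ^ 2 := by
    rw [div_pow, div_pow, ← sq_abs (dist q p - dist q c)]
    gcongr
  have t3 : 0 ≤ 1 - C * (2 * R) ^ 2 := by linarith [hB.small]
  refine le_of_sq_le_sq ?_ (by positivity)
  linarith [mul_nonneg t3 (sub_nonneg.2 t2)]

lemma sq_dist_midpoint_le (hB : NiceBall x R C) {r : ℝ} (hr : r ≤ R) {p c q m : X}
    (hp : p ∈ closedBall x r)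
    (hc : c ∈ closedBall x r) (hq : q ∈ closedBall x r) (hm : m ∈ closedBall x R)
    (h1 : dist p m = dist p c / 2) (h2 : dist m c = dist p c / 2) :
    dist q m ^ 2 ≤
      dist q p ^ 2 / 2 + dist q c ^ 2 / 2 - (1 - 4 * C * r ^ 2) * dist p c ^ 2 / 4 := by
  have bd : ∀ a ∈ closedBall x r, ∀ b ∈ closedBall x r, dist a b ≤ 2 * r := by
    intro a ha b hb
    have := dist_triangle_right a b x
    linarith [mem_closedBall.1 ha, mem_closedBall.1 hb]
  have hs := closedBall_subset_closedBall (x := x) hr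
  have := hB.midpoint p (hs hp) c (hs hc) q (hs hq) m hm h1 h2 (2 * r) (by linarith) (bd _ hq _ hp)
    (bd _ hq _ hc) (bd _ hp _ hc)
  have h3 : 0 ≤ C * (2 * r) ^ 2 * ((dist q p - dist q c) / 2) ^ 2 :=
    mul_nonneg (mul_nonneg hB.const_nonneg (sq_nonneg _)) (sq_nonneg _)
  nlinarith

end NiceBall

/-- A continuous midpoint convex function on an interval lies below its chord. -/
lemma le_chord_of_midpoint_le {f : ℝ → ℝ} {L : ℝ} (hL : 0 < L) (hf : ContinuousOn f (Icc 0 L))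
    (hmid : ∀ a ∈ Icc 0 L, ∀ b ∈ Icc 0 L, f ((a + b) / 2) ≤ (f a + f b) / 2) {l : ℝ}
    (hl : l ∈ Icc (0 : ℝ) 1) : f (l * L) ≤ (1 - l) * f 0 + l * f L := by
  set g : ℝ → ℝ := fun t => f t - ((1 - t / L) * f 0 + t / L * f L) with hg
  have hgc : ContinuousOn g (Icc 0 L) := by
    apply hf.sub
    fun_prop
  have hgm : ∀ a ∈ Icc 0 L, ∀ b ∈ Icc 0 L, g ((a + b) / 2) ≤ (g a + g b) / 2 := by
    intro a ha b hb
    have := hmid a ha b hb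
    simp only [hg]
    have e : (1 - (a + b) / 2 / L) * f 0 + (a + b) / 2 / L * f L =
      (((1 - a / L) * f 0 + a / L * f L) + ((1 - b / L) * f 0 + b / L * f L)) / 2 := by ring
    rw [e]; linarith
  have g0 : g 0 = 0 := by simp [hg]
  have gL : g L = 0 := by simp [hg, hL.ne']
  obtain ⟨t, ht, htmax⟩ := isCompact_Icc.exists_isMaxOn (nonempty_Icc.2 hL.le) hgc
  have hmem : l * L ∈ Icc 0 L := ⟨mul_nonneg hl.1 hL.le, by nlinarith [hl.2]⟩
  have key : g t ≤ 0 := by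
    rcases le_total (2 * t) L with h | h
    · have m2 : 2 * t ∈ Icc 0 L := ⟨by linarith [ht.1], h⟩
      have h1 := hgm 0 ⟨le_rfl, hL.le⟩ (2 * t) m2
      have h2 : g (2 * t) ≤ g t := htmax m2
      rw [show (0 + 2 * t) / 2 = t by ring, g0] at h1
      linarith
    · have m2 : 2 * t - L ∈ Icc 0 L := ⟨by linarith, by linarith [ht.2]⟩
      have h1 := hgm (2 * t - L) m2 L ⟨hL.le, le_rfl⟩
      have h2 : g (2 * t - L) ≤ g t := htmax m2
      rw [show (2 * t - L + L) / 2 = t by ring, gL] at h1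
      linarith
  have h3 : g (l * L) ≤ g t := htmax hmem
  have h4 : l * L / L = l := by field_simp
  simp only [hg, h4] at h3
  simp only [hg] at key
  linarith

namespace NiceBall

variable {x : X} {R C : ℝ}

/-- The `CAT(0)` inequality for a point and a geodesic in a small ball, up to a relative error of
order `r ^ 2`. -/
lemma sq_dist_le (hB : NiceBall x R C) {r : ℝ} (hr : r ≤ R) {L : ℝ} (hL : 0 < L) {γ : ℝ → X}
    (hγ : ∀ s ∈ Icc 0 L, ∀ t ∈ Icc 0 L, dist (γ s) (γ t) = |s - t|)
    (hmem : ∀ t ∈ Icc 0 L, γ t ∈ closedBall x r) {q : X} (hq : q ∈ closedBall x r) {l : ℝ}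
    (hl : l ∈ Icc (0 : ℝ) 1) :
    dist q (γ (l * L)) ^ 2 ≤ (1 - l) * dist q (γ 0) ^ 2 + l * dist q (γ L) ^ 2 -
      l * (1 - l) * (1 - 4 * C * r ^ 2) * L ^ 2 := by
  have hcont : ContinuousOn γ (Icc 0 L) := by
    refine (LipschitzOnWith.of_dist_le_mul (K := 1) fun s hs t ht => ?_).continuousOn
    rw [hγ s hs t ht, NNReal.coe_one, one_mul, Real.dist_eq]
  have := le_chord_of_midpoint_le (f := fun t => dist q (γ t) ^ 2 - (1 - 4 * C * r ^ 2) * t ^ 2) hL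
    (by
      apply ContinuousOn.sub
      · exact ((continuous_const.dist continuous_id).comp_continuousOn hcont).pow 2
      · fun_prop)
    (by
      intro a ha b hb
      have hm : (a + b) / 2 ∈ Icc 0 L := ⟨by linarith [ha.1, hb.1], by linarith [ha.2, hb.2]⟩
      have e1 : |a - (a + b) / 2| = |a - b| / 2 := by
        rw [show a - (a + b) / 2 = (a - b) / 2 by ring, abs_div, abs_two]
      have e2 : |(a + b) / 2 - b| = |a - b| / 2 := by
        rw [show (a + b) / 2 - b = (a - b) / 2 by ring, abs_div, abs_two]
      have := hB.sq_dist_midpoint_le hr (hmem a ha) (hmem b hb) hq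
        (closedBall_subset_closedBall hr (hmem _ hm))
        (by rw [hγ a ha _ hm, hγ a ha b hb, e1]) (by rw [hγ _ hm b hb, hγ a ha b hb, e2])
      rw [hγ a ha b hb, sq_abs] at this
      nlinarith) hl
  beta_reduce at this
  nlinarith

/-- In a locally geodesically complete space a geodesic between points of a nice ball can be
prolonged a little: convexity of the distance to `a` shows that the local geodesic extending it is
still minimising. -/
lemma exists_extension (hB : NiceBall x R C) (hX : LocallyGeodesicallyComplete X) {a z : X}
    (ha : a ∈ ball x R) (hz : z ∈ ball x R) (haz : a ≠ z) {e : ℝ} (he : 0 < e) :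
    ∃ z', z' ≠ z ∧ dist z z' < e ∧ dist a z' = dist a z + dist z z' := by
  obtain ⟨γ, h0, h1, h2⟩ := hB.geodesic a (ball_subset_closedBall ha) z (ball_subset_closedBall hz)
  set L := dist a z with hL
  have hLpos : 0 < L := dist_pos.2 haz
  obtain ⟨ε, hε, γ', heq, hloc⟩ := hX γ 0 L hLpos (fun t _ => ⟨1, one_pos, fun s hs s' hs' =>
    h2 s hs.1 s' hs'.1⟩)
  obtain ⟨ε₀, hε₀, hiso⟩ := hloc L ⟨by linarith, by linarith⟩
  have hslack : 0 < R - dist z x := sub_pos.2 (mem_ball.1 hz)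
  set h := min (min L ε) (min (min ε₀ e) (R - dist z x)) / 2 with hh
  have hmin : 0 < min (min L ε) (min (min ε₀ e) (R - dist z x)) := by positivity
  have hpos : 0 < h := by positivity
  have b1 : 2 * h ≤ L := by
    rw [hh, mul_div_cancel₀ _ (two_ne_zero)]; exact (min_le_left _ _).trans (min_le_left _ _)
  have b2 : 2 * h ≤ ε := by
    rw [hh, mul_div_cancel₀ _ (two_ne_zero)]; exact (min_le_left _ _).trans (min_le_right _ _)
  have b3 : 2 * h ≤ ε₀ := by
    rw [hh, mul_div_cancel₀ _ (two_ne_zero)]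
    exact (min_le_right _ _).trans ((min_le_left _ _).trans (min_le_left _ _))
  have b4 : 2 * h ≤ e := by
    rw [hh, mul_div_cancel₀ _ (two_ne_zero)]
    exact (min_le_right _ _).trans ((min_le_left _ _).trans (min_le_right _ _))
  have b5 : 2 * h ≤ R - dist z x := by
    rw [hh, mul_div_cancel₀ _ (two_ne_zero)]
    exact (min_le_right _ _).trans (min_le_right _ _)
  have mm : L - h ∈ Icc (0 - ε) (L + ε) ∩ Ioo (L - ε₀) (L + ε₀) :=
    ⟨⟨by linarith, by linarith⟩, by linarith, by linarith⟩
  have m0 : L ∈ Icc (0 - ε) (L + ε) ∩ Ioo (L - ε₀) (L + ε₀) :=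
    ⟨⟨by linarith, by linarith⟩, by linarith, by linarith⟩
  have mp : L + h ∈ Icc (0 - ε) (L + ε) ∩ Ioo (L - ε₀) (L + ε₀) :=
    ⟨⟨by linarith, by linarith⟩, by linarith, by linarith⟩
  have gL : γ' L = z := by rw [heq ⟨hLpos.le, le_rfl⟩, h1]
  have gm : γ' (L - h) = γ (L - h) := heq ⟨by linarith, by linarith⟩
  have d1 := hiso _ mm _ m0
  have d2 := hiso _ m0 _ mp
  have d3 := hiso _ mm _ mp
  rw [gL] at d1 d2
  rw [show L - h - L = -h by ring, abs_neg, abs_of_pos hpos] at d1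
  rw [show L - (L + h) = -h by ring, abs_neg, abs_of_pos hpos] at d2
  rw [show L - h - (L + h) = -(2 * h) by ring, abs_neg, abs_of_pos (by linarith)] at d3
  have c1 : γ' (L - h) ∈ closedBall x R := by
    rw [mem_closedBall]; linarith [dist_triangle (γ' (L - h)) z x]
  have c2 : γ' (L + h) ∈ closedBall x R := by
    rw [mem_closedBall]; linarith [dist_triangle_left (γ' (L + h)) x z, dist_comm z x]
  have hconv := hB.dist_midpoint_le c1 c2 (ball_subset_closedBall ha) (ball_subset_closedBall hz)
    (by rw [d1, d3]; ring) (by rw [d2, d3]; ring)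
  have d4 : dist a (γ' (L - h)) = L - h := by
    have := h2 0 ⟨le_rfl, hLpos.le⟩ (L - h) ⟨by linarith, by linarith⟩
    rw [h0, zero_sub, abs_neg, abs_of_nonneg (by linarith)] at this
    rw [gm, this]
  have d5 := dist_triangle a z (γ' (L + h))
  refine ⟨γ' (L + h), ?_, by linarith, ?_⟩
  · intro hcontra
    rw [hcontra, dist_self] at d2
    linarith
  · apply le_antisymm d5
    rw [d2, ← hL]; linarith

/-- A geodesic from `x` to `y` can be prolonged up to the sphere of radius `ρ`: a farthest point `z`
of the closed ball with `y` between `x` and `z` lies on the sphere, by `exists_extension`. -/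
lemma exists_on_sphere (hB : NiceBall x R C) (hX : LocallyGeodesicallyComplete X) {y : X} {ρ : ℝ}
    (hρ : ρ < R) (hy0 : y ≠ x) (hy : dist x y ≤ ρ) :
    ∃ z, dist x z = ρ ∧ dist x y + dist y z = ρ := by
  set S := closedBall x ρ ∩ {z | dist x z = dist x y + dist y z} with hS
  have hSc : IsCompact S := by
    apply IsCompact.inter_right
    · exact hB.compact.of_isClosed_subset isClosed_closedBall (closedBall_subset_closedBall hρ.le)
    · exact isClosed_eq (by fun_prop) (by fun_prop)
  have hSn : S.Nonempty := ⟨y, by rw [mem_closedBall, dist_comm]; exact hy, by simp⟩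
  obtain ⟨z, ⟨hz1, hz2⟩, hzmax⟩ := hSc.exists_isMaxOn hSn
    (f := fun z => dist x z) (by fun_prop)
  rw [mem_closedBall, dist_comm] at hz1
  rw [mem_ofPred_eq] at hz2
  rcases hz1.eq_or_lt with h | h
  · exact ⟨z, h, by rw [← hz2, h]⟩
  exfalso
  have hxy : 0 < dist x y := dist_pos.2 hy0.symm
  have hxz : x ≠ z := by
    rw [← dist_pos, hz2]; positivity
  obtain ⟨z', h1, h2, h3⟩ := hB.exists_extension hX (mem_ball_self hB.radius_pos)
    (by rw [mem_ball, dist_comm]; linarith : z ∈ ball x R) hxz (e := ρ - dist x z) (by linarith)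
  have hpos : 0 < dist z z' := dist_pos.2 h1.symm
  have hmem : z' ∈ S := by
    refine ⟨by rw [mem_closedBall, dist_comm]; linarith, ?_⟩
    rw [mem_ofPred_eq]
    have t1 := dist_triangle x y z'
    have t2 := dist_triangle y z z'
    linarith
  have h4 : dist x z' ≤ dist x z := hzmax hmem
  linarith

lemma exists_geodesicFrom (hB : NiceBall x R C) {y : X} (hy : y ∈ closedBall x R) (hne : y ≠ x) :
    ∃ γ : GeodesicFrom x, γ.length = dist x y ∧ γ.toFun γ.length = y := by
  obtain ⟨γ, h0, h1, h2⟩ := hB.geodesic x (mem_closedBall_self hB.radius_pos.le) y hy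
  exact ⟨⟨γ, dist x y, dist_pos.2 hne.symm, h0, h2⟩, rfl, h1⟩

lemma exists_geodesicFrom_through (hB : NiceBall x R C) (hX : LocallyGeodesicallyComplete X)
    {y : X} {ρ : ℝ} (hρ : ρ < R) (hy0 : y ≠ x) (hy : dist x y ≤ ρ) :
    ∃ γ : GeodesicFrom x, γ.length = ρ ∧ γ.toFun (dist x y) = y := by
  obtain ⟨z, hz1, hz2⟩ := hB.exists_on_sphere hX hρ hy0 hy
  have hxy : 0 < dist x y := dist_pos.2 hy0.symm
  have myB : y ∈ closedBall x R := by rw [mem_closedBall, dist_comm]; linarith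
  have mzB : z ∈ closedBall x R := by rw [mem_closedBall, dist_comm]; linarith
  obtain ⟨γ₁, a0, a1, a2⟩ := hB.geodesic x (mem_closedBall_self hB.radius_pos.le) y myB
  obtain ⟨γ₂, b0, b1, b2⟩ := hB.geodesic y myB z mzB
  set s := dist x y with hs
  have hyz : dist y z = ρ - s := by linarith
  rw [hyz] at b1 b2
  have start2 : ∀ t ∈ Icc s ρ, dist y (γ₂ (t - s)) = t - s := by
    intro t ht
    have := b2 0 ⟨le_rfl, by linarith⟩ (t - s) ⟨by linarith [ht.1], by linarith [ht.2]⟩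
    rwa [b0, zero_sub, abs_neg, abs_of_nonneg (by linarith [ht.1])] at this
  have end2 : ∀ t ∈ Icc s ρ, dist (γ₂ (t - s)) z = ρ - t := by
    intro t ht
    have := b2 (t - s) ⟨by linarith [ht.1], by linarith [ht.2]⟩ (ρ - s) ⟨by linarith, le_rfl⟩
    rwa [b1, show t - s - (ρ - s) = -(ρ - t) by ring, abs_neg,
      abs_of_nonneg (by linarith [ht.2])] at this
  have start1 : ∀ t ∈ Icc 0 s, dist x (γ₁ t) = t := by
    intro t ht
    have := a2 0 ⟨le_rfl, hxy.le⟩ t ht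
    rwa [a0, zero_sub, abs_neg, abs_of_nonneg ht.1] at this
  have end1 : ∀ t ∈ Icc 0 s, dist (γ₁ t) y = s - t := by
    intro t ht
    have := a2 t ht s ⟨hxy.le, le_rfl⟩
    rwa [a1, show t - s = -(s - t) by ring, abs_neg, abs_of_nonneg (by linarith [ht.2])] at this
  have mixed : ∀ t₁ ∈ Icc 0 s, ∀ t₂ ∈ Icc s ρ, dist (γ₁ t₁) (γ₂ (t₂ - s)) = t₂ - t₁ := by
    intro t₁ h₁ t₂ h₂
    have c1 := dist_triangle (γ₁ t₁) y (γ₂ (t₂ - s))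
    have c2 := dist_triangle4 x (γ₁ t₁) (γ₂ (t₂ - s)) z
    rw [start1 _ h₁, end2 _ h₂, hz1] at c2
    rw [end1 _ h₁, start2 _ h₂] at c1
    linarith
  refine ⟨⟨fun t => if t ≤ s then γ₁ t else γ₂ (t - s), ρ, by linarith, ?_, ?_⟩, rfl, ?_⟩
  · simp only [hxy.le, if_true, a0]
  · intro t ht t' ht'
    split_ifs with h h' h'
    · exact a2 t ⟨ht.1, h⟩ t' ⟨ht'.1, h'⟩
    · rw [mixed t ⟨ht.1, h⟩ t' ⟨by linarith, ht'.2⟩, abs_sub_comm, abs_of_nonneg (by linarith)]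
    · rw [dist_comm, mixed t' ⟨ht'.1, h'⟩ t ⟨by linarith, ht.2⟩, abs_of_nonneg (by linarith)]
    · rw [b2 (t - s) ⟨by linarith, by linarith [ht.2]⟩ (t' - s) ⟨by linarith, by linarith [ht'.2]⟩]
      congr 1; ring
  · simp only [le_refl, if_true, a1]

end NiceBall

end

section

open Metric

/-! ### Comparison angles in small balls -/

variable {X : Type u} [MetricSpace X] {x : X} {R C : ℝ}

/-- The cosine of the Euclidean comparison angle at `x` for the points `γ s` and `η t`. -/
def compCos (γ η : GeodesicFrom x) (s t : ℝ) : ℝ :=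
  (s ^ 2 + t ^ 2 - dist (γ.toFun s) (η.toFun t) ^ 2) / (2 * s * t)

lemma compCos_comm (γ η : GeodesicFrom x) (s t : ℝ) : compCos γ η s t = compCos η γ t s := by
  unfold compCos; rw [dist_comm]; congr 1 <;> ring

lemma compCos_self (γ η : GeodesicFrom x) {s : ℝ} (hs : 0 < s) :
    compCos γ η s s = 1 - dist (γ.toFun s) (η.toFun s) ^ 2 / (2 * s ^ 2) := by
  unfold compCos; field_simp; ring

lemma sq_dist_eq_compCos (γ η : GeodesicFrom x) {s t : ℝ} (hs : 0 < s) (ht : 0 < t) :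
    dist (γ.toFun s) (η.toFun t) ^ 2 = s ^ 2 + t ^ 2 - 2 * s * t * compCos γ η s t := by
  unfold compCos; field_simp; ring

lemma sq_lawOfCosines {s t : ℝ} (hs : 0 ≤ s) (ht : 0 ≤ t) (θ : ℝ) :
    lawOfCosines s t θ ^ 2 = s ^ 2 + t ^ 2 - 2 * s * t * Real.cos θ :=
  Real.sq_sqrt (law_arg_nonneg hs ht θ)

namespace NiceBall

lemma mem_closedBall_of_geodesic (γ : GeodesicFrom x) {r s : ℝ} (hs0 : 0 ≤ s) (hs : s ≤ γ.length)
    (hr : s ≤ r) : γ.toFun s ∈ closedBall x r := by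
  rw [mem_closedBall, γ.dist_start ⟨hs0, hs⟩]; exact hr

/-- Comparison angles are almost monotone in one side of the hinge. -/
lemma compCos_shrink (hB : NiceBall x R C) (γ η : GeodesicFrom x) {r s t l : ℝ} (hr : r ≤ R)
    (hs0 : 0 < s) (ht0 : 0 < t) (hsr : s ≤ r) (htr : t ≤ r) (hs : s ≤ γ.length)
    (ht : t ≤ η.length) (hl0 : 0 < l) (hl1 : l ≤ 1) :
    compCos γ η s t - 2 * (1 - l) * C * r ^ 2 * (s / t) ≤ compCos γ η (l * s) t := by
  have key := hB.sq_dist_le hr hs0 (γ := γ.toFun)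
    (fun a ha b hb => γ.isometric a ⟨ha.1, ha.2.trans hs⟩ b ⟨hb.1, hb.2.trans hs⟩)
    (fun a ha => mem_closedBall_of_geodesic γ ha.1 (ha.2.trans hs) (ha.2.trans hsr))
    (mem_closedBall_of_geodesic η ht0.le ht htr) ⟨hl0.le, hl1⟩
  rw [γ.start, η.dist_start ⟨ht0.le, ht⟩, dist_comm (η.toFun t), dist_comm (η.toFun t)] at key
  rw [compCos, compCos, le_div_iff₀ (by positivity)]
  have e : ((s ^ 2 + t ^ 2 - dist (γ.toFun s) (η.toFun t) ^ 2) / (2 * s * t) -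
      2 * (1 - l) * C * r ^ 2 * (s / t)) * (2 * (l * s) * t) =
      l * (s ^ 2 + t ^ 2 - dist (γ.toFun s) (η.toFun t) ^ 2) -
        4 * l * (1 - l) * C * r ^ 2 * s ^ 2 := by
    field_simp; ring
  rw [e]
  linarith

/-- Comparison angles of isosceles hinges are almost monotone; for ratios in `[1 / 2, 1]` the error
of the two steps, one for each side, is controlled. -/
lemma compCos_diag_half (hB : NiceBall x R C) (γ η : GeodesicFrom x) {s l : ℝ}
    (hs0 : 0 < s) (hsR : s ≤ R) (hs : s ≤ γ.length)
    (hs' : s ≤ η.length) (hl0 : 1 / 2 ≤ l) (hl1 : l ≤ 1) :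
    compCos γ η s s - 3 * C * s ^ 2 ≤ compCos γ η (l * s) (l * s) := by
  have hlpos : 0 < l := by linarith
  have hls : l * s ≤ s := by nlinarith
  have h1 := hB.compCos_shrink γ η hsR hs0 hs0 le_rfl le_rfl hs hs' hlpos hl1
  have h2 := hB.compCos_shrink η γ hsR hs0 (mul_pos hlpos hs0) le_rfl hls hs' (hls.trans hs) hlpos
    hl1
  rw [compCos_comm η γ, compCos_comm η γ] at h2
  rw [div_self hs0.ne'] at h1
  have hCs : 0 ≤ C * s ^ 2 := mul_nonneg hB.const_nonneg (sq_nonneg _)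
  have e : 2 * (1 - l) * C * s ^ 2 * (s / (l * s)) ≤ 2 * C * s ^ 2 := by
    have : (1 - l) * (s / (l * s)) ≤ 1 := by
      rw [mul_div_assoc', div_le_one (by positivity)]; nlinarith
    nlinarith
  nlinarith

/-- Comparison angles of isosceles hinges are almost monotone at all scales: repeated halving gives
errors forming a geometric series. -/
lemma compCos_diag (hB : NiceBall x R C) (γ η : GeodesicFrom x) {s σ : ℝ}
    (hsR : s ≤ R) (hs : s ≤ γ.length)
    (hs' : s ≤ η.length) (hσ0 : 0 < σ) (hσ : σ ≤ s) :
    compCos γ η s s - 4 * C * s ^ 2 ≤ compCos γ η σ σ := by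
  have main : ∀ n : ℕ, ∀ s, s ≤ R → s ≤ γ.length → s ≤ η.length → σ ≤ s → s ≤ 2 ^ n * σ →
      compCos γ η s s - 4 * C * s ^ 2 ≤ compCos γ η σ σ := by
    intro n
    induction n with
    | zero =>
      intro s _ _ _ h1 h2
      have : s = σ := le_antisymm (by simpa using h2) h1
      subst this
      linarith [mul_nonneg hB.const_nonneg (sq_nonneg s)]
    | succ n ih =>
      intro s hsR h1 h2 hσs hn
      have hs0 : 0 < s := hσ0.trans_le hσs
      have hCs : 0 ≤ C * s ^ 2 := mul_nonneg hB.const_nonneg (sq_nonneg _)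
      rcases le_total (s / 2) σ with h | h
      · have := hB.compCos_diag_half γ η hs0 hsR h1 h2 (l := σ / s)
          (by rw [le_div_iff₀ hs0]; linarith) (by rw [div_le_one hs0]; exact hσs)
        rw [div_mul_cancel₀ _ hs0.ne'] at this
        linarith
      · have a1 := hB.compCos_diag_half γ η hs0 hsR h1 h2 (l := 1 / 2) le_rfl (by norm_num)
        have a2 := ih (1 / 2 * s) (by linarith) (by linarith) (by linarith) (by linarith)
          (by rw [pow_succ] at hn; linarith)
        nlinarith
  obtain ⟨n, hn⟩ := pow_unbounded_of_one_lt (s / σ) (one_lt_two)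
  exact main n s hsR hs hs' hσ ((div_le_iff₀ hσ0).1 hn.le)

/-- The comparison angle at scale `s` almost bounds those of all smaller hinges. -/
lemma compCos_corner (hB : NiceBall x R C) (γ η : GeodesicFrom x) {s σ τ : ℝ}
    (hsR : s ≤ R) (hs : s ≤ γ.length)
    (hs' : s ≤ η.length) (hσ0 : 0 < σ) (hσ : σ ≤ s) (hτ0 : 0 < τ) (hτ : τ ≤ s) :
    compCos γ η s s - 6 * C * s ^ 2 ≤ compCos γ η σ τ := by
  have aux : ∀ (γ η : GeodesicFrom x), s ≤ γ.length → s ≤ η.length → ∀ σ τ : ℝ, 0 < τ → τ ≤ σ →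
      σ ≤ s → compCos γ η s s - 6 * C * s ^ 2 ≤ compCos γ η σ τ := by
    intro γ η hs hs' σ τ hτ0 hτσ hσ
    have hσ0 : 0 < σ := hτ0.trans_le hτσ
    have h1 := hB.compCos_diag γ η hsR hs hs' hσ0 hσ
    have h2 := hB.compCos_shrink η γ (hσ.trans hsR) hσ0 hσ0 le_rfl le_rfl (hσ.trans hs')
      (hσ.trans hs) (l := τ / σ) (by positivity) (by rw [div_le_one hσ0]; exact hτσ)
    rw [div_mul_cancel₀ _ hσ0.ne', div_self hσ0.ne', compCos_comm η γ, compCos_comm η γ] at h2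
    have h3 : σ ^ 2 ≤ s ^ 2 := pow_le_pow_left₀ hσ0.le hσ 2
    have h4 : C * σ ^ 2 ≤ C * s ^ 2 := mul_le_mul_of_nonneg_left h3 hB.const_nonneg
    have h5 : 0 ≤ τ / σ * (C * σ ^ 2) :=
      mul_nonneg (by positivity) (mul_nonneg hB.const_nonneg (sq_nonneg _))
    nlinarith
  rcases le_total τ σ with h | h
  · exact aux γ η hs hs' σ τ hτ0 h hσ
  · have := aux η γ hs' hs τ σ hσ0 h hτ
    rwa [compCos_comm η γ, compCos_comm η γ] at this

/-- The angle is almost bounded by the comparison angle. -/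
lemma le_cos_angle (hB : NiceBall x R C) (γ η : GeodesicFrom x) {s : ℝ} (hs0 : 0 < s)
    (hsR : s ≤ R) (hs : s ≤ γ.length) (hs' : s ≤ η.length) :
    compCos γ η s s - 6 * C * s ^ 2 ≤ Real.cos (angle γ η) := by
  set v := compCos γ η s s - 6 * C * s ^ 2 with hv
  rcases le_or_gt v (-1) with h | h
  · exact h.trans (Real.neg_one_le_cos _)
  have hv1 : v ≤ 1 := by
    have := compCos_self γ η hs0
    have h0 : 0 ≤ dist (γ.toFun s) (η.toFun s) ^ 2 / (2 * s ^ 2) := by positivity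
    have h1 : 0 ≤ C * s ^ 2 := mul_nonneg hB.const_nonneg (sq_nonneg _)
    linarith
  have hle : angle γ η ≤ Real.arccos v := by
    refine limsup_le_of_le (bdd_below_angle _ _).isCoboundedUnder_flip ?_
    filter_upwards [eventually_small hs0 hs0] with p hp
    exact Real.arccos_le_arccos
      (hB.compCos_corner γ η hsR hs hs' hp.1.1 hp.1.2.le hp.2.1 hp.2.2.le)
  have := Real.cos_le_cos_of_nonneg_of_le_pi (angle_nonneg γ η) (Real.arccos_le_pi v) hle
  rwa [Real.cos_arccos h.le hv1] at this

/-- Up to an error of order four, distances in a small ball are at least those in the tangent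
cone. -/
lemma sq_law_angle_le (hB : NiceBall x R C) (γ η : GeodesicFrom x) {r s t : ℝ} (hr : r ≤ R)
    (hs0 : 0 ≤ s) (ht0 : 0 ≤ t) (hsr : s ≤ r) (htr : t ≤ r) (hs : s ≤ γ.length)
    (ht : t ≤ η.length) :
    lawOfCosines s t (angle γ η) ^ 2 ≤ dist (γ.toFun s) (η.toFun t) ^ 2 + 16 * C * r ^ 4 := by
  have hr0 : 0 ≤ r := hs0.trans hsr
  have hCr : 0 ≤ 16 * C * r ^ 4 := by have := hB.const_nonneg; positivity
  have aux : ∀ (γ η : GeodesicFrom x) (s t : ℝ), s ≤ γ.length → t ≤ η.length → 0 < t → t ≤ s →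
      s ≤ r → lawOfCosines s t (angle γ η) ^ 2 ≤
        dist (γ.toFun s) (η.toFun t) ^ 2 + 16 * C * r ^ 4 := by
    intro γ η s t hs ht ht0 hts hsr
    have hs0 : 0 < s := ht0.trans_le hts
    rw [sq_lawOfCosines hs0.le ht0.le, sq_dist_eq_compCos γ η hs0 ht0]
    have h1 := hB.le_cos_angle γ η ht0 ((hts.trans hsr).trans hr) (hts.trans hs) ht
    have h2 := hB.compCos_shrink γ η (hsr.trans hr) hs0 ht0 le_rfl hts hs ht (l := t / s)
      (by positivity) (by rw [div_le_one hs0]; exact hts)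
    rw [div_mul_cancel₀ _ hs0.ne'] at h2
    have h3 : compCos γ η s t - (2 * (1 - t / s) * C * s ^ 2 * (s / t) + 6 * C * t ^ 2) ≤
        Real.cos (angle γ η) := by linarith
    have h4 := mul_le_mul_of_nonneg_left h3 (show 0 ≤ 2 * s * t by positivity)
    have e : 2 * s * t * (2 * (1 - t / s) * C * s ^ 2 * (s / t) + 6 * C * t ^ 2) =
        4 * C * s ^ 4 - 4 * C * s ^ 3 * t + 12 * C * (s * t ^ 3) := by
      field_simp; ring
    have hC := hB.const_nonneg
    have h5 : s ^ 4 ≤ r ^ 4 := pow_le_pow_left₀ hs0.le hsr 4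
    have h6 : s * t ^ 3 ≤ r * r ^ 3 :=
      mul_le_mul hsr (pow_le_pow_left₀ ht0.le (hts.trans hsr) 3) (by positivity) hr0
    have h7 : 0 ≤ C * s ^ 3 * t := by positivity
    have h8 := mul_le_mul_of_nonneg_left h5 hC
    have h9 := mul_le_mul_of_nonneg_left h6 hC
    rw [mul_sub, e] at h4
    linarith [show C * (r * r ^ 3) = C * r ^ 4 by ring]
  rcases hs0.eq_or_lt with rfl | hs0'
  · rw [sq_lawOfCosines le_rfl ht0, γ.start, dist_comm, η.dist_start ⟨ht0, ht⟩]
    linarith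
  rcases ht0.eq_or_lt with rfl | ht0'
  · rw [sq_lawOfCosines hs0 le_rfl, η.start, γ.dist_start ⟨hs0, hs⟩]
    linarith
  rcases le_total t s with h | h
  · exact aux γ η s t hs ht ht0' h hsr
  · have := aux η γ t s ht hs hs0' h htr
    rwa [EuclideanCone.law_comm, angle_comm, dist_comm] at this

/-- Two geodesics whose ends are close stay proportionally close at all smaller scales. -/
lemma sq_dist_le_of_end (hB : NiceBall x R C) (γ η : GeodesicFrom x) {ρ s : ℝ} (hρR : ρ ≤ R)
    (h1 : ρ ≤ γ.length) (h2 : ρ ≤ η.length) (hs0 : 0 < s) (hs : s ≤ ρ) :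
    dist (γ.toFun s) (η.toFun s) ^ 2 ≤
      s ^ 2 * (dist (γ.toFun ρ) (η.toFun ρ) ^ 2 / ρ ^ 2 + 8 * C * ρ ^ 2) := by
  have h := hB.compCos_diag γ η hρR h1 h2 hs0 hs
  have hρ0 : 0 < ρ := hs0.trans_le hs
  rw [compCos_self γ η hs0, compCos_self γ η hρ0] at h
  have e1 : dist (γ.toFun s) (η.toFun s) ^ 2 / (2 * s ^ 2) =
    dist (γ.toFun s) (η.toFun s) ^ 2 / s ^ 2 / 2 := by field_simp
  have e2 : dist (γ.toFun ρ) (η.toFun ρ) ^ 2 / (2 * ρ ^ 2) =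
    dist (γ.toFun ρ) (η.toFun ρ) ^ 2 / ρ ^ 2 / 2 := by field_simp
  rw [e1, e2] at h
  have h3 : dist (γ.toFun s) (η.toFun s) ^ 2 / s ^ 2 ≤
    dist (γ.toFun ρ) (η.toFun ρ) ^ 2 / ρ ^ 2 + 8 * C * ρ ^ 2 := by linarith
  rw [div_le_iff₀ (by positivity)] at h3
  linarith

end NiceBall

end

section

open Metric

/-! ### The tangent cone approximates small balls -/

lemma law_self_le {t : ℝ} (ht : 0 ≤ t) (φ : ℝ) : lawOfCosines t t φ ≤ t * |φ| := by
  refine le_of_sq_le_sq ?_ (by positivity)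
  rw [sq_lawOfCosines ht ht, mul_pow, sq_abs]
  have := Real.one_sub_sq_div_two_le_cos (x := φ)
  nlinarith [sq_nonneg t]

lemma law_le_law_add (s : ℝ) {t : ℝ} (ht : 0 ≤ t) (a b : ℝ) :
    lawOfCosines s t a ≤ lawOfCosines s t b + t * |a - b| := by
  have := EuclideanCone.law_triangle_aux s t t b (a - b)
  rw [add_sub_cancel] at this
  linarith [law_self_le ht (a - b)]

lemma law_zero_left {t : ℝ} (ht : 0 ≤ t) (a : ℝ) : lawOfCosines 0 t a = t := by
  unfold lawOfCosines
  rw [show (0 : ℝ) ^ 2 + t ^ 2 - 2 * 0 * t * Real.cos a = t ^ 2 by ring, Real.sqrt_sq ht]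

lemma law_zero_right {s : ℝ} (hs : 0 ≤ s) (a : ℝ) : lawOfCosines s 0 a = s := by
  rw [EuclideanCone.law_comm, law_zero_left hs]

lemma law_pi {s t : ℝ} (hs : 0 ≤ s) (ht : 0 ≤ t) : lawOfCosines s t Real.pi = s + t := by
  unfold lawOfCosines
  rw [Real.cos_pi, show s ^ 2 + t ^ 2 - 2 * s * t * -1 = (s + t) ^ 2 by ring,
    Real.sqrt_sq (by positivity)]

variable {X : Type u} [MetricSpace X] {x : X} {R C : ℝ}

/-- The converse comparison for two fixed geodesics, from the definition of the angle as an upper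
limit. It becomes uniform by means of a finite net of geodesics. -/
lemma eventually_dist_le_law (γ η : GeodesicFrom x) {ε : ℝ} (hε : 0 < ε) :
    ∀ᶠ r in 𝓝[>] (0 : ℝ), ∀ s ∈ Icc 0 r, ∀ t ∈ Icc 0 r,
      dist (γ.toFun s) (η.toFun t) ≤ lawOfCosines s t (angle γ η) + ε * t := by
  obtain ⟨δ, hδ, h⟩ := eventually_lt_of_angle_lt (show angle γ η < angle γ η + ε by linarith)
  have hm : 0 < min δ (min γ.length η.length) :=
    lt_min hδ (lt_min γ.length_pos η.length_pos)
  filter_upwards [Ioo_mem_nhdsGT hm] with r hr s hs t ht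
  have r1 : r < δ := hr.2.trans_le (min_le_left _ _)
  have r2 : r < γ.length := hr.2.trans_le ((min_le_right _ _).trans (min_le_left _ _))
  have r3 : r < η.length := hr.2.trans_le ((min_le_right _ _).trans (min_le_right _ _))
  have ms : s ∈ Icc 0 γ.length := ⟨hs.1, by linarith [hs.2]⟩
  have mt : t ∈ Icc 0 η.length := ⟨ht.1, by linarith [ht.2]⟩
  rcases hs.1.eq_or_lt with rfl | hs0
  · rw [γ.start, dist_comm, η.dist_start mt, law_zero_left ht.1]
    nlinarith [ht.1]
  rcases ht.1.eq_or_lt with rfl | ht0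
  · rw [η.start, γ.dist_start ms, law_zero_right hs.1]
    linarith
  have hd := dist_geodesics γ η ms mt
  rcases le_total (angle γ η + ε) Real.pi with hle | hge
  · have h1 := lt_law_of_comparisonAngle_lt hs0 ht0 hle hd.1
      (h s ⟨hs0, by linarith [hs.2]⟩ t ⟨ht0, by linarith [ht.2]⟩)
    have h2 := law_le_law_add s ht.1 (angle γ η + ε) (angle γ η)
    rw [add_sub_cancel_left, abs_of_pos hε] at h2
    linarith
  · have h2 := law_le_law_add s ht.1 Real.pi (angle γ η)
    rw [law_pi hs.1 ht.1, abs_of_nonneg (by linarith [angle_le_pi γ η])] at h2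
    nlinarith [hd.2]

namespace NiceBall

/-- Finitely many geodesics of a fixed length approximate all geodesics starting at `x`, at every
scale and in the angle metric. -/
lemma exists_finite_net (hB : NiceBall x R C) (hX : LocallyGeodesicallyComplete X) {ε : ℝ}
    (hε : 0 < ε) :
    ∃ ρ > 0, ∃ N : Set (GeodesicFrom x), N.Finite ∧ (∀ η ∈ N, η.length = ρ) ∧
      ∀ γ : GeodesicFrom x, ∀ s, 0 < s → s ≤ ρ → s ≤ γ.length → ∃ η ∈ N,
        dist (γ.toFun s) (η.toFun s) ≤ 2 * ε * s ∧ angle γ η ≤ 4 * ε := by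
  have hC := hB.const_nonneg
  obtain ⟨ρ, hρ, hρR, hρC⟩ : ∃ ρ > 0, ρ < R ∧ 8 * C * ρ ^ 2 ≤ ε ^ 2 := by
    have : ∀ᶠ ρ in 𝓝[>] (0 : ℝ), 8 * C * ρ ^ 2 < ε ^ 2 := by
      apply nhdsWithin_le_nhds
      have hc : ContinuousAt (fun ρ : ℝ => 8 * C * ρ ^ 2) 0 := by fun_prop
      apply hc.eventually_lt continuousAt_const
      simp only [ne_eq, OfNat.ofNat_ne_zero, not_false_eq_true, zero_pow, mul_zero]
      positivity
    obtain ⟨ρ, h1, h2⟩ := (this.and (Ioo_mem_nhdsGT hB.radius_pos)).exists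
    exact ⟨ρ, h2.1, h2.2, h1.le⟩
  have hS : IsCompact (sphere x ρ) :=
    hB.compact.of_isClosed_subset isClosed_sphere
      (sphere_subset_closedBall.trans (closedBall_subset_closedBall hρR.le))
  obtain ⟨T, hTS, hTfin, hT⟩ := hS.finite_cover_balls (mul_pos hε hρ)
  have hgeo : ∀ z ∈ sphere x ρ, ∃ γ : GeodesicFrom x, γ.length = ρ ∧ γ.toFun ρ = z := by
    intro z hz
    have hzρ : dist x z = ρ := by rw [dist_comm]; exact hz
    obtain ⟨γ, h1, h2⟩ := hB.exists_geodesicFrom (y := z)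
      (by rw [mem_closedBall, dist_comm]; linarith)
      (by rintro rfl; rw [dist_self] at hzρ; linarith)
    rw [hzρ] at h1
    exact ⟨γ, h1, by rw [← h1]; exact h2⟩
  choose g hg1 hg2 using hgeo
  refine ⟨ρ, hρ, {η | ∃ z, ∃ hz : z ∈ T, g z (hTS hz) = η},
    hTfin.dependent_image fun z hz => g z (hTS hz), ?_, ?_⟩
  · rintro _ ⟨z, hz, rfl⟩
    exact hg1 z (hTS hz)
  · intro γ s hs0 hsρ hsγ
    set y := γ.toFun s with hy
    have hxy : dist x y = s := by rw [dist_comm, hy, γ.dist_start ⟨hs0.le, hsγ⟩]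
    obtain ⟨γ', hl, hthr⟩ := hB.exists_geodesicFrom_through hX hρR (y := y)
      (by rw [← dist_pos, dist_comm, hxy]; exact hs0) (by rw [hxy]; exact hsρ)
    rw [hxy] at hthr
    have hz : γ'.toFun ρ ∈ sphere x ρ := by
      rw [mem_sphere, γ'.dist_start ⟨hρ.le, hl.ge⟩]
    obtain ⟨z, hzT, hzd⟩ := mem_iUnion₂.1 (hT hz)
    have hl1 := hg1 z (hTS hzT)
    have hl2 := hg2 z (hTS hzT)
    set η := g z (hTS hzT) with hη
    have hd := hB.sq_dist_le_of_end γ' η hρR.le hl.ge hl1.ge hs0 hsρ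
    rw [hthr, hl2] at hd
    have hq : dist (γ'.toFun ρ) z ^ 2 / ρ ^ 2 ≤ ε ^ 2 := by
      rw [div_le_iff₀ (by positivity), ← mul_pow]
      exact pow_le_pow_left₀ dist_nonneg (mem_ball.1 hzd).le 2
    have hd2 : dist y (η.toFun s) ^ 2 ≤ s ^ 2 * (2 * ε ^ 2) :=
      hd.trans (mul_le_mul_of_nonneg_left (by linarith) (sq_nonneg _))
    refine ⟨η, ⟨z, hzT, rfl⟩, ?_, ?_⟩
    · refine le_of_sq_le_sq ?_ (by positivity)
      nlinarith [mul_nonneg (sq_nonneg s) (sq_nonneg ε)]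
    · have hlaw := hB.sq_law_angle_le γ η (hsρ.trans hρR.le) hs0.le hs0.le le_rfl le_rfl hsγ
        (hsρ.trans hl1.ge)
      rw [sq_lawOfCosines hs0.le hs0.le, ← hy] at hlaw
      have hs2 : s ^ 2 ≤ ρ ^ 2 := pow_le_pow_left₀ hs0.le hsρ 2
      have h16 : 16 * C * s ^ 4 ≤ s ^ 2 * (2 * ε ^ 2) := by
        have : 8 * C * s ^ 2 ≤ ε ^ 2 := (mul_le_mul_of_nonneg_left hs2 (by positivity)).trans hρC
        nlinarith [mul_le_mul_of_nonneg_left this (sq_nonneg s)]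
      have hcos : 1 - Real.cos (angle γ η) ≤ 2 * ε ^ 2 := by
        have h2 : s ^ 2 * (1 - Real.cos (angle γ η)) ≤ s ^ 2 * (2 * ε ^ 2) := by
          linarith
        exact le_of_mul_le_mul_left h2 (by positivity)
      have hpi := Real.pi_pos
      have hquad := Real.cos_le_one_sub_mul_cos_sq (x := angle γ η)
        (by rw [abs_of_nonneg (angle_nonneg _ _)]; exact angle_le_pi _ _)
      have h3 : 2 / Real.pi ^ 2 * angle γ η ^ 2 ≤ 2 * ε ^ 2 := by linarith
      have h4 : angle γ η ^ 2 ≤ (Real.pi * ε) ^ 2 := by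
        rw [div_mul_eq_mul_div, div_le_iff₀ (by positivity)] at h3
        nlinarith
      have h5 := le_of_sq_le_sq h4 (by positivity)
      nlinarith [Real.pi_lt_four]

/-- Every direction is approximated by that of a geodesic of length at least `r`. -/
lemma eventually_exists_long (hB : NiceBall x R C) (hX : LocallyGeodesicallyComplete X) {ε : ℝ}
    (hε : 0 < ε) :
    ∀ᶠ r in 𝓝[>] (0 : ℝ), ∀ γ : GeodesicFrom x, ∃ η : GeodesicFrom x, r ≤ η.length ∧
      angle γ η ≤ ε := by
  obtain ⟨ρ, hρ, N, -, hlen, h⟩ := hB.exists_finite_net hX (show 0 < ε / 4 by positivity)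
  filter_upwards [Ioo_mem_nhdsGT hρ] with r hr γ
  obtain ⟨η, hη, -, h2⟩ := h γ (min ρ γ.length) (lt_min hρ γ.length_pos) (min_le_left _ _)
    (min_le_right _ _)
  exact ⟨η, by rw [hlen η hη]; exact hr.2.le, by linarith⟩

lemma totallyBounded_geodesicFrom (hB : NiceBall x R C) (hX : LocallyGeodesicallyComplete X) :
    TotallyBounded (univ : Set (GeodesicFrom x)) := by
  rw [Metric.totallyBounded_iff]
  intro ε hε
  obtain ⟨ρ, hρ, N, hN, hlen, h⟩ := hB.exists_finite_net hX (show 0 < ε / 8 by positivity)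
  refine ⟨N, hN, fun γ _ => ?_⟩
  obtain ⟨η, hη, -, h2⟩ := h γ (min ρ γ.length) (lt_min hρ γ.length_pos) (min_le_left _ _)
    (min_le_right _ _)
  refine mem_iUnion₂.2 ⟨η, hη, ?_⟩
  rw [mem_ball]
  change angle γ η < ε
  linarith

/-- Uniformly over all pairs of geodesics starting at `x`, distances at scale `r` agree with those
in the Euclidean cone up to `ε * r`. -/
theorem eventually_abs_dist_sub_law_le (hB : NiceBall x R C) (hX : LocallyGeodesicallyComplete X)
    {ε : ℝ} (hε : 0 < ε) :
    ∀ᶠ r in 𝓝[>] (0 : ℝ), ∀ γ η : GeodesicFrom x, ∀ s ∈ Icc 0 r, ∀ t ∈ Icc 0 r,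
      s ≤ γ.length → t ≤ η.length →
      |dist (γ.toFun s) (η.toFun t) - lawOfCosines s t (angle γ η)| ≤ ε * r := by
  have hC := hB.const_nonneg
  set e := ε / 13 with he
  have he0 : 0 < e := by positivity
  obtain ⟨ρ, hρ, N, hN, hlen, h⟩ := hB.exists_finite_net hX he0
  have hup : ∀ᶠ r in 𝓝[>] (0 : ℝ), ∀ γ ∈ N, ∀ η ∈ N, ∀ s ∈ Icc 0 r, ∀ t ∈ Icc 0 r,
      dist (γ.toFun s) (η.toFun t) ≤ lawOfCosines s t (angle γ η) + e * t := by
    rw [eventually_all_finite hN]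
    intro γ _
    rw [eventually_all_finite hN]
    intro η _
    exact eventually_dist_le_law γ η he0
  have hsmall : ∀ᶠ r in 𝓝[>] (0 : ℝ), 16 * C * r ^ 2 < ε ^ 2 := by
    apply nhdsWithin_le_nhds
    have hc : ContinuousAt (fun ρ : ℝ => 16 * C * ρ ^ 2) 0 := by fun_prop
    apply hc.eventually_lt continuousAt_const
    simp only [ne_eq, OfNat.ofNat_ne_zero, not_false_eq_true, zero_pow, mul_zero]
    positivity
  filter_upwards [hup, hsmall, Ioo_mem_nhdsGT hρ, Ioo_mem_nhdsGT hB.radius_pos] with r h1 h2 h3 h4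
    γ η s hs t ht hsγ htη
  have hr0 : 0 < r := h3.1
  rcases hs.1.eq_or_lt with rfl | hs0
  · rw [γ.start, dist_comm, η.dist_start ⟨ht.1, htη⟩, law_zero_left ht.1, sub_self, abs_zero]
    positivity
  rcases ht.1.eq_or_lt with rfl | ht0
  · rw [η.start, γ.dist_start ⟨hs.1, hsγ⟩, law_zero_right hs.1, sub_self, abs_zero]
    positivity
  rw [abs_le]
  constructor
  · have hl := hB.sq_law_angle_le γ η h4.2.le hs.1 ht.1 hs.2 ht.2 hsγ htη
    have h5 : 16 * C * r ^ 4 ≤ (ε * r) ^ 2 := by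
      nlinarith [mul_le_mul_of_nonneg_right h2.le (sq_nonneg r)]
    have h6 : lawOfCosines s t (angle γ η) ≤ dist (γ.toFun s) (η.toFun t) + ε * r := by
      refine le_of_sq_le_sq ?_ (by positivity)
      have : 0 ≤ dist (γ.toFun s) (η.toFun t) * (ε * r) := by positivity
      nlinarith
    linarith
  · obtain ⟨γ', hγ', a1, a2⟩ := h γ s hs0 (hs.2.trans h3.2.le) hsγ
    obtain ⟨η', hη', b1, b2⟩ := h η t ht0 (ht.2.trans h3.2.le) htη
    have c1 := h1 γ' hγ' η' hη' s hs t ht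
    have c2 := dist_triangle4 (γ.toFun s) (γ'.toFun s) (η'.toFun t) (η.toFun t)
    rw [dist_comm (η'.toFun t)] at c2
    have c3 := law_le_law_add s ht.1 (angle γ' η') (angle γ η)
    have c4 : |angle γ' η' - angle γ η| ≤ 8 * e := by
      have t1 := angle_triangle γ' γ η'
      have t2 := angle_triangle γ η η'
      have t3 := angle_triangle γ γ' η
      have t4 := angle_triangle γ' η' η
      rw [angle_comm γ' γ] at t1
      rw [angle_comm η' η] at t4
      rw [abs_le]; constructor <;> linarith
    have c5 : t * |angle γ' η' - angle γ η| ≤ r * (8 * e) :=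
      mul_le_mul ht.2 c4 (abs_nonneg _) hr0.le
    have c6 : 2 * e * s ≤ 2 * e * r := by gcongr; exact hs.2
    have c7 : 2 * e * t ≤ 2 * e * r := by gcongr; exact ht.2
    have c8 : e * t ≤ e * r := by gcongr; exact ht.2
    have c9 : ε * r = 13 * (e * r) := by rw [he]; ring
    linarith

end NiceBall

end

section

open Metric

/-! ### Geometry of Euclidean cones -/

namespace EuclideanCone

section Cone

variable {S : Type u}

/-- The point at distance `t` from the apex in the direction `v` (the apex if `t ≤ 0`). -/
def ray (t : ℝ) (v : S) : EuclideanCone S := if h : 0 < t then point t h v else apex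

/-- The dilation of the cone by the factor `c`. -/
def dil (c : ℝ) : EuclideanCone S → EuclideanCone S
  | apex => apex
  | point t _ v => ray (c * t) v

lemma ray_of_pos {t : ℝ} (ht : 0 < t) (v : S) : ray t v = point t ht v := dif_pos ht

lemma ray_zero (v : S) : ray 0 v = apex := dif_neg (lt_irrefl 0)

lemma dil_apex (c : ℝ) : dil c (apex : EuclideanCone S) = apex := rfl

lemma dil_ray (c : ℝ) {t : ℝ} (ht : 0 ≤ t) (v : S) : dil c (ray t v) = ray (c * t) v := by
  rcases ht.eq_or_lt with rfl | ht
  · rw [ray_zero, mul_zero, ray_zero, dil_apex]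
  · rw [ray_of_pos ht]; rfl

lemma exists_eq_ray (p : EuclideanCone S) (hp : p ≠ apex) : ∃ t > 0, ∃ v, p = ray t v := by
  cases p with
  | apex => exact absurd rfl hp
  | point t ht v => exact ⟨t, ht, v, (ray_of_pos ht v).symm⟩

lemma dil_dil_inv {c : ℝ} (hc : 0 < c) (p : EuclideanCone S) : dil c (dil c⁻¹ p) = p := by
  by_cases hp : p = apex
  · rw [hp, dil_apex, dil_apex]
  obtain ⟨s, hs, v, rfl⟩ := exists_eq_ray p hp
  rw [dil_ray _ hs.le, dil_ray _ (by positivity), mul_inv_cancel_left₀ hc.ne']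

variable [MetricSpace S]

lemma dist_apex_ray {t : ℝ} (ht : 0 ≤ t) (v : S) : dist apex (ray t v) = t := by
  rcases ht.eq_or_lt with rfl | ht
  · rw [ray_zero, dist_self]
  · rw [ray_of_pos ht]; rfl

lemma dist_ray_ray {s t : ℝ} (hs : 0 ≤ s) (ht : 0 ≤ t) (v w : S) :
    dist (ray s v) (ray t w) = lawOfCosines s t (min (dist v w) Real.pi) := by
  rcases hs.eq_or_lt with rfl | hs'
  · rw [ray_zero, dist_apex_ray ht, law_zero_left ht]
  rcases ht.eq_or_lt with rfl | ht'
  · rw [ray_zero, dist_comm, dist_apex_ray hs, law_zero_right hs]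
  rw [ray_of_pos hs', ray_of_pos ht']; rfl

/-- The scalar product of two vectors of the cone, with the apex as origin. -/
def ip (p q : EuclideanCone S) : ℝ :=
  (dist apex p ^ 2 + dist apex q ^ 2 - dist p q ^ 2) / 2

lemma sq_dist_eq (p q : EuclideanCone S) :
    dist p q ^ 2 = dist apex p ^ 2 + dist apex q ^ 2 - 2 * ip p q := by
  unfold ip; ring

lemma ip_comm (p q : EuclideanCone S) : ip p q = ip q p := by
  unfold ip; rw [dist_comm p q]; ring

lemma ip_self (p : EuclideanCone S) : ip p p = dist apex p ^ 2 := by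
  unfold ip; rw [dist_self]; ring

lemma ip_apex_left (q : EuclideanCone S) : ip apex q = 0 := by
  unfold ip; rw [dist_self]; ring

lemma ip_apex_right (q : EuclideanCone S) : ip q apex = 0 := by rw [ip_comm, ip_apex_left]

lemma ip_ray {s t : ℝ} (hs : 0 ≤ s) (ht : 0 ≤ t) (v w : S) :
    ip (ray s v) (ray t w) = s * t * Real.cos (min (dist v w) Real.pi) := by
  unfold ip
  rw [dist_apex_ray hs, dist_apex_ray ht, dist_ray_ray hs ht, sq_lawOfCosines hs ht]
  ring

lemma ip_dil_left {c : ℝ} (hc : 0 ≤ c) (p q : EuclideanCone S) : ip (dil c p) q = c * ip p q := by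
  by_cases hp : p = apex
  · rw [hp, dil_apex, ip_apex_left, mul_zero]
  by_cases hq : q = apex
  · rw [hq, ip_apex_right, ip_apex_right, mul_zero]
  obtain ⟨s, hs, v, rfl⟩ := exists_eq_ray p hp
  obtain ⟨t, ht, w, rfl⟩ := exists_eq_ray q hq
  rw [dil_ray c hs.le, ip_ray (by positivity) ht.le, ip_ray hs.le ht.le]
  ring

lemma ip_dil_right {c : ℝ} (hc : 0 ≤ c) (p q : EuclideanCone S) : ip p (dil c q) = c * ip p q := by
  rw [ip_comm, ip_dil_left hc, ip_comm]

lemma dist_apex_dil {c : ℝ} (hc : 0 ≤ c) (p : EuclideanCone S) :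
    dist apex (dil c p) = c * dist apex p := by
  by_cases hp : p = apex
  · rw [hp, dil_apex, dist_self, mul_zero]
  obtain ⟨s, hs, v, rfl⟩ := exists_eq_ray p hp
  rw [dil_ray c hs.le, dist_apex_ray (by positivity), dist_apex_ray hs.le]

lemma dist_dil {c : ℝ} (hc : 0 ≤ c) (p q : EuclideanCone S) :
    dist (dil c p) (dil c q) = c * dist p q := by
  have h : dist (dil c p) (dil c q) ^ 2 = (c * dist p q) ^ 2 := by
    rw [mul_pow, sq_dist_eq, sq_dist_eq p q, dist_apex_dil hc, dist_apex_dil hc, ip_dil_left hc,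
      ip_dil_right hc]
    ring
  exact (pow_left_inj₀ dist_nonneg (mul_nonneg hc dist_nonneg) two_ne_zero).1 h

lemma dist_ray_same_left {t : ℝ} (ht : 0 ≤ t) (v w : S) :
    dist (ray t v) (ray t w) ≤ t * dist v w := by
  rw [dist_ray_ray ht ht]
  refine (law_self_le ht _).trans ?_
  rw [abs_of_nonneg (min_mem v w).1]
  exact mul_le_mul_of_nonneg_left (min_le_left _ _) ht

lemma dist_ray_same_right {s t : ℝ} (hs : 0 ≤ s) (ht : 0 ≤ t) (v : S) :
    dist (ray s v) (ray t v) = |s - t| := by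
  rw [dist_ray_ray hs ht, dist_self, min_eq_left Real.pi_pos.le, lawOfCosines, Real.cos_zero,
    show s ^ 2 + t ^ 2 - 2 * s * t * 1 = (s - t) ^ 2 by ring, Real.sqrt_sq_eq_abs]

instance [CompactSpace S] : ProperSpace (EuclideanCone S) := by
  have hball : ∀ M : ℝ, IsCompact (closedBall (apex : EuclideanCone S) M) := by
    intro M
    have hcont : ContinuousOn (fun p : ℝ × S => ray p.1 p.2) (Icc 0 M ×ˢ univ) := by
      rw [Metric.continuousOn_iff]
      rintro ⟨t, v⟩ ⟨ht, -⟩ ε hε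
      refine ⟨min (ε / 2) (ε / (2 * (t + 1))), by have := ht.1; positivity, ?_⟩
      rintro ⟨s, w⟩ ⟨hs, -⟩ hd
      simp only at ht hs ⊢
      rw [Prod.dist_eq, max_lt_iff] at hd
      have h1 : dist s t < ε / 2 := hd.1.trans_le (min_le_left _ _)
      have h2 : dist w v < ε / (2 * (t + 1)) := hd.2.trans_le (min_le_right _ _)
      have h3 : (t + 1) * dist w v < ε / 2 := by
        rw [lt_div_iff₀ (by linarith [ht.1])] at h2
        linarith
      calc dist (ray s w) (ray t v) ≤ dist (ray s w) (ray t w) + dist (ray t w) (ray t v) :=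
            dist_triangle _ _ _
        _ ≤ dist s t + t * dist w v := by
            rw [dist_ray_same_right hs.1 ht.1, Real.dist_eq]
            gcongr
            exact dist_ray_same_left ht.1 w v
        _ < ε := by nlinarith [dist_nonneg (x := w) (y := v)]
    have hc := (isCompact_Icc.prod isCompact_univ).image_of_continuousOn hcont
    refine (hc.union (isCompact_singleton (x := apex))).of_isClosed_subset isClosed_closedBall ?_
    intro p hp
    by_cases h : p = apex
    · exact Or.inr h
    obtain ⟨t, ht, v, rfl⟩ := exists_eq_ray p h
    rw [mem_closedBall, dist_comm, dist_apex_ray ht.le] at hp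
    exact Or.inl ⟨(t, v), ⟨⟨ht.le, hp⟩, mem_univ _⟩, rfl⟩
  refine ⟨fun p r => (hball (dist apex p + r)).of_isClosed_subset isClosed_closedBall ?_⟩
  apply closedBall_subset_closedBall'
  rw [dist_comm]; linarith

end Cone

end EuclideanCone

/-! ### The logarithm -/

open EuclideanCone

variable {X : Type u} [MetricSpace X] {x : X} {R C : ℝ}

open Classical in
/-- The logarithm at `x`: the tangent vector of some geodesic from `x` to `y`. It is the apex if
there is no nonconstant geodesic of this kind, in particular for `y = x`. -/
def logMap (x y : X) : TangentSpace x :=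
  if h : ∃ γ : GeodesicFrom x, γ.toFun γ.length = y then
    ray h.choose.length (h.choose : GeodesicFrom x)
  else apex

lemma logMap_self (x : X) : logMap x x = apex := by
  refine dif_neg ?_
  rintro ⟨γ, h⟩
  have := γ.dist_start ⟨γ.length_pos.le, le_rfl⟩
  rw [h, dist_self] at this
  exact γ.length_pos.ne this

lemma dist_ray_geodesic {s t : ℝ} (hs : 0 ≤ s) (ht : 0 ≤ t) (γ η : GeodesicFrom x) :
    dist (ray s (γ : SpaceOfDirections x)) (ray t (η : SpaceOfDirections x)) =
      lawOfCosines s t (angle γ η) := by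
  rw [dist_ray_ray hs ht, UniformSpace.Completion.dist_eq]
  change lawOfCosines s t (min (angle γ η) Real.pi) = _
  rw [min_eq_left (angle_le_pi γ η)]

namespace NiceBall

lemma exists_logMap_eq (hB : NiceBall x R C) {y : X} (hy : y ∈ closedBall x R) (hne : y ≠ x) :
    ∃ γ : GeodesicFrom x, γ.length = dist x y ∧ γ.toFun γ.length = y ∧
      logMap x y = ray (dist x y) (γ : SpaceOfDirections x) := by
  have h : ∃ γ : GeodesicFrom x, γ.toFun γ.length = y := by
    obtain ⟨γ, -, h⟩ := hB.exists_geodesicFrom hy hne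
    exact ⟨γ, h⟩
  have hl : h.choose.length = dist x y := by
    have := h.choose.dist_start ⟨h.choose.length_pos.le, le_rfl⟩
    rw [h.choose_spec, dist_comm] at this
    exact this.symm
  refine ⟨h.choose, hl, h.choose_spec, ?_⟩
  rw [← hl]
  exact dif_pos h

lemma dist_apex_logMap (hB : NiceBall x R C) {y : X} (hy : y ∈ closedBall x R) :
    dist apex (logMap x y) = dist x y := by
  by_cases hne : y = x
  · rw [hne, logMap_self, dist_self, dist_self]
  · obtain ⟨γ, -, -, h⟩ := hB.exists_logMap_eq hy hne
    rw [h, dist_apex_ray dist_nonneg]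

/-- The logarithm is almost isometric at small scales. -/
lemma eventually_dist_logMap (hB : NiceBall x R C) (hX : LocallyGeodesicallyComplete X) {ε : ℝ}
    (hε : 0 < ε) :
    ∀ᶠ r in 𝓝[>] (0 : ℝ), ∀ y ∈ closedBall x r, ∀ z ∈ closedBall x r,
      |dist y z - dist (logMap x y) (logMap x z)| ≤ ε * r := by
  filter_upwards [hB.eventually_abs_dist_sub_law_le hX hε, Ioo_mem_nhdsGT hB.radius_pos] with
    r h1 h2 y hy z hz
  have hyR := closedBall_subset_closedBall h2.2.le hy
  have hzR := closedBall_subset_closedBall h2.2.le hz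
  have hr0 : 0 ≤ ε * r := mul_nonneg hε.le h2.1.le
  by_cases hyx : y = x
  · rw [hyx, logMap_self, hB.dist_apex_logMap hzR, sub_self, abs_zero]; exact hr0
  by_cases hzx : z = x
  · rw [hzx, logMap_self, dist_comm, dist_comm (logMap x y), hB.dist_apex_logMap hyR, sub_self,
      abs_zero]
    exact hr0
  obtain ⟨γ, a1, a2, a3⟩ := hB.exists_logMap_eq hyR hyx
  obtain ⟨η, b1, b2, b3⟩ := hB.exists_logMap_eq hzR hzx
  rw [a3, b3, dist_ray_geodesic dist_nonneg dist_nonneg]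
  rw [mem_closedBall, dist_comm] at hy hz
  have := h1 γ η (dist x y) ⟨dist_nonneg, hy⟩ (dist x z) ⟨dist_nonneg, hz⟩ a1.ge b1.ge
  rwa [← a1, ← b1, a2, b2] at *

lemma eventually_dist_logMap_ray (hB : NiceBall x R C) (hX : LocallyGeodesicallyComplete X) {ε : ℝ}
    (hε : 0 < ε) :
    ∀ᶠ r in 𝓝[>] (0 : ℝ), ∀ γ : GeodesicFrom x, ∀ s ∈ Icc 0 r, s ≤ γ.length →
      dist (logMap x (γ.toFun s)) (ray s (γ : SpaceOfDirections x)) ≤ ε * r := by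
  filter_upwards [hB.eventually_abs_dist_sub_law_le hX hε, Ioo_mem_nhdsGT hB.radius_pos] with
    r h1 h2 γ s hs hsγ
  have hd : dist x (γ.toFun s) = s := by rw [dist_comm, γ.dist_start ⟨hs.1, hsγ⟩]
  rcases hs.1.eq_or_lt with rfl | hs0
  · rw [γ.start, logMap_self, ray_zero, dist_self]; exact mul_nonneg hε.le h2.1.le
  obtain ⟨η, b1, b2, b3⟩ := hB.exists_logMap_eq (y := γ.toFun s)
    (by rw [mem_closedBall, dist_comm, hd]; linarith [hs.2, h2.2])
    (by rw [← dist_pos, dist_comm, hd]; exact hs0)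
  rw [hd] at b1 b3
  rw [b1] at b2
  rw [b3, dist_ray_geodesic hs.1 hs.1]
  have := h1 η γ s hs s hs b1.ge hsγ
  rw [b2, dist_self, zero_sub, abs_neg] at this
  exact (le_abs_self _).trans this

/-- The logarithm is almost surjective at small scales. -/
lemma eventually_exists_logMap_near (hB : NiceBall x R C) (hX : LocallyGeodesicallyComplete X)
    {ε : ℝ} (hε : 0 < ε) :
    ∀ᶠ r in 𝓝[>] (0 : ℝ), ∀ v : TangentSpace x, dist apex v ≤ r →
      ∃ y, dist x y = dist apex v ∧ dist v (logMap x y) ≤ ε * r := by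
  filter_upwards [hB.eventually_dist_logMap_ray hX (half_pos hε),
    hB.eventually_exists_long hX (show 0 < ε / 4 by positivity), Ioo_mem_nhdsGT hB.radius_pos]
    with r h1 h2 h3 v hv
  by_cases hva : v = apex
  · refine ⟨x, by rw [hva, dist_self, dist_self], ?_⟩
    rw [hva, logMap_self, dist_self]
    exact mul_nonneg hε.le h3.1.le
  obtain ⟨t, ht, w, rfl⟩ := exists_eq_ray v hva
  rw [dist_apex_ray ht.le] at hv ⊢
  obtain ⟨γ, hγ⟩ := (UniformSpace.Completion.denseRange_coe (α := GeodesicFrom x)).exists_dist_lt w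
    (show 0 < ε / 4 by positivity)
  obtain ⟨η, hη, hang⟩ := h2 γ
  have hl : t ≤ η.length := hv.trans hη
  refine ⟨η.toFun t, by rw [dist_comm, η.dist_start ⟨ht.le, hl⟩], ?_⟩
  have h4 := h1 η t ⟨ht.le, hv⟩ hl
  rw [dist_comm] at h4
  have h5 : dist w (η : SpaceOfDirections x) ≤ ε / 2 := by
    have h6 : dist (γ : SpaceOfDirections x) η ≤ ε / 4 := by
      rw [UniformSpace.Completion.dist_eq]; exact hang
    linarith [dist_triangle w (γ : SpaceOfDirections x) η]
  calc _ ≤ dist (ray t w) (ray t (η : SpaceOfDirections x)) + _ := dist_triangle _ _ _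
    _ ≤ t * dist w (η : SpaceOfDirections x) + ε / 2 * r :=
        add_le_add (dist_ray_same_left ht.le _ _) h4
    _ ≤ r * (ε / 2) + ε / 2 * r := by gcongr; exact h3.1.le
    _ = ε * r := by ring

lemma compactSpace_spaceOfDirections (hB : NiceBall x R C) (hX : LocallyGeodesicallyComplete X) :
    CompactSpace (SpaceOfDirections x) := by
  have h1 := hB.totallyBounded_geodesicFrom hX
  have h2 : TotallyBounded (univ : Set (SpaceOfDirections x)) := by
    have h3 := (h1.image (UniformSpace.Completion.uniformContinuous_coe (GeodesicFrom x))).closure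
    rw [image_univ, UniformSpace.Completion.denseRange_coe.closure_range] at h3
    exact h3
  exact ⟨isCompact_iff_totallyBounded_isComplete.2
    ⟨h2, completeSpace_iff_isComplete_univ.1 inferInstance⟩⟩

end NiceBall

/-- At the scale `r`, the ball of radius `M * r` around `x` is `ε * r`-close to the ball of radius
`M * r` around the apex of the tangent space, by means of the rescaled logarithm `ℓ`. -/
structure BlowUp (x : X) (M ε r : ℝ) (ℓ : X → TangentSpace x) : Prop where
  pos : 0 < r
  dist_le : ∀ y ∈ closedBall x (M * r), ∀ z ∈ closedBall x (M * r),
    |dist y z - r * dist (ℓ y) (ℓ z)| ≤ ε * r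
  norm_eq : ∀ y ∈ closedBall x (M * r), dist x y = r * dist apex (ℓ y)
  exists_near : ∀ v, dist apex v ≤ M → ∃ y ∈ closedBall x (M * r), dist v (ℓ y) ≤ ε

/-- The rescaled balls around `x` converge to the tangent space. -/
theorem NiceBall.eventually_blowUp (hB : NiceBall x R C) (hX : LocallyGeodesicallyComplete X)
    {M ε : ℝ} (hM : 0 < M) (hε : 0 < ε) :
    ∀ᶠ r in 𝓝[>] (0 : ℝ), BlowUp x M ε r (fun y => dil r⁻¹ (logMap x y)) := by
  have hεM : 0 < ε / M := by positivity
  have htend : Tendsto (fun r : ℝ => M * r) (𝓝[>] 0) (𝓝[>] 0) := by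
    refine tendsto_nhdsWithin_iff.2 ⟨?_, ?_⟩
    · apply tendsto_nhdsWithin_of_tendsto_nhds
      have : Continuous fun r : ℝ => M * r := by fun_prop
      simpa using this.tendsto 0
    · filter_upwards [self_mem_nhdsWithin] with r hr
      exact mul_pos hM hr
  filter_upwards [htend.eventually (hB.eventually_dist_logMap hX hεM),
    htend.eventually (hB.eventually_exists_logMap_near hX hεM),
    htend.eventually (Ioo_mem_nhdsGT hB.radius_pos), self_mem_nhdsWithin] with r h1 h2 h3 h4
  have hr : 0 < r := h4
  have e1 : ε / M * (M * r) = ε * r := by field_simp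
  rw [e1] at h1 h2
  refine ⟨hr, ?_, ?_, ?_⟩
  · intro y hy z hz
    have := h1 y hy z hz
    rwa [dist_dil (inv_nonneg.2 hr.le), mul_inv_cancel_left₀ hr.ne']
  · intro y hy
    rw [dist_apex_dil (inv_nonneg.2 hr.le), mul_inv_cancel_left₀ hr.ne',
      hB.dist_apex_logMap (closedBall_subset_closedBall h3.2.le hy)]
  · intro v hv
    have hn : dist apex (dil r v) = r * dist apex v := dist_apex_dil hr.le v
    obtain ⟨y, hy1, hy2⟩ := h2 (dil r v) (by rw [hn, mul_comm M]; gcongr)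
    refine ⟨y, by rw [mem_closedBall, dist_comm, hy1, hn, mul_comm M]; gcongr, ?_⟩
    have h5 : dist (dil r v) (dil r (dil r⁻¹ (logMap x y))) ≤ ε * r := by
      rwa [dil_dil_inv hr]
    rw [dist_dil hr.le] at h5
    exact le_of_mul_le_mul_left (by linarith) hr

end

section

open Metric

/-! ### Splitting off Euclidean factors from cones -/

namespace EuclideanCone

section Splitting

variable {S : Type u} [MetricSpace S]

/-- `U` and `V` are unit vectors of the cone spanning a line which is a direct factor: the
parallelogram law holds for `U`, `V` and every third point. -/
structure OppositePair (U V : EuclideanCone S) : Prop where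
  norm_left : dist apex U = 1
  parallelogram : ∀ z, dist z U ^ 2 + dist z V ^ 2 = 2 * dist apex z ^ 2 + 2

/-- The vectors `U i` form an orthonormal system and the `V i` are their opposites. -/
structure FlatFrame {k : ℕ} (U V : Fin k → EuclideanCone S) : Prop where
  opposite : ∀ i, OppositePair (U i) (V i)
  orthogonal : ∀ i j, i ≠ j → dist (U i) (U j) ^ 2 = 2

/-- The `CAT(0)` condition for a cone, in the form of the midpoint inequality. -/
def HasMidpoints (S : Type u) [MetricSpace S] : Prop :=
  ∀ p c : EuclideanCone S, ∃ m, ∀ q,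
    dist q m ^ 2 ≤ dist q p ^ 2 / 2 + dist q c ^ 2 / 2 - dist p c ^ 2 / 4

namespace OppositePair

variable {U V : EuclideanCone S}

lemma norm_right (h : OppositePair U V) : dist apex V = 1 := by
  have := h.parallelogram apex
  rw [h.norm_left, dist_self] at this
  have h1 : dist apex V ^ 2 = 1 := by linarith
  exact (pow_eq_one_iff_of_nonneg dist_nonneg two_ne_zero).1 h1

lemma ip_right (h : OppositePair U V) (z : EuclideanCone S) : ip z V = - ip z U := by
  have h1 := h.parallelogram z
  unfold ip
  rw [h.norm_left, h.norm_right]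
  linarith

lemma ip_self_left (h : OppositePair U V) : ip U U = 1 := by
  rw [ip_self, h.norm_left, one_pow]

lemma symm (h : OppositePair U V) : OppositePair V U :=
  ⟨h.norm_right, fun z => by rw [add_comm]; exact h.parallelogram z⟩

end OppositePair

/-- Iterated midpoints: the point at ratio `2⁻ʲ` on the segment from `p` to `c`. -/
lemma HasMidpoints.dyadic (hT : HasMidpoints S) (p c : EuclideanCone S) (j : ℕ) :
    ∃ m, ∀ q, dist q m ^ 2 ≤ (1 - (1 / 2) ^ j) * dist q p ^ 2 + (1 / 2) ^ j * dist q c ^ 2 -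
      (1 / 2) ^ j * (1 - (1 / 2) ^ j) * dist p c ^ 2 := by
  induction j with
  | zero => exact ⟨c, fun q => by simp⟩
  | succ j ih =>
    obtain ⟨m, hm⟩ := ih
    obtain ⟨m', hm'⟩ := hT p m
    set l : ℝ := (1 / 2) ^ j with hl
    have hl0 : 0 < l := by positivity
    have hl1 : l ≤ 1 := pow_le_one₀ (by norm_num) (by norm_num)
    have hc := hm c
    rw [dist_self, dist_comm c p] at hc
    have hc1 : dist c m ≤ (1 - l) * dist p c := by
      refine le_of_sq_le_sq ?_ (mul_nonneg (by linarith) dist_nonneg)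
      nlinarith
    have hpm : l * dist p c ≤ dist p m := by
      have := dist_triangle_right p c m
      linarith
    have hpm2 : l ^ 2 * dist p c ^ 2 ≤ dist p m ^ 2 := by
      rw [← mul_pow]; exact pow_le_pow_left₀ (by positivity) hpm 2
    refine ⟨m', fun q => ?_⟩
    have h1 := hm' q
    have h2 := hm q
    rw [show ((1 : ℝ) / 2) ^ (j + 1) = l / 2 by rw [pow_succ, hl]; ring]
    nlinarith

/-- A translation by `s * U` changes the scalar product with `W` by `s * ip W U`. -/
lemma ip_translation {U p p' : EuclideanCone S} {s : ℝ}
    (hp : ∀ q, dist p' q ^ 2 = dist p q ^ 2 + 2 * s * (ip p U - ip q U) + s ^ 2)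
    (W : EuclideanCone S) : ip p' W = ip p W + s * ip W U := by
  have h1 := hp apex
  have h2 := hp W
  rw [ip_apex_left, dist_comm, dist_comm p] at h1
  unfold ip at *
  linarith

lemma nonpos_of_forall_mul_le {a K : ℝ} (h : ∀ N : ℝ, 0 < N → N * a ≤ K) : a ≤ 0 := by
  by_contra hpos
  have ha : 0 < a := not_le.1 hpos
  have := h ((|K| + 1) / a) (by positivity)
  rw [div_mul_cancel₀ _ ha.ne'] at this
  linarith [le_abs_self K]

namespace OppositePair

variable {U V : EuclideanCone S} [CompactSpace S]

/-- The translated point is the limit of the points at ratio `2⁻ʲ` on the segments from `p` to the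
far away point `(2ʲ * s) U` on the ray through `U`. -/
lemma exists_translation_le (h : OppositePair U V) (hT : HasMidpoints S) (p : EuclideanCone S)
    {s : ℝ} (hs : 0 ≤ s) :
    ∃ p', ∀ q, dist p' q ^ 2 ≤ dist p q ^ 2 + 2 * s * (ip p U - ip q U) + s ^ 2 := by
  set l : ℕ → ℝ := fun j => (1 / 2) ^ j with hl
  have hl0 : ∀ j, 0 < l j := fun j => by positivity
  have hl1 : ∀ j, l j ≤ 1 := fun j => pow_le_one₀ (by norm_num) (by norm_num)
  have hlim : Tendsto l atTop (𝓝 0) :=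
    tendsto_pow_atTop_nhds_zero_of_lt_one (by norm_num) (by norm_num)
  have hm : ∀ j, ∃ m, ∀ q, dist q m ^ 2 ≤ dist q p ^ 2 + 2 * s * (ip p U - ip q U) + s ^ 2 +
      l j * (dist apex q ^ 2 - dist q p ^ 2 - dist apex p ^ 2 + l j * dist apex p ^ 2 -
        2 * s * ip p U) := by
    intro j
    obtain ⟨m, hm⟩ := hT.dyadic p (dil (s / l j) U) j
    refine ⟨m, fun q => (hm q).trans (le_of_eq ?_)⟩
    have h0 : 0 ≤ s / l j := div_nonneg hs (hl0 j).le
    rw [sq_dist_eq q (dil _ U), sq_dist_eq p (dil _ U), ip_dil_right h0, ip_dil_right h0,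
      dist_apex_dil h0, h.norm_left]
    change (1 - l j) * _ + l j * _ - l j * (1 - l j) * _ = _
    have := (hl0 j).ne'
    field_simp
    ring
  choose m hm using hm
  set K := s ^ 2 + dist apex p ^ 2 + 2 * s * |ip p U| with hK
  have hbd : ∀ j, m j ∈ closedBall p (K + 1) := by
    intro j
    have h1 := hm j p
    rw [dist_self] at h1
    have h2 : l j * (dist apex p ^ 2 - 0 ^ 2 - dist apex p ^ 2 + l j * dist apex p ^ 2 -
        2 * s * ip p U) ≤ dist apex p ^ 2 + 2 * s * |ip p U| := by
      have a1 : l j * (l j * dist apex p ^ 2) ≤ 1 * (1 * dist apex p ^ 2) := by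
        have := hl1 j; have := (hl0 j).le; gcongr
      have a2 : l j * (2 * s * (-ip p U)) ≤ 1 * (2 * s * |ip p U|) := by
        have b1 : 2 * s * (-ip p U) ≤ 2 * s * |ip p U| := by gcongr; exact neg_le_abs _
        have b2 := mul_le_mul_of_nonneg_left b1 (hl0 j).le
        have b3 := mul_le_mul_of_nonneg_right (hl1 j)
          (show 0 ≤ 2 * s * |ip p U| by positivity)
        exact b2.trans b3
      linarith
    have h3 : dist p (m j) ^ 2 ≤ K := by rw [hK]; linarith
    rw [mem_closedBall, dist_comm]
    have hK0 : 0 ≤ K := by positivity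
    nlinarith [dist_nonneg (x := p) (y := m j)]
  obtain ⟨p', -, φ, hφ, hp'⟩ := (isCompact_closedBall p (K + 1)).tendsto_subseq hbd
  refine ⟨p', fun q => ?_⟩
  have hl' : Tendsto (fun j => l (φ j)) atTop (𝓝 0) := hlim.comp hφ.tendsto_atTop
  have t1 : Tendsto (fun j => dist q (m (φ j)) ^ 2) atTop (𝓝 (dist q p' ^ 2)) :=
    (tendsto_const_nhds.dist hp').pow 2
  have t2 : Tendsto (fun j => dist q p ^ 2 + 2 * s * (ip p U - ip q U) + s ^ 2 +
      l (φ j) * (dist apex q ^ 2 - dist q p ^ 2 - dist apex p ^ 2 + l (φ j) * dist apex p ^ 2 -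
        2 * s * ip p U)) atTop (𝓝 (dist q p ^ 2 + 2 * s * (ip p U - ip q U) + s ^ 2 +
      0 * (dist apex q ^ 2 - dist q p ^ 2 - dist apex p ^ 2 + 0 * dist apex p ^ 2 -
        2 * s * ip p U))) := by
    apply Tendsto.const_add
    apply hl'.mul
    apply Tendsto.sub_const
    apply Tendsto.const_add
    exact hl'.mul_const _
  have := le_of_tendsto_of_tendsto' t1 t2 (fun j => hm (φ j) q)
  rw [dist_comm p' q, dist_comm p q]
  linarith

/-- Translation by `s * U`. The inequality of `exists_translation_le`, applied to `U` and then to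
the opposite vector `V`, leads back to the original point, so both inequalities are equalities. -/
lemma exists_translation (h : OppositePair U V) (hT : HasMidpoints S) (p : EuclideanCone S)
    (s : ℝ) :
    ∃ p', ∀ q, dist p' q ^ 2 = dist p q ^ 2 + 2 * s * (ip p U - ip q U) + s ^ 2 := by
  have main : ∀ {U V : EuclideanCone S}, OppositePair U V → ∀ s, 0 ≤ s →
      ∃ p', ∀ q, dist p' q ^ 2 = dist p q ^ 2 + 2 * s * (ip p U - ip q U) + s ^ 2 := by
    intro U V h s hs
    obtain ⟨p', hp'⟩ := h.exists_translation_le hT p hs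
    -- testing with the far away points `N U` and `N V` determines `ip p' U`
    have hge : ip p U + s - ip p' U ≤ 0 := by
      apply nonpos_of_forall_mul_le
        (K := (dist apex p ^ 2 - dist apex p' ^ 2 + 2 * s * ip p U + s ^ 2) / 2)
      intro N hN
      have := hp' (dil N U)
      rw [sq_dist_eq, sq_dist_eq p, dist_apex_dil hN.le, ip_dil_right hN.le, ip_dil_right hN.le,
        ip_dil_left hN.le, h.ip_self_left, h.norm_left] at this
      linarith
    have hle : ip p' U - ip p U - s ≤ 0 := by
      apply nonpos_of_forall_mul_le
        (K := (dist apex p ^ 2 - dist apex p' ^ 2 + 2 * s * ip p U + s ^ 2) / 2)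
      intro N hN
      have := hp' (dil N V)
      rw [sq_dist_eq, sq_dist_eq p, dist_apex_dil hN.le, ip_dil_right hN.le, ip_dil_right hN.le,
        ip_dil_left hN.le, h.ip_right, h.ip_right, ip_comm V U, h.ip_right, h.ip_self_left,
        h.norm_right] at this
      linarith
    have heq : ip p' U = ip p U + s := by linarith
    obtain ⟨p'', hp''⟩ := h.symm.exists_translation_le hT p' hs
    have hback : p'' = p := by
      have h1 := hp'' p
      have h2 := hp' p
      rw [dist_self] at h2
      rw [h.ip_right, h.ip_right, heq] at h1
      have h3 : dist p'' p ^ 2 ≤ 0 := by nlinarith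
      exact dist_eq_zero.1 (pow_eq_zero_iff two_ne_zero |>.1 (le_antisymm h3 (sq_nonneg _)))
    refine ⟨p', fun q => le_antisymm (hp' q) ?_⟩
    have h1 := hp'' q
    rw [hback, h.ip_right, h.ip_right, heq] at h1
    nlinarith
  rcases le_total 0 s with hs | hs
  · exact main h s hs
  · obtain ⟨p', hp'⟩ := main h.symm (-s) (by linarith)
    refine ⟨p', fun q => ?_⟩
    rw [hp' q, h.ip_right, h.ip_right]
    ring

end OppositePair

namespace FlatFrame

variable {k : ℕ} {U V : Fin k → EuclideanCone S}

lemma ip_orthogonal (h : FlatFrame U V) {i j : Fin k} (hij : i ≠ j) : ip (U i) (U j) = 0 := by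
  unfold ip
  rw [h.orthogonal i j hij, (h.opposite i).norm_left, (h.opposite j).norm_left]
  norm_num

variable [CompactSpace S]

/-- The translations along the vectors of the frame combine to translations by arbitrary vectors of
`ℝ ^ k`, which do not change the component orthogonal to the frame. -/
lemma exists_translation (h : FlatFrame U V) (hT : HasMidpoints S) (a : Fin k → ℝ)
    (p : EuclideanCone S) :
    ∃ p', (∀ i, ip p' (U i) = ip p (U i) + a i) ∧
      ∀ q, dist p' q ^ 2 - ∑ i, (ip p' (U i) - ip q (U i)) ^ 2 =
        dist p q ^ 2 - ∑ i, (ip p (U i) - ip q (U i)) ^ 2 := by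
  have main : ∀ s : Finset (Fin k), ∃ p',
      (∀ i, ip p' (U i) = ip p (U i) + if i ∈ s then a i else 0) ∧
      ∀ q, dist p' q ^ 2 - ∑ i, (ip p' (U i) - ip q (U i)) ^ 2 =
        dist p q ^ 2 - ∑ i, (ip p (U i) - ip q (U i)) ^ 2 := by
    intro s
    induction s using Finset.induction_on with
    | empty => exact ⟨p, by simp, fun q => rfl⟩
    | insert j s hj ih =>
      obtain ⟨p₁, h1, h2⟩ := ih
      obtain ⟨p', hp'⟩ := (h.opposite j).exists_translation hT p₁ (a j)
      have hip : ∀ i, ip p' (U i) = ip p₁ (U i) + if i = j then a j else 0 := by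
        intro i
        rw [ip_translation hp']
        split_ifs with hij
        · rw [hij, (h.opposite j).ip_self_left, mul_one]
        · rw [h.ip_orthogonal hij, mul_zero]
      refine ⟨p', fun i => ?_, fun q => ?_⟩
      · rw [hip, h1]
        by_cases hij : i = j
        · subst hij; simp [hj]
        · simp [hij]
      · rw [← h2 q, hp' q]
        have : ∑ i, (ip p' (U i) - ip q (U i)) ^ 2 = ∑ i, (ip p₁ (U i) - ip q (U i)) ^ 2 +
            (2 * a j * (ip p₁ (U j) - ip q (U j)) + a j ^ 2) := by
          rw [← Finset.add_sum_erase _ _ (Finset.mem_univ j),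
            ← Finset.add_sum_erase (Finset.univ) (fun i => (ip p₁ (U i) - ip q (U i)) ^ 2)
              (Finset.mem_univ j), hip j, if_pos rfl]
          have : ∑ i ∈ Finset.univ.erase j, (ip p' (U i) - ip q (U i)) ^ 2 =
              ∑ i ∈ Finset.univ.erase j, (ip p₁ (U i) - ip q (U i)) ^ 2 := by
            refine Finset.sum_congr rfl fun i hi => ?_
            rw [hip i, if_neg (Finset.ne_of_mem_erase hi), add_zero]
          rw [this]
          ring
        rw [this]
        ring
  obtain ⟨p', h1, h2⟩ := main Finset.univ
  exact ⟨p', fun i => by simpa using h1 i, h2⟩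

end FlatFrame

lemma sq_dist_withLp {E Y : Type*} [MetricSpace E] [MetricSpace Y] (p q : WithLp 2 (E × Y)) :
    dist p q ^ 2 = dist p.fst q.fst ^ 2 + dist p.snd q.snd ^ 2 := by
  have h := WithLp.prod_dist_eq_add (p := 2) (by norm_num) p q
  have h2 : dist p q = √(dist p.fst q.fst ^ 2 + dist p.snd q.snd ^ 2) := by
    rw [Real.sqrt_eq_rpow]
    refine h.trans ?_
    norm_num
  rw [h2, Real.sq_sqrt (by positivity)]

/-- The second factor is the set of points orthogonal to the frame, onto which the cone is projected
by translations. -/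
theorem FlatFrame.splitsOff [CompactSpace S] {k : ℕ} {U V : Fin k → EuclideanCone S}
    (h : FlatFrame U V) (hT : HasMidpoints S) : SplitsOff k (EuclideanCone S) := by
  let Y := {p : EuclideanCone S // ∀ i, ip p (U i) = 0}
  have hpr : ∀ p : EuclideanCone S, ∃ y : Y,
      ∀ q, dist (y : EuclideanCone S) q ^ 2 - ∑ i, (ip y (U i) - ip q (U i)) ^ 2 =
        dist p q ^ 2 - ∑ i, (ip p (U i) - ip q (U i)) ^ 2 := by
    intro p
    obtain ⟨p', h1, h2⟩ := h.exists_translation hT (fun i => - ip p (U i)) p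
    exact ⟨⟨p', fun i => by rw [h1, add_neg_cancel]⟩, h2⟩
  choose pr hpr using hpr
  have hdist : ∀ p q, dist (pr p) (pr q) ^ 2 =
      dist p q ^ 2 - ∑ i, (ip p (U i) - ip q (U i)) ^ 2 := by
    intro p q
    have h1 := hpr p (pr q)
    have h2 := hpr q p
    have e : ∑ i, (ip (pr p : EuclideanCone S) (U i) - ip (pr q : EuclideanCone S) (U i)) ^ 2 = 0 :=
      Finset.sum_eq_zero fun i _ => by rw [(pr p).2 i, (pr q).2 i, sub_self, zero_pow two_ne_zero]
    have e1 : ∀ a b : EuclideanCone S, ∑ i, (ip a (U i) - ip b (U i)) ^ 2 =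
        ∑ i, (ip b (U i) - ip a (U i)) ^ 2 := fun a b =>
      Finset.sum_congr rfl fun i _ => by ring
    rw [e] at h1
    rw [dist_comm, dist_comm q p, e1, e1 q p] at h2
    rw [Subtype.dist_eq]
    linarith
  let f : EuclideanCone S → WithLp 2 (EuclideanSpace ℝ (Fin k) × Y) := fun p =>
    WithLp.toLp 2 (WithLp.toLp 2 (fun i => ip p (U i)), pr p)
  have hf : Isometry f := by
    refine Isometry.of_dist_eq fun p q => ?_
    refine (pow_left_inj₀ dist_nonneg dist_nonneg two_ne_zero).1 ?_
    rw [sq_dist_withLp]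
    change dist (WithLp.toLp 2 (fun i => ip p (U i)) : EuclideanSpace ℝ (Fin k))
      (WithLp.toLp 2 (fun i => ip q (U i))) ^ 2 + dist (pr p) (pr q) ^ 2 = _
    rw [hdist, EuclideanSpace.dist_eq, Real.sq_sqrt (Finset.sum_nonneg fun i _ => sq_nonneg _)]
    simp only [Real.dist_eq, sq_abs]
    ring
  have hsurj : Function.Surjective f := by
    intro w
    obtain ⟨p, h1, h2⟩ := h.exists_translation hT (fun i => w.fst i) (w.snd : EuclideanCone S)
    have hF : ∀ i, ip p (U i) = w.fst i := fun i => by rw [h1, w.snd.2 i, zero_add]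
    refine ⟨p, ?_⟩
    have hsnd : pr p = w.snd := by
      have h3 := hpr p w.snd
      have h4 := h2 w.snd
      rw [← h3, dist_self] at h4
      have e : ∑ i, (ip (pr p : EuclideanCone S) (U i) - ip (w.snd : EuclideanCone S) (U i)) ^ 2
          = 0 :=
        Finset.sum_eq_zero fun i _ => by
          rw [(pr p).2 i, w.snd.2 i, sub_self, zero_pow two_ne_zero]
      simp only [e, sub_self, ne_eq, OfNat.ofNat_ne_zero, not_false_eq_true, zero_pow,
        Finset.sum_const_zero, sub_zero] at h4
      exact Subtype.ext (dist_eq_zero.1 (pow_eq_zero_iff two_ne_zero |>.1 h4))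
    have hfst : (WithLp.toLp 2 (fun i => ip p (U i)) : EuclideanSpace ℝ (Fin k)) = w.fst := by
      ext i; exact hF i
    change WithLp.toLp 2 (WithLp.toLp 2 (fun i => ip p (U i)), pr p) = w
    rw [hsnd, hfst]
    rfl
  exact ⟨Y, inferInstance, ⟨⟨Equiv.ofBijective f ⟨hf.injective, hsurj⟩, hf⟩⟩⟩

/-- The apex need not correspond to the origin of `ℝ ^ k`; the frame is the standard basis,
translated to the first component of the apex. -/
theorem exists_flatFrame {k : ℕ} (h : SplitsOff k (EuclideanCone S)) :
    ∃ U V : Fin k → EuclideanCone S, FlatFrame U V := by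
  obtain ⟨Y, _, ⟨Φ⟩⟩ := h
  set a := (Φ apex).fst with ha
  set y := (Φ apex).snd with hy
  set e : Fin k → EuclideanSpace ℝ (Fin k) := fun i => EuclideanSpace.single i 1 with he
  have hsymm : ∀ (z : EuclideanCone S) (w : EuclideanSpace ℝ (Fin k)),
      dist z (Φ.symm (WithLp.toLp 2 (w, y))) ^ 2 = ‖(Φ z).fst - w‖ ^ 2 + dist (Φ z).snd y ^ 2 := by
    intro z w
    rw [← Φ.dist_eq, Φ.apply_symm_apply, sq_dist_withLp, dist_eq_norm]
    rfl
  have hn : ∀ i, ‖e i‖ = 1 := fun i => by simp [he]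
  refine ⟨fun i => Φ.symm (WithLp.toLp 2 (a + e i, y)),
    fun i => Φ.symm (WithLp.toLp 2 (a - e i, y)),
    ⟨fun i => ⟨?_, fun z => ?_⟩, fun i j hij => ?_⟩⟩
  · have := hsymm apex (a + e i)
    rw [← ha, ← hy, dist_self, sub_add_cancel_left, norm_neg, hn] at this
    have h1 : dist apex (Φ.symm (WithLp.toLp 2 (a + e i, y))) ^ 2 = 1 := by linarith
    exact (pow_eq_one_iff_of_nonneg dist_nonneg two_ne_zero).1 h1
  · rw [hsymm, hsymm]
    have h1 : dist apex z ^ 2 = ‖(Φ z).fst - a‖ ^ 2 + dist (Φ z).snd y ^ 2 := by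
      rw [dist_comm, ← Φ.dist_eq, sq_dist_withLp, dist_eq_norm]
    have h2 := parallelogram_law_with_norm ℝ ((Φ z).fst - a) (e i)
    rw [hn, show (Φ z).fst - a + e i = (Φ z).fst - (a - e i) by abel,
      show (Φ z).fst - a - e i = (Φ z).fst - (a + e i) by abel] at h2
    rw [h1]
    nlinarith
  · have h1 := hsymm (Φ.symm (WithLp.toLp 2 (a + e i, y))) (a + e j)
    rw [Φ.apply_symm_apply] at h1
    change _ = ‖a + e i - (a + e j)‖ ^ 2 + dist y y ^ 2 at h1
    rw [h1, dist_self, add_sub_add_left_eq_sub, norm_sub_sq_real, hn, hn]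
    have : inner ℝ (e i) (e j) = (0 : ℝ) := by
      simp [he, EuclideanSpace.inner_single_left, hij]
    rw [this]
    norm_num

end Splitting

end EuclideanCone

end

section

open Metric EuclideanCone

/-! ### The tangent space is a `CAT(0)` cone -/

lemma abs_sq_sub_sq_le {a b e K : ℝ} (ha0 : 0 ≤ a) (hb0 : 0 ≤ b) (ha : a ≤ K) (hb : b ≤ K)
    (h : |a - b| ≤ e) : |a ^ 2 - b ^ 2| ≤ 2 * K * e := by
  have h1 : |a + b| ≤ 2 * K := by rw [abs_of_nonneg (by linarith)]; linarith
  rw [sq_sub_sq, abs_mul]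
  exact mul_le_mul h1 h (abs_nonneg _) (by linarith)

variable {X : Type u} [MetricSpace X] {x : X} {R C : ℝ}

namespace BlowUp

variable {M ε r : ℝ} {ℓ : X → TangentSpace x}

lemma norm_le (h : BlowUp x M ε r ℓ) {y : X} (hy : y ∈ closedBall x (M * r)) :
    dist apex (ℓ y) ≤ M := by
  have h1 := h.norm_eq y hy
  rw [mem_closedBall, dist_comm, h1, mul_comm M] at hy
  exact le_of_mul_le_mul_left hy h.pos

lemma map_center (h : BlowUp x M ε r ℓ) (hM : 0 ≤ M) : ℓ x = apex := by
  have h1 := h.norm_eq x (mem_closedBall_self (mul_nonneg hM h.pos.le))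
  rw [dist_self] at h1
  have h2 := (mul_eq_zero.1 h1.symm).resolve_left h.pos.ne'
  exact (dist_eq_zero.1 h2).symm

/-- Comparison of squared distances with those of approximating tangent vectors. -/
lemma abs_sq_sub_le (h : BlowUp x M ε r ℓ) {y z : X} (hy : y ∈ closedBall x (M * r))
    (hz : z ∈ closedBall x (M * r)) {v w : TangentSpace x} (hv : dist apex v ≤ M)
    (hw : dist apex w ≤ M) (hvy : dist v (ℓ y) ≤ ε) (hwz : dist w (ℓ z) ≤ ε) :
    |dist y z ^ 2 - r ^ 2 * dist v w ^ 2| ≤ 12 * M * ε * r ^ 2 := by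
  have hr := h.pos
  have h1 := h.dist_le y hy z hz
  have h2 : |dist y z - r * dist v w| ≤ 3 * ε * r := by
    have a1 := dist_triangle4 v (ℓ y) (ℓ z) w
    have a2 := dist_triangle4 (ℓ y) v w (ℓ z)
    rw [dist_comm (ℓ z) w] at a1
    rw [dist_comm (ℓ y) v] at a2
    have a3 : |dist (ℓ y) (ℓ z) - dist v w| ≤ 2 * ε := by
      rw [abs_le]; constructor <;> linarith
    have a4 : |r * dist (ℓ y) (ℓ z) - r * dist v w| ≤ r * (2 * ε) := by
      rw [← mul_sub, abs_mul, abs_of_pos hr]; gcongr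
    have a5 := abs_sub_le (dist y z) (r * dist (ℓ y) (ℓ z)) (r * dist v w)
    linarith
  have h3 : dist y z ≤ 2 * M * r := by
    have := dist_triangle_right y z x
    rw [mem_closedBall] at hy hz
    linarith
  have h4 : r * dist v w ≤ 2 * M * r := by
    have : dist v w ≤ 2 * M := by
      have := dist_triangle_left v w apex
      linarith
    rw [mul_comm]; gcongr
  have := abs_sq_sub_sq_le dist_nonneg (mul_nonneg hr.le dist_nonneg) h3 h4 h2
  rw [mul_pow] at this
  linarith

end BlowUp

namespace NiceBall

/-- The midpoint inequality in the tangent space up to an error `ε`, obtained from a geodesic of `X`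
at a small scale. -/
lemma exists_approx_midpoint (hB : NiceBall x R C) (hX : LocallyGeodesicallyComplete X)
    (p c : TangentSpace x) {M ε : ℝ} (hM : 0 ≤ M) (hε : 0 < ε) :
    ∃ m : TangentSpace x, dist apex m ≤ 2 * (dist apex p + dist apex c + 1) ∧
      ∀ q, dist apex q ≤ M →
        dist q m ^ 2 ≤ dist q p ^ 2 / 2 + dist q c ^ 2 / 2 - dist p c ^ 2 / 4 + ε := by
  set N := 2 * (dist apex p + dist apex c + 1) + M with hN
  have hp0 : 0 ≤ dist apex p := dist_nonneg
  have hc0 : 0 ≤ dist apex c := dist_nonneg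
  have hNpos : 0 < N := by positivity
  set e := min (1 / 2) (ε / (27 * N + N ^ 2)) with he
  have he0 : 0 < e := by positivity
  have heh : e ≤ 1 / 2 := min_le_left _ _
  have heε : e * (27 * N + N ^ 2) ≤ ε := by
    have := min_le_right (1 / 2) (ε / (27 * N + N ^ 2))
    rwa [← he, le_div_iff₀ (by positivity)] at this
  have hsmall : ∀ᶠ r in 𝓝[>] (0 : ℝ), 4 * C * (N * r) ^ 2 < e ∧ N * r < R := by
    apply nhdsWithin_le_nhds
    have hc : ContinuousAt (fun r : ℝ => 4 * C * (N * r) ^ 2) 0 := by fun_prop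
    have hc' : ContinuousAt (fun r : ℝ => N * r) 0 := by fun_prop
    refine (hc.eventually_lt continuousAt_const ?_).and (hc'.eventually_lt continuousAt_const ?_)
    · simpa using he0
    · simpa using hB.radius_pos
  obtain ⟨r, hbl, hr1, hr2⟩ := ((hB.eventually_blowUp hX hNpos he0).and hsmall).exists
  set ℓ : X → TangentSpace x := fun y => dil r⁻¹ (logMap x y)
  have hr := hbl.pos
  have hpN : dist apex p ≤ N := by linarith
  have hcN : dist apex c ≤ N := by linarith
  obtain ⟨y, hy, hyp⟩ := hbl.exists_near p hpN
  obtain ⟨z, hz, hzc⟩ := hbl.exists_near c hcN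
  have hsub := closedBall_subset_closedBall (x := x) hr2.le
  obtain ⟨γ, g0, g1, g2⟩ := hB.geodesic y (hsub hy) z (hsub hz)
  set L := dist y z with hL
  have hL0 : 0 ≤ L := dist_nonneg
  set m := γ (L / 2) with hm
  have m1 : dist y m = L / 2 := by
    have := g2 0 ⟨le_rfl, hL0⟩ (L / 2) ⟨by linarith, by linarith⟩
    rwa [g0, zero_sub, abs_neg, abs_of_nonneg (by linarith)] at this
  have m2 : dist m z = L / 2 := by
    have := g2 (L / 2) ⟨by linarith, by linarith⟩ L ⟨hL0, le_rfl⟩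
    rwa [g1, show L / 2 - L = -(L / 2) by ring, abs_neg, abs_of_nonneg (by linarith)] at this
  have ny : dist x y ≤ r * (dist apex p + e) := by
    rw [hbl.norm_eq y hy]
    have := dist_triangle apex p (ℓ y)
    gcongr
    linarith
  have nz : dist x z ≤ r * (dist apex c + e) := by
    rw [hbl.norm_eq z hz]
    have := dist_triangle apex c (ℓ z)
    gcongr
    linarith
  have nm : dist x m ≤ r * (2 * (dist apex p + dist apex c + 1)) := by
    have t1 := dist_triangle x y m
    have t2 := dist_triangle_left y z x
    have t3 : r * e ≤ r * (1 / 2) := by gcongr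
    nlinarith
  have hmN : m ∈ closedBall x (N * r) := by
    rw [mem_closedBall, dist_comm, mul_comm N]
    refine nm.trans ?_
    gcongr
    linarith
  have hnm : dist apex (ℓ m) ≤ 2 * (dist apex p + dist apex c + 1) := by
    rw [hbl.norm_eq m hmN] at nm
    exact le_of_mul_le_mul_left nm hr
  refine ⟨ℓ m, hnm, fun q hq => ?_⟩
  obtain ⟨w, hw, hwq⟩ := hbl.exists_near q (by linarith)
  have key := hB.sq_dist_midpoint_le hr2.le hy hz hw (hsub hmN) m1 m2
  have e0 : dist (ℓ m) (ℓ m) ≤ e := by rw [dist_self]; exact he0.le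
  have hqN : dist apex q ≤ N := by linarith
  have a1 := (abs_le.1 (hbl.abs_sq_sub_le hw hmN hqN (by linarith) hwq e0)).1
  have a2 := (abs_le.1 (hbl.abs_sq_sub_le hw hy hqN hpN hwq hyp)).2
  have a3 := (abs_le.1 (hbl.abs_sq_sub_le hw hz hqN hcN hwq hzc)).2
  have a4 := (abs_le.1 (hbl.abs_sq_sub_le hy hz hpN hcN hyp hzc)).1
  have a5 : dist y z ^ 2 ≤ (2 * N * r) ^ 2 := by
    apply pow_le_pow_left₀ dist_nonneg
    have := dist_triangle_right y z x
    rw [mem_closedBall] at hy hz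
    linarith
  have a6 : 4 * C * (N * r) ^ 2 * dist y z ^ 2 ≤ e * (2 * N * r) ^ 2 :=
    mul_le_mul hr1.le a5 (sq_nonneg _) he0.le
  have hr2pos : 0 < r ^ 2 := by positivity
  have hfin : r ^ 2 * dist q (ℓ m) ^ 2 ≤ r ^ 2 * (dist q p ^ 2 / 2 + dist q c ^ 2 / 2 -
      dist p c ^ 2 / 4 + e * (27 * N + N ^ 2)) := by
    linarith
  have := le_of_mul_le_mul_left hfin hr2pos
  linarith

theorem hasMidpoints (hB : NiceBall x R C) (hX : LocallyGeodesicallyComplete X) :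
    HasMidpoints (SpaceOfDirections x) := by
  have := hB.compactSpace_spaceOfDirections hX
  intro p c
  have h : ∀ n : ℕ, ∃ m : TangentSpace x, dist apex m ≤ 2 * (dist apex p + dist apex c + 1) ∧
      ∀ q, dist apex q ≤ n →
        dist q m ^ 2 ≤ dist q p ^ 2 / 2 + dist q c ^ 2 / 2 - dist p c ^ 2 / 4 + 1 / ((n : ℝ) + 1) :=
    fun n => hB.exists_approx_midpoint hX p c (Nat.cast_nonneg n) (by positivity)
  choose m hm1 hm2 using h
  obtain ⟨m', -, φ, hφ, hm'⟩ := (isCompact_closedBall (apex : TangentSpace x)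
    (2 * (dist apex p + dist apex c + 1))).tendsto_subseq
    (fun n => by rw [mem_closedBall, dist_comm]; exact hm1 n)
  refine ⟨m', fun q => ?_⟩
  have t1 : Tendsto (fun j => dist q (m (φ j)) ^ 2) atTop (𝓝 (dist q m' ^ 2)) :=
    (tendsto_const_nhds.dist hm').pow 2
  have t2 : Tendsto (fun j => dist q p ^ 2 / 2 + dist q c ^ 2 / 2 - dist p c ^ 2 / 4 +
      1 / (((φ j : ℕ) : ℝ) + 1)) atTop
      (𝓝 (dist q p ^ 2 / 2 + dist q c ^ 2 / 2 - dist p c ^ 2 / 4 + 0)) :=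
    (tendsto_one_div_add_atTop_nhds_zero_nat.comp hφ.tendsto_atTop).const_add _
  rw [add_zero] at t2
  refine le_of_tendsto_of_tendsto t1 t2 ?_
  obtain ⟨n, hn⟩ := exists_nat_ge (dist apex q)
  filter_upwards [hφ.tendsto_atTop.eventually_ge_atTop n] with j hj
  exact hm2 (φ j) q (hn.trans (by exact_mod_cast hj))

end NiceBall

/-! ### Strained points -/

/-- At scale `r` and with relative error `δ`, the points `a i`, `b i` look from `x` like the ends of
an orthonormal frame and of its opposite. -/
def Strained (k : ℕ) (δ r : ℝ) (x : X) : Prop :=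
  ∃ a b : Fin k → X, (∀ i, |dist x (a i) ^ 2 - r ^ 2| ≤ δ * r ^ 2) ∧
    (∀ i j, i ≠ j → |dist (a i) (a j) ^ 2 - 2 * r ^ 2| ≤ δ * r ^ 2) ∧
    ∀ i, ∀ z ∈ closedBall x ((1 - δ) * r),
      |dist z (a i) ^ 2 + dist z (b i) ^ 2 - 2 * dist z x ^ 2 - 2 * r ^ 2| ≤ δ * r ^ 2

/-- The points which are strained with relative error `δ` at some scale smaller than `δ`. -/
def strainedNear (k : ℕ) (δ : ℝ) (X : Type u) [MetricSpace X] : Set X :=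
  {x | ∃ r, 0 < r ∧ r < δ ∧ Strained k δ r x}

/-- The same strainers serve for all nearby points. -/
lemma strainedNear_subset_interior (k : ℕ) {δ : ℝ} (hδ : 0 < δ) :
    strainedNear k δ X ⊆ interior (strainedNear k (2 * δ) X) := by
  rintro x ⟨r, hr0, hrδ, a, b, h1, h2, h3⟩
  rw [mem_interior_iff_mem_nhds]
  have hc1 : ∀ᶠ y in 𝓝 x, ∀ i, |dist y (a i) ^ 2 - r ^ 2| < 2 * δ * r ^ 2 := by
    rw [eventually_all]
    intro i
    have : ContinuousAt (fun y => |dist y (a i) ^ 2 - r ^ 2|) x := by fun_prop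
    refine this.eventually_lt continuousAt_const ((h1 i).trans_lt ?_)
    have : 0 < δ * r ^ 2 := by positivity
    linarith
  filter_upwards [hc1, closedBall_mem_nhds x (show 0 < δ * r / 4 by positivity)] with y hy1 hy2
  rw [mem_closedBall] at hy2
  refine ⟨r, hr0, by linarith, a, b, fun i => (hy1 i).le, fun i j hij => ?_, fun i z hz => ?_⟩
  · have := h2 i j hij
    have : 0 < δ * r ^ 2 := by positivity
    linarith
  · rw [mem_closedBall] at hz
    have t1 := dist_triangle z y x
    have hδr : 0 < δ * r := by positivity
    have hz' : dist z x ≤ (1 - δ) * r := by linarith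
    have h4 := h3 i z hz'
    have h5 : |dist z y ^ 2 - dist z x ^ 2| ≤ 2 * r * (δ * r / 4) := by
      apply abs_sq_sub_sq_le dist_nonneg dist_nonneg (by linarith) (by linarith)
      rw [dist_comm z y, dist_comm z x]
      exact (abs_dist_sub_le y x z).trans hy2
    have h4' := abs_le.1 h4
    have h5' := abs_le.1 h5
    rw [abs_le]
    constructor <;> nlinarith

namespace NiceBall

/-- A frame in the tangent space is realised by points of `X` at all small scales. -/
theorem eventually_strained (hB : NiceBall x R C) (hX : LocallyGeodesicallyComplete X) {k : ℕ}
    {U V : Fin k → TangentSpace x} (h : FlatFrame U V) {δ : ℝ} (hδ : 0 < δ) :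
    ∀ᶠ r in 𝓝[>] (0 : ℝ), Strained k δ r x := by
  filter_upwards [hB.eventually_blowUp hX one_pos (show 0 < δ / 48 by positivity)] with r hbl
  have hr := hbl.pos
  set ℓ : X → TangentSpace x := fun y => dil r⁻¹ (logMap x y)
  have hU1 : ∀ i, dist apex (U i) ≤ 1 := fun i => (h.opposite i).norm_left.le
  have hV1 : ∀ i, dist apex (V i) ≤ 1 := fun i => (h.opposite i).norm_right.le
  choose a ha haU using fun i => hbl.exists_near (U i) (hU1 i)
  choose b hb hbV using fun i => hbl.exists_near (V i) (hV1 i)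
  have hx : x ∈ closedBall x (1 * r) := mem_closedBall_self (by linarith)
  have hself : ∀ y, dist (ℓ y) (ℓ y) ≤ δ / 48 := fun y => by rw [dist_self]; positivity
  have hℓx : ℓ x = apex := hbl.map_center zero_le_one
  have hxapex : dist apex (ℓ x) ≤ δ / 48 := by rw [hℓx, dist_self]; positivity
  have ha0 : dist (apex : TangentSpace x) apex ≤ 1 := by rw [dist_self]; exact zero_le_one
  refine ⟨a, b, fun i => ?_, fun i j hij => ?_, fun i z hz => ?_⟩
  · have := hbl.abs_sq_sub_le hx (ha i) ha0 (hU1 i) hxapex (haU i)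
    rw [(h.opposite i).norm_left] at this
    refine le_trans (by simpa using this) ?_
    have : 0 < δ * r ^ 2 := by positivity
    linarith
  · have := hbl.abs_sq_sub_le (ha i) (ha j) (hU1 i) (hU1 j) (haU i) (haU j)
    rw [h.orthogonal i j hij, mul_comm (r ^ 2)] at this
    refine le_trans this ?_
    have : 0 < δ * r ^ 2 := by positivity
    linarith
  · have hδr : 0 < δ * r := by positivity
    have hz1 : z ∈ closedBall x (1 * r) :=
      closedBall_subset_closedBall (by linarith) hz
    have b1 := abs_le.1 (hbl.abs_sq_sub_le hz1 (ha i) (hbl.norm_le hz1) (hU1 i) (hself z) (haU i))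
    have b2 := abs_le.1 (hbl.abs_sq_sub_le hz1 (hb i) (hbl.norm_le hz1) (hV1 i) (hself z) (hbV i))
    have b3 := abs_le.1 (hbl.abs_sq_sub_le hz1 hx (hbl.norm_le hz1) ha0 (hself z) hxapex)
    have b4 := (h.opposite i).parallelogram (ℓ z)
    rw [dist_comm apex] at b4
    have b5 : r ^ 2 * dist (ℓ z) (V i) ^ 2 = r ^ 2 * (2 * dist (ℓ z) apex ^ 2 + 2) -
      r ^ 2 * dist (ℓ z) (U i) ^ 2 := by rw [← b4]; ring
    rw [b5] at b2
    rw [abs_le]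
    constructor <;> nlinarith

/-- Strainers at a small scale give an approximate frame in the tangent space. The parallelogram law
is only obtained for short vectors `z`. -/
lemma exists_approx_frame (hB : NiceBall x R C) (hX : LocallyGeodesicallyComplete X) {k : ℕ}
    (hx : ∀ δ > 0, x ∈ strainedNear k δ X) {ε : ℝ} (hε : 0 < ε) :
    ∃ U V : Fin k → TangentSpace x, (∀ i, dist apex (U i) ≤ 3) ∧ (∀ i, dist apex (V i) ≤ 3) ∧
      (∀ i, |dist apex (U i) ^ 2 - 1| ≤ ε) ∧ (∀ i j, i ≠ j → |dist (U i) (U j) ^ 2 - 2| ≤ ε) ∧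
      ∀ i z, dist apex z ≤ 1 / 2 →
        |dist z (U i) ^ 2 + dist z (V i) ^ 2 - 2 * dist apex z ^ 2 - 2| ≤ ε := by
  set e := min (1 / 4) (ε / 145) with he
  have he0 : 0 < e := by positivity
  have he1 : e ≤ 1 / 4 := min_le_left _ _
  have he2 : 145 * e ≤ ε := by have := min_le_right (1 / 4) (ε / 145); linarith
  obtain ⟨δ₀, hδ₀, hbl⟩ := mem_nhdsGT_iff_exists_Ioo_subset.1
    (hB.eventually_blowUp hX (M := 3) (by norm_num) he0)
  have hδ₀' : 0 < δ₀ := hδ₀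
  set δ := min δ₀ e with hδ
  have hδ0 : 0 < δ := by positivity
  have hδe : δ ≤ e := min_le_right _ _
  obtain ⟨r, hr0, hrδ, a, b, h1, h2, h3⟩ := hx δ hδ0
  have hbl : BlowUp x 3 e r (fun y => dil r⁻¹ (logMap x y)) :=
    hbl ⟨hr0, hrδ.trans_le (min_le_left _ _)⟩
  set ℓ : X → TangentSpace x := fun y => dil r⁻¹ (logMap x y)
  have hr2 : 0 < r ^ 2 := by positivity
  have hδr : δ * r ^ 2 ≤ e * r ^ 2 := by gcongr
  have her : e * r ^ 2 ≤ 1 / 4 * r ^ 2 := by gcongr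
  have hx3 : x ∈ closedBall x (3 * r) := mem_closedBall_self (by linarith)
  have haM : ∀ i, a i ∈ closedBall x (3 * r) := by
    intro i
    have := (abs_le.1 (h1 i)).2
    rw [mem_closedBall, dist_comm]
    refine le_of_sq_le_sq ?_ (by positivity)
    nlinarith
  have hbM : ∀ i, b i ∈ closedBall x (3 * r) := by
    intro i
    have hm : x ∈ closedBall x ((1 - δ) * r) := mem_closedBall_self (by nlinarith)
    have := (abs_le.1 (h3 i x hm)).2
    rw [dist_self] at this
    rw [mem_closedBall, dist_comm]
    refine le_of_sq_le_sq ?_ (by positivity)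
    nlinarith [sq_nonneg (dist x (a i))]
  have hself : ∀ y, dist (ℓ y) (ℓ y) ≤ e := fun y => by rw [dist_self]; positivity
  have hℓx : ℓ x = apex := hbl.map_center (by norm_num)
  have hxapex : dist apex (ℓ x) ≤ e := by rw [hℓx, dist_self]; positivity
  have ha0 : dist (apex : TangentSpace x) apex ≤ 3 := by rw [dist_self]; norm_num
  refine ⟨fun i => ℓ (a i), fun i => ℓ (b i), fun i => hbl.norm_le (haM i),
    fun i => hbl.norm_le (hbM i), fun i => ?_, fun i j hij => ?_, fun i z hz => ?_⟩
  · have c1 := abs_le.1 (hbl.abs_sq_sub_le hx3 (haM i) ha0 (hbl.norm_le (haM i)) hxapex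
      (hself (a i)))
    have c2 := abs_le.1 (h1 i)
    rw [abs_le]
    constructor <;> refine le_of_mul_le_mul_left ?_ hr2 <;>
      linarith [mul_le_mul_of_nonneg_left he2 hr2.le]
  · have c1 := abs_le.1 (hbl.abs_sq_sub_le (haM i) (haM j) (hbl.norm_le (haM i))
      (hbl.norm_le (haM j)) (hself (a i)) (hself (a j)))
    have c2 := abs_le.1 (h2 i j hij)
    rw [abs_le]
    constructor <;> refine le_of_mul_le_mul_left ?_ hr2 <;>
      linarith [mul_le_mul_of_nonneg_left he2 hr2.le]
  · have hz3 : dist apex z ≤ 3 := by linarith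
    obtain ⟨y, hy, hyz⟩ := hbl.exists_near z hz3
    have hyx : y ∈ closedBall x ((1 - δ) * r) := by
      rw [mem_closedBall, dist_comm, hbl.norm_eq y hy, mul_comm r]
      have := dist_triangle apex z (ℓ y)
      gcongr
      linarith
    have c1 := abs_le.1 (hbl.abs_sq_sub_le hy (haM i) hz3 (hbl.norm_le (haM i)) hyz (hself (a i)))
    have c2 := abs_le.1 (hbl.abs_sq_sub_le hy (hbM i) hz3 (hbl.norm_le (hbM i)) hyz (hself (b i)))
    have c3 := abs_le.1 (hbl.abs_sq_sub_le hy hx3 hz3 ha0 hyz hxapex)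
    have c4 := abs_le.1 (h3 i y hyx)
    rw [dist_comm z apex] at c3
    rw [abs_le]
    constructor <;> refine le_of_mul_le_mul_left ?_ hr2 <;>
      linarith [mul_le_mul_of_nonneg_left he2 hr2.le]

theorem exists_flatFrame_of_strainedNear (hB : NiceBall x R C)
    (hX : LocallyGeodesicallyComplete X) {k : ℕ} (hx : ∀ δ > 0, x ∈ strainedNear k δ X) :
    ∃ U V : Fin k → TangentSpace x, FlatFrame U V := by
  have := hB.compactSpace_spaceOfDirections hX
  choose U V h1 h2 h3 h4 h5 using fun n : ℕ =>
    hB.exists_approx_frame hX hx (show 0 < 1 / ((n : ℝ) + 1) by positivity)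
  have hK : IsCompact ((Set.univ.pi fun _ : Fin k => closedBall (apex : TangentSpace x) 3) ×ˢ
      (Set.univ.pi fun _ : Fin k => closedBall (apex : TangentSpace x) 3)) :=
    (isCompact_univ_pi fun _ => isCompact_closedBall _ _).prod
      (isCompact_univ_pi fun _ => isCompact_closedBall _ _)
  obtain ⟨⟨U', V'⟩, -, φ, hφ, hlim⟩ := hK.tendsto_subseq (x := fun n => (U n, V n)) (fun n =>
    ⟨fun i _ => by rw [mem_closedBall, dist_comm]; exact h1 n i,
      fun i _ => by rw [mem_closedBall, dist_comm]; exact h2 n i⟩)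
  have hU : ∀ i, Tendsto (fun n => U (φ n) i) atTop (𝓝 (U' i)) := fun i =>
    (tendsto_pi_nhds.1 ((continuous_fst.tendsto _).comp hlim)) i
  have hV : ∀ i, Tendsto (fun n => V (φ n) i) atTop (𝓝 (V' i)) := fun i =>
    (tendsto_pi_nhds.1 ((continuous_snd.tendsto _).comp hlim)) i
  have hzero : Tendsto (fun n => 1 / (((φ n : ℕ) : ℝ) + 1)) atTop (𝓝 0) :=
    tendsto_one_div_add_atTop_nhds_zero_nat.comp hφ.tendsto_atTop
  have lim0 : ∀ {f : ℕ → ℝ} {a : ℝ}, Tendsto f atTop (𝓝 a) →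
      (∀ n, |f n| ≤ 1 / (((φ n : ℕ) : ℝ) + 1)) → a = 0 := by
    intro f a hf hb
    have := le_of_tendsto_of_tendsto' hf.abs hzero hb
    exact abs_eq_zero.1 (le_antisymm this (abs_nonneg _))
  have nU : ∀ i, dist apex (U' i) = 1 := by
    intro i
    have := lim0 (((tendsto_const_nhds.dist (hU i)).pow 2).sub_const 1) (fun n => h3 (φ n) i)
    exact (pow_eq_one_iff_of_nonneg dist_nonneg two_ne_zero).1 (sub_eq_zero.1 this)
  have par : ∀ i z, dist apex z ≤ 1 / 2 →
      dist z (U' i) ^ 2 + dist z (V' i) ^ 2 = 2 * dist apex z ^ 2 + 2 := by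
    intro i z hz
    have := lim0 (((((tendsto_const_nhds.dist (hU i)).pow 2).add
      ((tendsto_const_nhds.dist (hV i)).pow 2)).sub_const _).sub_const 2)
      (fun n => h5 (φ n) i z hz)
    linarith
  have nV : ∀ i, dist apex (V' i) ^ 2 = 1 := by
    intro i
    have := par i apex (by rw [dist_self]; norm_num)
    rw [nU, dist_self] at this
    linarith
  refine ⟨U', V', fun i => ⟨nU i, fun z => ?_⟩, fun i j hij => ?_⟩
  · -- both scalar products are homogeneous in `z`, so small `z` suffice
    set c := 1 / (2 * (dist apex z + 1)) with hc
    have hz0 : 0 ≤ dist apex z := dist_nonneg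
    have hc0 : 0 < c := by positivity
    have h6 := par i (dil c z) (by
      rw [dist_apex_dil hc0.le, hc, div_mul_eq_mul_div, div_le_div_iff₀ (by positivity)
        (by norm_num)]
      linarith)
    rw [sq_dist_eq, sq_dist_eq (dil c z), ip_dil_left hc0.le, ip_dil_left hc0.le, nV, nU] at h6
    have h7 : c * (ip z (U' i) + ip z (V' i)) = 0 := by linarith
    have h8 := (mul_eq_zero.1 h7).resolve_left hc0.ne'
    rw [sq_dist_eq, sq_dist_eq z, nV, nU]
    linarith
  · have := lim0 ((((hU i).dist (hU j)).pow 2).sub_const 2) (fun n => h4 (φ n) i j hij)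
    linarith

/-- The tangent space splits off `ℝ ^ k` if and only if the point is strained with arbitrarily small
error at arbitrarily small scales. -/
theorem mem_strainedSet_iff (hB : NiceBall x R C) (hX : LocallyGeodesicallyComplete X) {k : ℕ} :
    x ∈ strainedSet k X ↔ ∀ δ > 0, x ∈ strainedNear k δ X := by
  have := hB.compactSpace_spaceOfDirections hX
  constructor
  · intro h δ hδ
    obtain ⟨U, V, hUV⟩ := exists_flatFrame (S := SpaceOfDirections x) h
    obtain ⟨r, h1, h2⟩ := ((hB.eventually_strained hX hUV hδ).and (Ioo_mem_nhdsGT hδ)).exists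
    exact ⟨r, h2.1, h2.2, h1⟩
  · intro h
    obtain ⟨U, V, hUV⟩ := hB.exists_flatFrame_of_strainedNear hX h
    exact hUV.splitsOff (hB.hasMidpoints hX)

end NiceBall

end

section

open Metric EuclideanCone

/-! ### Strained points near a point with a Euclidean factor -/

namespace EuclideanCone

/-- If the cone splits off `ℝ ^ k`, then a unit vector `v` almost orthogonal to this factor is the
centre of an almost orthonormal frame of `k + 1` vectors: to the translates of `v` along the factor
one adds the apex, the opposite direction being represented by `2 v`. -/
lemma FlatFrame.exists_frame_at {S : Type u} [MetricSpace S] [CompactSpace S] {k : ℕ}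
    {U V : Fin k → EuclideanCone S} (h : FlatFrame U V) (hT : HasMidpoints S)
    {v : EuclideanCone S} (hv : dist apex v = 1) {e : ℝ} (he : ∀ i, |ip v (U i)| ≤ e) :
    ∃ A B : Fin (k + 1) → EuclideanCone S, (∀ i, dist v (A i) = 1) ∧ (∀ i, dist v (B i) = 1) ∧
      (∀ i j, i ≠ j → |dist (A i) (A j) ^ 2 - 2| ≤ 2 * e) ∧
      ∀ i z, dist z (A i) ^ 2 + dist z (B i) ^ 2 = 2 * dist z v ^ 2 + 2 := by
  choose a ha using fun i => (h.opposite i).exists_translation hT v 1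
  choose b hb using fun i => (h.opposite i).exists_translation hT v (-1)
  have one_of_sq : ∀ {p q : EuclideanCone S}, dist p q ^ 2 = 1 → dist p q = 1 := fun h =>
    (pow_eq_one_iff_of_nonneg dist_nonneg two_ne_zero).1 h
  have apex_two : ∀ z, dist z apex ^ 2 + dist z (dil 2 v) ^ 2 = 2 * dist z v ^ 2 + 2 := by
    intro z
    rw [sq_dist_eq z (dil 2 v), sq_dist_eq z v, ip_dil_right zero_le_two,
      dist_apex_dil zero_le_two, hv, dist_comm z apex]
    ring
  have a_apex : ∀ i, |dist (a i) apex ^ 2 - 2| ≤ 2 * e := by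
    intro i
    rw [ha i apex, ip_apex_left, dist_comm v, hv,
      show (1 : ℝ) ^ 2 + 2 * 1 * (ip v (U i) - 0) + 1 ^ 2 - 2 = 2 * ip v (U i) by ring, abs_mul,
      abs_two]
    linarith [he i]
  refine ⟨Fin.snoc (α := fun _ => EuclideanCone S) a apex,
    Fin.snoc (α := fun _ => EuclideanCone S) b (dil 2 v), fun i => ?_, fun i => ?_,
    fun i j hij => ?_, fun i z => ?_⟩
  · induction i using Fin.lastCases with
    | last => rw [Fin.snoc_last, dist_comm, hv]
    | cast i =>
      rw [Fin.snoc_castSucc, dist_comm]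
      apply one_of_sq
      rw [ha i v, dist_self]; ring
  · induction i using Fin.lastCases with
    | last =>
      rw [Fin.snoc_last]
      apply one_of_sq
      have := apex_two v
      rw [dist_self, dist_comm v apex, hv] at this
      linarith
    | cast i =>
      rw [Fin.snoc_castSucc, dist_comm]
      apply one_of_sq
      rw [hb i v, dist_self]; ring
  · induction i using Fin.lastCases with
    | last =>
      induction j using Fin.lastCases with
      | last => exact absurd rfl hij
      | cast j =>
        rw [Fin.snoc_castSucc, Fin.snoc_last, dist_comm]
        exact a_apex j
    | cast i =>
      induction j using Fin.lastCases with
      | last =>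
        rw [Fin.snoc_castSucc, Fin.snoc_last]
        exact a_apex i
      | cast j =>
        have hij' : i ≠ j := fun h => hij (congrArg _ h)
        rw [Fin.snoc_castSucc, Fin.snoc_castSucc]
        have h1 := ip_translation (ha j) (U i)
        rw [ip_comm (U i), h.ip_orthogonal hij'.symm] at h1
        have h2 := ha j v
        rw [dist_self, dist_comm] at h2
        rw [ha i (a j), h1, h2]
        have := (abs_nonneg _).trans (he i)
        rw [show (0 : ℝ) ^ 2 + 2 * 1 * (ip v (U j) - ip v (U j)) + 1 ^ 2 +
          2 * 1 * (ip v (U i) - (ip v (U i) + 1 * 0)) + 1 ^ 2 - 2 = 0 by ring, abs_zero]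
        linarith
  · induction i using Fin.lastCases with
    | last => rw [Fin.snoc_last, Fin.snoc_last]; exact apex_two z
    | cast i =>
      rw [Fin.snoc_castSucc, Fin.snoc_castSucc, dist_comm z, dist_comm z (b i), ha i z, hb i z,
        dist_comm z v]
      ring

end EuclideanCone

variable {X : Type u} [MetricSpace X] {x : X} {R C : ℝ}

/-- Two geodesics starting at `x` whose concatenation is a geodesic enclose the angle `π`. -/
lemma angle_eq_pi (γ η : GeodesicFrom x)
    (h : dist (γ.toFun γ.length) (η.toFun η.length) = γ.length + η.length) :
    angle γ η = Real.pi := by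
  unfold angle
  rw [limsup_congr (v := fun _ => Real.pi) ?_, limsup_const]
  filter_upwards [eventually_small γ.length_pos η.length_pos] with p hp
  obtain ⟨⟨h1, h2⟩, h3, h4⟩ := hp
  have ms : p.1 ∈ Icc 0 γ.length := ⟨h1.le, h2.le⟩
  have mt : p.2 ∈ Icc 0 η.length := ⟨h3.le, h4.le⟩
  have e1 := γ.isometric p.1 ms γ.length ⟨γ.length_pos.le, le_rfl⟩
  have e2 := η.isometric p.2 mt η.length ⟨η.length_pos.le, le_rfl⟩
  rw [abs_sub_comm, abs_of_nonneg (by linarith)] at e1 e2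
  have e3 := dist_triangle4 (γ.toFun γ.length) (γ.toFun p.1) (η.toFun p.2) (η.toFun η.length)
  rw [dist_comm _ (γ.toFun p.1)] at e3
  have e4 := (dist_geodesics γ η ms mt).2
  have e5 : dist (γ.toFun p.1) (η.toFun p.2) = p.1 + p.2 := by linarith
  rw [e5, comparisonAngle]
  have : (p.1 ^ 2 + p.2 ^ 2 - (p.1 + p.2) ^ 2) / (2 * p.1 * p.2) = -1 := by
    rw [div_eq_iff (by positivity)]; ring
  rw [this, Real.arccos_neg_one]

namespace NiceBall

/-- One half of the first variation formula. -/
lemma eventually_dist_end_le (hB : NiceBall x R C) (hX : LocallyGeodesicallyComplete X)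
    (γ : GeodesicFrom x) {e : ℝ} (he : 0 < e) :
    ∀ᶠ r in 𝓝[>] (0 : ℝ), ∀ y, dist x y = r →
      dist (γ.toFun γ.length) y ≤ γ.length +
        r * (- ip (ray 1 (γ : SpaceOfDirections x)) (dil r⁻¹ (logMap x y)) + e) := by
  -- the comparison is made with the point of `γ` at the distance `K * r`, for large `K`: then
  -- `√(K² + 1 - 2 K cos θ)` is at most `K - cos θ + 1 / (2 K)`
  set K := 1 / e + 1 with hK
  have hK1 : 1 ≤ K := by
    have : 0 < 1 / e := by positivity
    linarith
  have hK0 : 0 < K := by linarith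
  have hKe : 1 ≤ K * e := by
    rw [hK, add_mul, one_div_mul_cancel he.ne']; linarith
  have htend : Tendsto (fun r : ℝ => K * r) (𝓝[>] 0) (𝓝[>] 0) := by
    refine tendsto_nhdsWithin_iff.2 ⟨?_, ?_⟩
    · apply tendsto_nhdsWithin_of_tendsto_nhds
      have : Continuous fun r : ℝ => K * r := by fun_prop
      simpa using this.tendsto 0
    · filter_upwards [self_mem_nhdsWithin] with r hr
      exact mul_pos hK0 hr
  filter_upwards [htend.eventually
      (hB.eventually_abs_dist_sub_law_le hX (show 0 < e / (2 * K) by positivity)),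
    htend.eventually (Ioo_mem_nhdsGT γ.length_pos), Ioo_mem_nhdsGT hB.radius_pos] with
    r h1 h2 h3 y hy
  have hr : 0 < r := h3.1
  obtain ⟨η, b1, b2, b3⟩ := hB.exists_logMap_eq (y := y)
    (by rw [mem_closedBall, dist_comm, hy]; exact h3.2.le)
    (by rw [← dist_pos, dist_comm, hy]; exact hr)
  rw [hy] at b1 b3
  rw [b1] at b2
  have hrK : r ≤ K * r := le_mul_of_one_le_left hr.le hK1
  have h4 := (abs_le.1 (h1 γ η (K * r) ⟨by positivity, le_rfl⟩ r ⟨hr.le, hrK⟩ h2.2.le b1.ge)).2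
  rw [b2] at h4
  set θ := angle γ η with hθ
  have hip : ip (ray 1 (γ : SpaceOfDirections x)) (dil r⁻¹ (logMap x y)) = Real.cos θ := by
    rw [b3, dil_ray _ hr.le, inv_mul_cancel₀ hr.ne', ip_ray zero_le_one zero_le_one,
      UniformSpace.Completion.dist_eq]
    change 1 * 1 * Real.cos (min (angle γ η) Real.pi) = _
    rw [min_eq_left (angle_le_pi γ η), one_mul, one_mul]
  have hlaw : lawOfCosines (K * r) r θ ≤ r * (K - Real.cos θ + 1 / (2 * K)) := by
    have hc := Real.cos_le_one θ
    have h0 : 0 ≤ K - Real.cos θ + 1 / (2 * K) := by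
      have : 0 < 1 / (2 * K) := by positivity
      linarith
    refine le_of_sq_le_sq ?_ (mul_nonneg hr.le h0)
    rw [sq_lawOfCosines (by positivity) hr.le]
    have e1 : (r * (K - Real.cos θ + 1 / (2 * K))) ^ 2 = (K * r) ^ 2 + r ^ 2 -
        2 * (K * r) * r * Real.cos θ + r ^ 2 * (Real.cos θ - 1 / (2 * K)) ^ 2 := by
      field_simp; ring
    rw [e1]
    have : 0 ≤ r ^ 2 * (Real.cos θ - 1 / (2 * K)) ^ 2 := by positivity
    linarith
  have h5 : dist (γ.toFun γ.length) (γ.toFun (K * r)) = γ.length - K * r := by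
    rw [γ.isometric _ ⟨γ.length_pos.le, le_rfl⟩ _ ⟨h2.1.le, h2.2.le⟩, abs_of_pos]
    linarith [h2.2]
  have h6 := dist_triangle (γ.toFun γ.length) (γ.toFun (K * r)) y
  have h7 : e / (2 * K) * (K * r) = r * (e / 2) := by field_simp
  have h8 : 1 / (2 * K) ≤ e / 2 := by
    rw [div_le_div_iff₀ (by positivity) (by norm_num)]; linarith
  have h9 : r * (1 / (2 * K)) ≤ r * (e / 2) := by gcongr
  rw [hip]
  linarith

/-- Opposite unit vectors `U` and `V` of the tangent space are approximated by the directions at `x`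
of the two halves `γ` and `η` of a geodesic through `x`, and the end of `γ` can be taken from a
given dense set. -/
lemma exists_geodesics_near (hB : NiceBall x R C) (hX : LocallyGeodesicallyComplete X)
    {D : Set X} (hD : Dense D) {U V : TangentSpace x} (h : OppositePair U V) {e : ℝ} (he : 0 < e) :
    ∃ γ η : GeodesicFrom x, γ.toFun γ.length ∈ D ∧
      dist (γ.toFun γ.length) (η.toFun η.length) = γ.length + η.length ∧
      dist (ray 1 (γ : SpaceOfDirections x)) U ≤ e ∧
      dist (ray 1 (η : SpaceOfDirections x)) V ≤ e := by
  set ε := min (1 / 12) (min (e / 6) (e ^ 2 / 24)) with hε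
  have hε0 : 0 < ε := by positivity
  have ε1 : ε ≤ 1 / 12 := min_le_left _ _
  have ε2 : 6 * ε ≤ e := by
    have : ε ≤ e / 6 := (min_le_right _ _).trans (min_le_left _ _)
    linarith
  have ε3 : 24 * ε ≤ e ^ 2 := by
    have : ε ≤ e ^ 2 / 24 := (min_le_right _ _).trans (min_le_right _ _)
    linarith
  obtain ⟨r, hbl, hr2⟩ := ((hB.eventually_blowUp hX (M := 3) (by norm_num) hε0).and
    (Ioo_mem_nhdsGT (show 0 < R / 3 by linarith [hB.radius_pos]))).exists
  set ℓ : X → TangentSpace x := fun y => dil r⁻¹ (logMap x y) with hℓ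
  have hr := hbl.pos
  obtain ⟨y, hy, hyU⟩ := hbl.exists_near U (by rw [h.norm_left]; norm_num)
  have hny : dist x y ≤ r * (1 + ε) := by
    rw [hbl.norm_eq y hy]
    have := dist_triangle apex U (ℓ y)
    rw [h.norm_left] at this
    gcongr
    linarith
  obtain ⟨p, hpD, hp⟩ := hD.exists_dist_lt y (show 0 < ε * r by positivity)
  have hεr : ε * r ≤ 1 / 12 * r := by gcongr
  have hp3 : p ∈ closedBall x (3 * r) := by
    rw [mem_closedBall, dist_comm]
    linarith [dist_triangle x y p]
  have hpU : dist U (ℓ p) ≤ 3 * ε := by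
    have h1 := (abs_le.1 (hbl.dist_le y hy p hp3)).1
    have h2 : r * dist (ℓ y) (ℓ p) ≤ r * (2 * ε) := by linarith
    have h3 := le_of_mul_le_mul_left h2 hr
    linarith [dist_triangle U (ℓ y) (ℓ p)]
  have hnp : |1 - dist apex (ℓ p)| ≤ 3 * ε := by
    have := abs_dist_sub_le U (ℓ p) apex
    rw [dist_comm U, dist_comm (ℓ p), h.norm_left] at this
    exact this.trans hpU
  have hpR : p ∈ closedBall x R := by
    apply closedBall_subset_closedBall _ hp3
    have := hr2.2
    linarith
  have hpx : p ≠ x := by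
    rintro rfl
    rw [hbl.map_center (by norm_num), dist_self] at hnp
    rw [sub_zero, abs_one] at hnp
    linarith
  obtain ⟨γ, g1, g2, g3⟩ := hB.exists_logMap_eq hpR hpx
  have hℓp : ℓ p = ray (r⁻¹ * dist x p) (γ : SpaceOfDirections x) := by
    rw [hℓ]; simp only; rw [g3, dil_ray _ dist_nonneg]
  have hγU : dist (ray 1 (γ : SpaceOfDirections x)) U ≤ 6 * ε := by
    have h0 : 0 ≤ r⁻¹ * dist x p := by positivity
    have h1 : dist (ray 1 (γ : SpaceOfDirections x)) (ℓ p) ≤ 3 * ε := by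
      rw [hℓp, dist_ray_same_right zero_le_one h0]
      rwa [hℓp, dist_apex_ray h0] at hnp
    have := dist_triangle_right (ray 1 (γ : SpaceOfDirections x)) U (ℓ p)
    linarith
  have hpb : p ∈ ball x R := by
    rw [mem_ball]
    rw [mem_closedBall] at hp3
    linarith [hr2.2]
  obtain ⟨q, hq1, hq2, hq3⟩ := hB.exists_extension hX hpb (mem_ball_self hB.radius_pos) hpx
    hB.radius_pos
  obtain ⟨η, k1, k2, k3⟩ := hB.exists_logMap_eq (y := q)
    (by rw [mem_closedBall, dist_comm]; exact hq2.le) hq1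
  have hsum : dist (γ.toFun γ.length) (η.toFun η.length) = γ.length + η.length := by
    rw [g2, k2, g1, k1, hq3, dist_comm p x]
  refine ⟨γ, η, by rw [g2]; exact hpD, hsum, hγU.trans ε2, ?_⟩
  have hopp : dist (ray 1 (γ : SpaceOfDirections x)) (ray 1 (η : SpaceOfDirections x)) = 2 := by
    rw [dist_ray_geodesic zero_le_one zero_le_one, angle_eq_pi γ η hsum,
      law_pi zero_le_one zero_le_one]
    norm_num
  have hpar := h.parallelogram (ray 1 (η : SpaceOfDirections x))
  rw [dist_apex_ray zero_le_one] at hpar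
  have h2 : 2 - 6 * ε ≤ dist (ray 1 (η : SpaceOfDirections x)) U := by
    have := dist_triangle_right (ray 1 (γ : SpaceOfDirections x))
      (ray 1 (η : SpaceOfDirections x)) U
    linarith
  have h3 : (2 - 6 * ε) ^ 2 ≤ dist (ray 1 (η : SpaceOfDirections x)) U ^ 2 :=
    pow_le_pow_left₀ (by linarith) h2 2
  refine le_of_sq_le_sq ?_ he.le
  have : 0 ≤ ε ^ 2 := sq_nonneg ε
  linarith

/-- Near a point whose tangent space splits off `ℝ ^ k`, all points in directions almost orthogonal
to this factor are `k + 1`-strained. -/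
lemma eventually_strained_of_orthogonal (hB : NiceBall x R C)
    (hX : LocallyGeodesicallyComplete X) {k : ℕ} {U V : Fin k → TangentSpace x}
    (h : FlatFrame U V) {δ : ℝ} (hδ : 0 < δ) :
    ∀ᶠ r in 𝓝[>] (0 : ℝ), ∀ y, dist x y = r →
      (∀ i, |ip (dil r⁻¹ (logMap x y)) (U i)| ≤ δ / 4) → Strained (k + 1) δ r y := by
  have := hB.compactSpace_spaceOfDirections hX
  filter_upwards [hB.eventually_blowUp hX two_pos (show 0 < δ / 192 by positivity)] with
    r hbl y hy hyU
  have hr := hbl.pos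
  set ℓ : X → TangentSpace x := fun y => dil r⁻¹ (logMap x y)
  have hy2 : y ∈ closedBall x (2 * r) := by rw [mem_closedBall, dist_comm, hy]; linarith
  have hv : dist apex (ℓ y) = 1 := by
    have := hbl.norm_eq y hy2
    rw [hy] at this
    exact mul_left_cancel₀ hr.ne' (by linarith)
  obtain ⟨A, B, h1, h2, h3, h4⟩ := h.exists_frame_at (hB.hasMidpoints hX) hv hyU
  have hA : ∀ i, dist apex (A i) ≤ 2 := fun i => by
    linarith [dist_triangle apex (ℓ y) (A i), h1 i]
  have hB' : ∀ i, dist apex (B i) ≤ 2 := fun i => by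
    linarith [dist_triangle apex (ℓ y) (B i), h2 i]
  have hv2 : dist apex (ℓ y) ≤ 2 := by rw [hv]; norm_num
  choose a ha haA using fun i => hbl.exists_near (A i) (hA i)
  choose b hb hbB using fun i => hbl.exists_near (B i) (hB' i)
  have hself : ∀ y, dist (ℓ y) (ℓ y) ≤ δ / 192 := fun y => by rw [dist_self]; positivity
  have hδr2 : 0 < δ * r ^ 2 := by positivity
  refine ⟨a, b, fun i => ?_, fun i j hij => ?_, fun i z hz => ?_⟩
  · have := hbl.abs_sq_sub_le hy2 (ha i) hv2 (hA i) (hself y) (haA i)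
    rw [h1 i, one_pow, mul_one] at this
    linarith
  · have c1 := abs_le.1 (hbl.abs_sq_sub_le (ha i) (ha j) (hA i) (hA j) (haA i) (haA j))
    have c2 := abs_le.1 (h3 i j hij)
    have c3 : r ^ 2 * dist (A i) (A j) ^ 2 ≤ r ^ 2 * (2 + δ / 2) := by gcongr; linarith
    have c4 : r ^ 2 * (2 - δ / 2) ≤ r ^ 2 * dist (A i) (A j) ^ 2 := by gcongr; linarith
    rw [abs_le]
    constructor <;> linarith
  · have hδr : 0 < δ * r := by positivity
    have hz2 : z ∈ closedBall x (2 * r) := by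
      rw [mem_closedBall] at hz ⊢
      have := dist_triangle z y x
      rw [dist_comm y x, hy] at this
      linarith
    have b1 := abs_le.1 (hbl.abs_sq_sub_le hz2 (ha i) (hbl.norm_le hz2) (hA i) (hself z) (haA i))
    have b2 := abs_le.1 (hbl.abs_sq_sub_le hz2 (hb i) (hbl.norm_le hz2) (hB' i) (hself z) (hbB i))
    have b3 := abs_le.1 (hbl.abs_sq_sub_le hz2 hy2 (hbl.norm_le hz2) hv2 (hself z) (hself y))
    have b5 : r ^ 2 * dist (ℓ z) (B i) ^ 2 = r ^ 2 * (2 * dist (ℓ z) (ℓ y) ^ 2 + 2) -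
      r ^ 2 * dist (ℓ z) (A i) ^ 2 := by rw [← h4 i (ℓ z)]; ring
    rw [b5] at b2
    rw [abs_le]
    constructor <;> linarith

/-- The points near `x` which are not `k + 1`-strained are separated from `x` by the distance
functions of `k` points, if the tangent space at `x` splits off `ℝ ^ k`: by the first variation
formula, these functions approximate the projection to the factor `ℝ ^ k`. -/
theorem exists_strainer (hB : NiceBall x R C) (hX : LocallyGeodesicallyComplete X) {k : ℕ}
    (hx : x ∈ strainedSet k X) {D : Set X} (hD : Dense D) {δ : ℝ} (hδ : 0 < δ) :
    ∃ p : Fin k → X, (∀ i, p i ∈ D) ∧ ∃ c > 0, ∀ᶠ y in 𝓝 x, y ∉ strainedNear (k + 1) δ X →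
      y = x ∨ ∃ i, c * dist x y ≤ |dist (p i) y - dist (p i) x| := by
  obtain ⟨U, V, hUV⟩ := exists_flatFrame (S := SpaceOfDirections x) hx
  set e := δ / 4 with he
  have he0 : 0 < e := by positivity
  choose γ η hγD hγη hγ hη using fun i =>
    hB.exists_geodesics_near hX hD (hUV.opposite i) (show 0 < e / 8 by positivity)
  refine ⟨fun i => (γ i).toFun (γ i).length, hγD, e / 4, by positivity, ?_⟩
  have hγv := eventually_all.2 fun i =>
    hB.eventually_dist_end_le hX (γ i) (show 0 < e / 4 by positivity)
  have hηv := eventually_all.2 fun i =>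
    hB.eventually_dist_end_le hX (η i) (show 0 < e / 4 by positivity)
  obtain ⟨r₀, hr₀, hr⟩ := mem_nhdsGT_iff_exists_Ioo_subset.1
    ((((hB.eventually_strained_of_orthogonal hX hUV hδ).and hγv).and hηv).and
      (Ioo_mem_nhdsGT (lt_min hδ hB.radius_pos)))
  filter_upwards [ball_mem_nhds x (show 0 < r₀ from hr₀)] with y hy hyn
  by_cases hyx : y = x
  · exact Or.inl hyx
  refine Or.inr ?_
  have hpos : 0 < dist x y := dist_pos.2 (Ne.symm hyx)
  rw [mem_ball, dist_comm] at hy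
  obtain ⟨⟨⟨h1, h2⟩, h3⟩, h4⟩ := hr ⟨hpos, hy⟩
  set r := dist x y with hrdef
  set v := dil r⁻¹ (logMap x y) with hv
  have hv1 : dist apex v = 1 := by
    rw [hv, dist_apex_dil (by positivity), hB.dist_apex_logMap (by
      rw [mem_closedBall, dist_comm]; exact (h4.2.trans_le (min_le_right _ _)).le),
      inv_mul_cancel₀ hpos.ne']
  obtain ⟨i, hi⟩ : ∃ i, e < |ip v (U i)| := by
    by_contra! hall
    -- at the scale `r`, the point `y` would be strained
    exact hyn ⟨r, hpos, h4.2.trans_le (min_le_left _ _), h1 y rfl hall⟩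
  refine ⟨i, ?_⟩
  -- unit vectors which are close have close scalar products with `v`
  have hip : ∀ {P Q : TangentSpace x}, dist apex P = 1 → dist apex Q = 1 → dist P Q ≤ e / 8 →
      |ip P v - ip v Q| ≤ e / 4 := by
    intro P Q hP hQ hPQ
    have b1 : |dist P v - dist Q v| ≤ e / 8 := (abs_dist_sub_le P Q v).trans hPQ
    have b2 := abs_sq_sub_sq_le (K := 2) dist_nonneg dist_nonneg
      (by linarith [dist_triangle_left P v apex]) (by linarith [dist_triangle_left Q v apex]) b1
    rw [sq_dist_eq, sq_dist_eq Q, hP, hQ, ip_comm Q] at b2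
    rw [abs_le] at b2 ⊢
    constructor <;> linarith [b2.1, b2.2]
  have hgl := (γ i).isometric (γ i).length ⟨(γ i).length_pos.le, le_rfl⟩ 0
    ⟨le_rfl, (γ i).length_pos.le⟩
  rw [(γ i).start, sub_zero, abs_of_pos (γ i).length_pos] at hgl
  have k1 := h2 i y rfl
  have k2 := h3 i y rfl
  have k3 := dist_triangle_right ((γ i).toFun (γ i).length) ((η i).toFun (η i).length) y
  rw [hγη] at k3
  have k4 := abs_le.1 (hip (dist_apex_ray zero_le_one _) (hUV.opposite i).norm_left (hγ i))
  have k5 := abs_le.1 (hip (dist_apex_ray zero_le_one _) (hUV.opposite i).norm_right (hη i))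
  rw [(hUV.opposite i).ip_right] at k5
  rw [hgl]
  -- according to the sign of the component, `y` is closer to the end of `γ i` or to that of `η i`
  rcases lt_abs.1 hi with hi | hi
  · have : r * (-ip (ray 1 (γ i : SpaceOfDirections x)) v + e / 4) ≤ r * (-(e / 4)) := by
      gcongr; linarith
    rw [abs_sub_comm]
    refine le_trans ?_ (le_abs_self _)
    linarith
  · have : r * (-ip (ray 1 (η i : SpaceOfDirections x)) v + e / 4) ≤ r * (-(e / 4)) := by
      gcongr; linarith
    refine le_trans ?_ (le_abs_self _)
    linarith

end NiceBall

end

section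

open Metric

/-! ### Countable unions of biLipschitz images of compact sets -/

/-- A set is a countable union of sets with the property `P` as soon as each of its points lies in
such a subset taken from a countable family; other members of the family need not have `P`. -/
lemma exists_seq_iUnion_eq {α ι : Type*} [Countable ι] {P : Set α → Prop} (h0 : P ∅)
    (A : ι → Set α) {S : Set α} (h : ∀ x ∈ S, ∃ i, x ∈ A i ∧ A i ⊆ S ∧ P (A i)) :
    ∃ B : ℕ → Set α, S = ⋃ i, B i ∧ ∀ i, P (B i) := by
  set 𝒜 : Set (Set α) := insert ∅ (A '' {i | A i ⊆ S ∧ P (A i)}) with h𝒜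
  have hc : 𝒜.Countable := ((to_countable _).image A).insert ∅
  obtain ⟨B, hB⟩ := hc.exists_eq_range (insert_nonempty _ _)
  have hmem : ∀ i, B i ⊆ S ∧ P (B i) := by
    intro i
    have : B i ∈ 𝒜 := hB ▸ mem_range_self i
    rcases this with h | ⟨j, hj, h⟩
    · rw [h]; exact ⟨empty_subset _, h0⟩
    · rw [← h]; exact hj
  refine ⟨B, Subset.antisymm (fun x hx => ?_) (iUnion_subset fun i => (hmem i).1),
    fun i => (hmem i).2⟩
  obtain ⟨i, hi, hi'⟩ := h x hx
  have : A i ∈ range B := hB ▸ Or.inr ⟨i, hi', rfl⟩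
  obtain ⟨j, hj⟩ := this
  exact mem_iUnion.2 ⟨j, hj ▸ hi⟩

lemma biLipschitzEquivalent_image {X Y : Type*} [MetricSpace X] [MetricSpace Y] {A : Set X}
    {F : X → Y} {L L' : ℝ} (hL : 0 < L)
    (h1 : ∀ a ∈ A, ∀ b ∈ A, dist (F a) (F b) ≤ L' * dist a b)
    (h2 : ∀ a ∈ A, ∀ b ∈ A, dist a b ≤ L * dist (F a) (F b)) :
    BiLipschitzEquivalent A (F '' A) := by
  have hinj : InjOn F A := by
    intro a ha b hb hab
    have := h2 a ha b hb
    rw [hab, dist_self, mul_zero] at this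
    exact dist_le_zero.1 this
  set M := max L L' with hM
  have hM0 : 0 < M := lt_max_of_lt_left hL
  refine ⟨Equiv.Set.imageOfInjOn F A hinj, M, hM0, fun a b => ⟨?_, ?_⟩⟩
  · rw [one_div_mul_eq_div, div_le_iff₀ hM0, mul_comm]
    refine (h2 a a.2 b b.2).trans ?_
    gcongr
    exacts [le_max_left _ _, le_rfl]
  · refine (h1 a a.2 b b.2).trans ?_
    gcongr
    exacts [le_max_right _ _, le_rfl]

lemma BiLipschitzEquivalent.exists_lipschitz {X Y : Type*} [MetricSpace X] [MetricSpace Y]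
    {A : Set X} {K : Set Y} (h : BiLipschitzEquivalent A K) :
    ∃ f : K → X, (∃ L, LipschitzWith L f) ∧ range f = A := by
  obtain ⟨e, L, hL, he⟩ := h
  refine ⟨fun z => e.symm z, ⟨L.toNNReal, LipschitzWith.of_dist_le_mul fun z w => ?_⟩, ?_⟩
  · have := (he (e.symm z) (e.symm w)).1
    rw [e.apply_symm_apply, e.apply_symm_apply, one_div_mul_eq_div, div_le_iff₀ hL] at this
    rw [Real.coe_toNNReal _ hL.le, mul_comm]
    exact this
  · rw [range_comp' Subtype.val e.symm, e.symm.range_eq_univ, image_univ, Subtype.range_coe]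

/-- The map whose components are the distances to the points `p i`. -/
def distMap {X : Type*} [MetricSpace X] {m : ℕ} (p : Fin m → X) (y : X) :
    EuclideanSpace ℝ (Fin m) :=
  WithLp.toLp 2 fun i => dist (p i) y

section DistMap

variable {X : Type*} [MetricSpace X] {m : ℕ}

lemma exists_lipschitzWith_distMap (p : Fin m → X) : ∃ L, LipschitzWith L (distMap p) :=
  ⟨_, (PiLp.lipschitzWith_toLp 2 fun _ : Fin m => ℝ).comp
    (LipschitzWith.of_dist_le_mul (K := 1) fun y z => by
      rw [NNReal.coe_one, one_mul, dist_pi_le_iff dist_nonneg]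
      intro i
      rw [Real.dist_eq, dist_comm (p i), dist_comm (p i)]
      exact abs_dist_sub_le y z (p i))⟩

lemma abs_sub_le_dist_distMap (p : Fin m → X) (i : Fin m) (y z : X) :
    |dist (p i) y - dist (p i) z| ≤ dist (distMap p y) (distMap p z) := by
  rw [dist_eq_norm]
  exact PiLp.norm_apply_le (distMap p y - distMap p z) i

/-- A compact set is biLipschitz equivalent to its image under `distMap p`, if it is contained in
the closure of a set on which this map does not shrink distances too much. -/
lemma exists_biLipschitzEquivalent_of_distMap (p : Fin m → X) {A B : Set X} {L : ℝ} (hL : 0 < L)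
    (hA : IsCompact A) (hAB : A ⊆ closure B)
    (h : ∀ a ∈ B, ∀ b ∈ B, dist a b ≤ L * dist (distMap p a) (distMap p b)) :
    ∃ K : Set (EuclideanSpace ℝ (Fin m)), IsCompact K ∧ BiLipschitzEquivalent A K := by
  obtain ⟨L', hL'⟩ := exists_lipschitzWith_distMap p
  have hc := hL'.continuous
  have hclosed : IsClosed {q : X × X | dist q.1 q.2 ≤ L * dist (distMap p q.1) (distMap p q.2)} :=
    isClosed_le (by fun_prop) (by fun_prop)
  have hsub : closure B ×ˢ closure B ⊆
      {q : X × X | dist q.1 q.2 ≤ L * dist (distMap p q.1) (distMap p q.2)} := by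
    rw [← closure_prod_eq]
    exact closure_minimal (fun q hq => h q.1 hq.1 q.2 hq.2) hclosed
  exact ⟨_, hA.image hc, biLipschitzEquivalent_image hL (fun a _ b _ => hL'.dist_le_mul a b)
    fun a ha b hb => hsub (mk_mem_prod (hAB ha) (hAB hb))⟩

end DistMap

/-! ### The complement of the strained set -/

variable {X : Type u} [MetricSpace X]

lemma strainedNear_mono (k : ℕ) {δ δ' : ℝ} (h : δ ≤ δ') :
    strainedNear k δ X ⊆ strainedNear k δ' X := by
  rintro x ⟨r, hr, hrδ, a, b, h1, h2, h3⟩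
  have h4 : δ * r ^ 2 ≤ δ' * r ^ 2 := by gcongr
  refine ⟨r, hr, hrδ.trans_le h, a, b, fun i => (h1 i).trans h4,
    fun i j hij => (h2 i j hij).trans h4, fun i z hz => (h3 i z ?_).trans h4⟩
  refine closedBall_subset_closedBall ?_ hz
  gcongr

lemma exists_notMem_strainedNear {k : ℕ} {x : X} (h : ¬ ∀ δ > 0, x ∈ strainedNear k δ X) :
    ∃ n : ℕ, x ∉ strainedNear k (1 / ((n : ℝ) + 1)) X := by
  push Not at h
  obtain ⟨δ, hδ, hx⟩ := h
  obtain ⟨n, hn⟩ := exists_nat_one_div_lt hδ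
  exact ⟨n, fun h => hx (strainedNear_mono k hn.le h)⟩

lemma mem_strainedNear_zero {δ : ℝ} (hδ : 0 < δ) (x : X) : x ∈ strainedNear 0 δ X :=
  ⟨δ / 2, by linarith, by linarith, Fin.elim0, Fin.elim0, fun i => i.elim0, fun i => i.elim0,
    fun i => i.elim0⟩

/-- The points at which `distMap p` has a lower biLipschitz bound `1 / (N + 1)` at distances smaller
than `1 / (N + 1)`, relative to the set of points which are not strained. -/
def injectivitySet (X : Type u) [MetricSpace X] {m : ℕ} (k : ℕ) (δ : ℝ) (N : ℕ) (p : Fin m → X) :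
    Set X :=
  {x | x ∉ strainedNear k δ X ∧ ∀ y ∉ strainedNear k δ X, dist x y < 1 / ((N : ℝ) + 1) →
    dist x y ≤ ((N : ℝ) + 1) * dist (distMap p x) (distMap p y)}

/-- The points which are not `k`-strained are exhausted by countably many injectivity sets of
distance maps with `k - 1` components. -/
lemma exists_mem_injectivitySet (hX : IsGCBA X) {k : ℕ} {x : X} (hx : x ∉ strainedSet k X)
    {D : Set X} (hD : Dense D) :
    ∃ (l n N : ℕ) (p : Fin (k - 1) → D),
      x ∈ injectivitySet X l (1 / ((n : ℝ) + 1)) N (fun i => (p i : X)) := by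
  obtain ⟨R, C, hB⟩ := hX.exists_niceBall x
  have h0 : x ∈ strainedSet 0 X :=
    (hB.mem_strainedSet_iff hX.complete).2 fun δ hδ => mem_strainedNear_zero hδ x
  obtain ⟨l, hlk, hl, hl'⟩ : ∃ l < k, x ∈ strainedSet l X ∧ x ∉ strainedSet (l + 1) X := by
    by_contra! hall
    have : ∀ j ≤ k, x ∈ strainedSet j X := by
      intro j
      induction j with
      | zero => exact fun _ => h0
      | succ j ih => exact fun hj => hall j (by omega) (ih (by omega))
    exact hx (this k le_rfl)
  rw [hB.mem_strainedSet_iff hX.complete] at hl'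
  obtain ⟨n, hn⟩ := exists_notMem_strainedNear hl'
  obtain ⟨p, hpD, c, hc, hp⟩ := hB.exists_strainer hX.complete hl hD
    (show 0 < 1 / ((n : ℝ) + 1) by positivity)
  obtain ⟨ρ, hρ, hball⟩ := Metric.eventually_nhds_iff.1 hp
  obtain ⟨N₁, hN₁⟩ := exists_nat_one_div_lt hρ
  obtain ⟨N₂, hN₂⟩ := exists_nat_one_div_lt hc
  obtain ⟨d, hd⟩ := hD.nonempty_iff.2 ⟨x⟩
  set q : Fin (k - 1) → D := fun j =>
    if h : (j : ℕ) < l then ⟨p ⟨j, h⟩, hpD _⟩ else ⟨d, hd⟩ with hq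
  refine ⟨l + 1, n, max N₁ N₂, q, hn, fun y hy hxy => ?_⟩
  have hNpos : (0 : ℝ) < ((max N₁ N₂ : ℕ) : ℝ) + 1 := by positivity
  have hN₁' : 1 / (((max N₁ N₂ : ℕ) : ℝ) + 1) ≤ 1 / ((N₁ : ℝ) + 1) := by
    gcongr; exact le_max_left _ _
  have hN₂' : 1 / (((max N₁ N₂ : ℕ) : ℝ) + 1) ≤ 1 / ((N₂ : ℝ) + 1) := by
    gcongr; exact le_max_right _ _
  rcases hball (by rw [dist_comm]; linarith) hy with rfl | ⟨i, hi⟩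
  · rw [dist_self, dist_self, mul_zero]
  have hik : (i : ℕ) < k - 1 := by omega
  have h1 := abs_sub_le_dist_distMap (fun i => (q i : X)) ⟨i, hik⟩ y x
  have h2 : (q ⟨i, hik⟩ : X) = p i := by simp [hq]
  rw [h2, dist_comm (distMap _ y)] at h1
  have h3 : 1 / (((max N₁ N₂ : ℕ) : ℝ) + 1) * dist x y ≤ c * dist x y := by
    gcongr; linarith
  have h4 := h3.trans (hi.trans h1)
  rwa [one_div_mul_eq_div, div_le_iff₀' hNpos] at h4

/-- Each piece is the closure of the part of an injectivity set in a small compact ball, outside the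
interior of some `strainedNear k δ X`. The last restriction keeps the closure from meeting the
strained set. -/
theorem compl_strainedSet_eq_iUnion (hX : IsGCBA X) (k : ℕ) :
    ∃ A : ℕ → Set X, (strainedSet k X)ᶜ = ⋃ i, A i ∧
      ∀ i, ∃ K : Set (EuclideanSpace ℝ (Fin (k - 1))), IsCompact K ∧
        BiLipschitzEquivalent (A i) K := by
  have := hX.separable
  have := hX.locallyCompact
  obtain ⟨D, hDc, hD⟩ := TopologicalSpace.exists_countable_dense X
  have := hDc.to_subtype
  refine exists_seq_iUnion_eq (P := fun A => ∃ K : Set (EuclideanSpace ℝ (Fin (k - 1))),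
      IsCompact K ∧ BiLipschitzEquivalent A K)
    ⟨∅, isCompact_empty, Equiv.equivOfIsEmpty _ _, 1, one_pos, fun a => a.2.elim⟩
    (ι := (ℕ × ℕ × ℕ × ℕ × ℕ) × D × (Fin (k - 1) → D))
    (fun i => closure (injectivitySet X i.1.1 (1 / ((i.1.2.1 : ℝ) + 1)) i.1.2.2.1
        (fun j => (i.2.2 j : X)) ∩ closedBall i.2.1 (1 / ((i.1.2.2.2.1 : ℝ) + 1))) ∩
      (interior (strainedNear k (1 / ((i.1.2.2.2.2 : ℝ) + 1)) X))ᶜ) fun x hx => ?_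
  obtain ⟨l, n, N, p, hxE⟩ := exists_mem_injectivitySet hX hx hD
  obtain ⟨R, C, hB⟩ := hX.exists_niceBall x
  obtain ⟨n', hn'⟩ := exists_notMem_strainedNear
    (fun h => hx ((hB.mem_strainedSet_iff hX.complete).2 h))
  obtain ⟨ρ, hρ, hcomp⟩ := Metric.exists_isCompact_closedBall x
  obtain ⟨m, hm⟩ := exists_nat_one_div_lt
    (show 0 < min ρ (1 / ((N : ℝ) + 1)) / 2 by positivity)
  have hm1 : 2 * (1 / ((m : ℝ) + 1)) < ρ := by linarith [min_le_left ρ (1 / ((N : ℝ) + 1))]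
  have hm2 : 2 * (1 / ((m : ℝ) + 1)) < 1 / ((N : ℝ) + 1) := by
    linarith [min_le_right ρ (1 / ((N : ℝ) + 1))]
  obtain ⟨d, hd, hxd⟩ := hD.exists_dist_lt x (show 0 < 1 / ((m : ℝ) + 1) by positivity)
  have hdball : IsCompact (closedBall d (1 / ((m : ℝ) + 1))) := by
    refine hcomp.of_isClosed_subset isClosed_closedBall (closedBall_subset_closedBall' ?_)
    rw [dist_comm d x]
    linarith
  refine ⟨⟨⟨l, n, N, m, n'⟩, ⟨d, hd⟩, p⟩, ⟨subset_closure ⟨hxE, ?_⟩,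
    fun h => hn' (interior_subset h)⟩, ?_, ?_⟩
  · exact mem_closedBall.2 hxd.le
  · -- `strainedSet` is contained in the interior of each `strainedNear`
    rintro y ⟨-, hy⟩ hyk
    obtain ⟨R', C', hB'⟩ := hX.exists_niceBall y
    have h1 := (hB'.mem_strainedSet_iff hX.complete).1 hyk (1 / ((n' : ℝ) + 1) / 2) (by positivity)
    have h2 := strainedNear_subset_interior k (by positivity) h1
    rw [mul_div_cancel₀ _ two_ne_zero] at h2
    exact hy h2
  · refine exists_biLipschitzEquivalent_of_distMap (fun j => (p j : X))
      (show (0 : ℝ) < N + 1 by positivity) ?_ inter_subset_left ?_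
    · refine hdball.of_isClosed_subset (isClosed_closure.inter isOpen_interior.isClosed_compl) ?_
      exact inter_subset_left.trans (closure_minimal inter_subset_right isClosed_closedBall)
    · rintro a ⟨ha, had⟩ b ⟨hb, hbd⟩
      refine ha.2 b hb.1 ?_
      have := dist_triangle_right a b d
      rw [mem_closedBall] at had hbd
      linarith

end

end

end GCBA

theorem theorem1p6 {X : Type u} [MetricSpace X] (hX : GCBA.IsGCBA X) (k : ℕ) (hk : 1 ≤ k) :
    (∃ A : ℕ → Set X,
      (GCBA.strainedSet k X)ᶜ = ⋃ i, A i ∧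
      ∀ i, ∃ K : Set (EuclideanSpace ℝ (Fin (k - 1))),
        IsCompact K ∧ GCBA.BiLipschitzEquivalent (A i) K) ∧
    GCBA.CountablyRectifiable (k - 1) (GCBA.strainedSet k X)ᶜ := by
  obtain ⟨A, hA, h⟩ := GCBA.compl_strainedSet_eq_iUnion hX k
  refine ⟨⟨A, hA, h⟩, ?_⟩
  choose K hK hAK using h
  choose f hf hfA using fun i => (hAK i).exists_lipschitz
  exact ⟨K, f, fun i => (hK i).isBounded, hf, by rw [hA]; simp only [hfA]⟩
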